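/- Let $N\ge 0$. Write points of $\mathbb{R}^{2N}$ as $u=(q_1,\dots,q_N,p_1,\dots,p_N)$, let $u'Jv=\sum_{i=1}^N(q_i\tilde p_i-p_i\tilde q_i)$ for $v=(\tilde q,\tilde p)$, and let $dx=(2\pi)^{-N}d^{2N}x$ be normalized Lebesgue measure. Let $\mathcal{S}_2=\mathcal{S}(\mathbb{R}^{2N})$ be the complex Schwartz space and $\mathcal{S}_2'$ the space of tempered distributions, where $f\in\mathcal{S}_2$ is identified with the distribution $h\mapsto\int f(x)h(x)\,dx$, and likewise for other functions. For $f,g\in\mathcal{S}_2$ the twisted product is $$(f\times g)(u)=\iint f(u+s)\,g(u+t)\,e^{is'Jt}\,ds\,dt ,$$ which lies in $\mathcal{S}_2$. For $T\in\mathcal{S}_2'$ and $f\in\mathcal{S}_2$ define $T\times f,\ f\times T\in\mathcal{S}_2'$ by $\langle T\times f,h\rangle=\langle T,f\times h\rangle$ and $\langle f\times T,h\rangle=\langle T,h\times f\rangle$ for $h\in\mathcal{S}_2$. The Moyal algebra is $$\mathcal{M}=\{S\in\mathcal{S}_2' : S\times f\in\mathcal{S}_2 \text{ and } f\times S\in\mathcal{S}_2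 \text{ for all } f\in\mathcal{S}_2\}.$$ Let $\mathcal{E}_2$ be the space of smooth functions on $\mathbb{R}^{2N}$ with the topology of uniform convergence of all derivatives on compact sets. For $k,m\in\mathbb{N}$ let $\mathcal{V}_k^m$ (respectively $\mathcal{S}_{-k}^m$) be the space of $C^m$ functions $f$ such that $(1+|u|^2)^{-k-|\alpha|/2}\,\partial^\alpha f(u)$ (respectively $(1+|u|^2)^{-k}\,\partial^\alpha f(u)$) vanishes at infinity for all $|\alpha|\le m$, with the corresponding supremum norm. Put $$\mathcal{O}_T=\bigcup_k\bigcap_m\mathcal{V}_k^m,\qquad \mathcal{O}_M=\bigcap_m\bigcup_k\mathcal{S}_{-k}^m ,$$ with projective topologies on the intersections and locally convex inductive topologies on the unions. Elements of the dual spaces $\mathcal{E}_2'$ (the distributions of compact support), $\mathcal{O}_M'$ and $\mathcal{O}_T'$ are regarded as tempered distributions by restricting them to $\mathcal{S}_2$. **Theorem.** (1) The spaces $\mathcal{E}_2'$, $\mathcal{O}_M'$ and $\mathcal{O}_T'$ are contained in $\mathcal{M}$. (2) Let $S\in\mathcal{O}_T'$ and $T\in\mathcal{S}_2'$. For every $h\in\mathcal{S}_2$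 the distributions $T\times h$ and $h\times T$ are functions in $\mathcal{O}_T$, and there are unique tempered distributions $S\times T$ and $T\times S$ with $$\langle S\times T,h\rangle=\langle S,T\times h\rangle,\qquad \langle T\times S,h\rangle=\langle S,h\times T\rangle\qquad(h\in\mathcal{S}_2).$$ (3) For all $S\in\mathcal{O}_T'$ and $h\in\mathcal{S}_2$ the products $S\times h$ and $h\times S$ lie in $\mathcal{S}_2$. For these products the definition in (2) (with $T=h$) agrees with the earlier one for a tempered distribution and a Schwartz function. Moreover $$\langle T\times S,h\rangle=\langle T,S\times h\rangle,\qquad \langle S\times T,h\rangle=\langle T,h\times S\rangle\qquad\text{for all } T\in\mathcal{S}_2'.$$ -/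

import Mathlib

open MeasureTheory Filter Topology
open scoped SchwartzMap ContDiff

namespace TwistedIntegral

variable {E V₁ V₂ V : Type} [NormedAddCommGroup E] [NormedSpace ℝ E] [FiniteDimensional ℝ E]
  [MeasurableSpace E] [BorelSpace E]
  [NormedAddCommGroup V₁] [NormedSpace ℝ V₁] [NormedAddCommGroup V₂] [NormedSpace ℝ V₂]
  [NormedAddCommGroup V] [NormedSpace ℝ V] [NormedSpace ℂ V] [SMulCommClass ℝ ℂ V] [IsScalarTower ℝ ℂ V]

set_option linter.unusedSectionVars false

noncomputable section

/-- The integrand `e^{i B(u,t)} L(f(t), g(u+t))`. -/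
def integrand (B : E →L[ℝ] E →L[ℝ] ℝ) (L : V₁ →L[ℝ] V₂ →L[ℝ] V)
    (f : 𝓢(E, V₁)) (g : 𝓢(E, V₂)) (u t : E) : V :=
  Complex.exp (B u t * Complex.I) • L (f t) (g (u + t))

theorem norm_integrand (B : E →L[ℝ] E →L[ℝ] ℝ) (L : V₁ →L[ℝ] V₂ →L[ℝ] V)
    (f : 𝓢(E, V₁)) (g : 𝓢(E, V₂)) (u t : E) :
    ‖integrand B L f g u t‖ ≤ ‖L‖ * ‖f t‖ * ‖g (u + t)‖ := by
  rw [integrand, norm_smul, Complex.norm_exp_ofReal_mul_I, one_mul]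
  exact L.le_opNorm₂ _ _

theorem exists_norm_integrand_le (B : E →L[ℝ] E →L[ℝ] ℝ) (L : V₁ →L[ℝ] V₂ →L[ℝ] V)
    (f : 𝓢(E, V₁)) (g : 𝓢(E, V₂)) :
    ∃ C, ∀ u t, ‖integrand B L f g u t‖ ≤ C * ‖f t‖ := by
  refine ⟨‖L‖ * SchwartzMap.seminorm ℝ 0 0 g, fun u t => (norm_integrand B L f g u t).trans ?_⟩
  rw [mul_right_comm]
  gcongr
  exact SchwartzMap.norm_le_seminorm ℝ g _

theorem continuous_integrand (B : E →L[ℝ] E →L[ℝ] ℝ) (L : V₁ →L[ℝ] V₂ →L[ℝ] V)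
    (f : 𝓢(E, V₁)) (g : 𝓢(E, V₂)) (u : E) : Continuous (integrand B L f g u) := by
  have hf := f.continuous
  have hg := g.continuous
  unfold integrand
  fun_prop

theorem integrable_integrand (μ : Measure E) [μ.HasTemperateGrowth]
    (B : E →L[ℝ] E →L[ℝ] ℝ) (L : V₁ →L[ℝ] V₂ →L[ℝ] V)
    (f : 𝓢(E, V₁)) (g : 𝓢(E, V₂)) (u : E) : Integrable (integrand B L f g u) μ := by
  obtain ⟨C, hC⟩ := exists_norm_integrand_le B L f g
  exact Integrable.mono' ((f.integrable (μ := μ)).norm.const_mul C)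
    (continuous_integrand B L f g u).aestronglyMeasurable (Eventually.of_forall (hC u))

/-- The bilinear map in the first term of the derivative of the integral. -/
def derivMap₁ (E : Type) [NormedAddCommGroup E] [NormedSpace ℝ E] (L : V₁ →L[ℝ] V₂ →L[ℝ] V) :
    V₁ →L[ℝ] (E →L[ℝ] V₂) →L[ℝ] (E →L[ℝ] V) :=
  (ContinuousLinearMap.compL ℝ E V₂ V).comp L

/-- The bilinear map in the second term of the derivative of the integral. -/
def derivMap₂ (E : Type) [NormedAddCommGroup E] [NormedSpace ℝ E] (L : V₁ →L[ℝ] V₂ →L[ℝ] V) :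
    (E →L[ℝ] V₁) →L[ℝ] V₂ →L[ℝ] (E →L[ℝ] V) :=
  Complex.I • ((ContinuousLinearMap.compL ℝ E V₁ V).comp L.flip).flip

theorem hasFDerivAt_integrand (B : E →L[ℝ] E →L[ℝ] ℝ) (L : V₁ →L[ℝ] V₂ →L[ℝ] V)
    (f : 𝓢(E, V₁)) (g : 𝓢(E, V₂)) (u t : E) :
    HasFDerivAt (fun u => integrand B L f g u t)
      (integrand B (derivMap₁ E L) f (SchwartzMap.fderivCLM ℝ E V₂ g) u t +
        integrand B (derivMap₂ E L) (SchwartzMap.smulRightCLM ℝ V₁ B.flip f) g u t) u := by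
  have h1 : HasFDerivAt (fun u => Complex.exp (B u t * Complex.I))
      ((Complex.exp (B u t * Complex.I) * Complex.I) • Complex.ofRealCLM.comp (B.flip t)) u := by
    have h0 : HasFDerivAt (fun u => (B u t : ℂ)) (Complex.ofRealCLM.comp (B.flip t)) u :=
      (Complex.ofRealCLM.comp (B.flip t)).hasFDerivAt
    have := (h0.mul_const Complex.I).cexp
    convert! this using 1
    ext v
    simp
    ring
  have h2 : HasFDerivAt (fun u => L (f t) (g (u + t))) ((L (f t)).comp (fderiv ℝ g (u + t))) u := by
    have : HasFDerivAt g (fderiv ℝ g (u + t)) (u + t) := g.differentiableAt.hasFDerivAt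
    have h3 := this.comp u ((hasFDerivAt_id u).add_const t)
    exact (L (f t)).hasFDerivAt.comp u (by simpa using! h3)
  have h3 := h1.smul h2
  convert! h3 using 1
  ext v
  simp [integrand, derivMap₁, derivMap₂]
  rw [← algebraMap_smul ℂ (B v t), Complex.coe_algebraMap, smul_smul, smul_smul, mul_assoc]

theorem hasFDerivAt_integral (μ : Measure E) [μ.HasTemperateGrowth]
    (B : E →L[ℝ] E →L[ℝ] ℝ) (L : V₁ →L[ℝ] V₂ →L[ℝ] V)
    (f : 𝓢(E, V₁)) (g : 𝓢(E, V₂)) (u : E) :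
    HasFDerivAt (fun u => ∫ t, integrand B L f g u t ∂μ)
      (∫ t, integrand B (derivMap₁ E L) f (SchwartzMap.fderivCLM ℝ E V₂ g) u t ∂μ +
        ∫ t, integrand B (derivMap₂ E L) (SchwartzMap.smulRightCLM ℝ V₁ B.flip f) g u t ∂μ) u := by
  rw [← integral_add (integrable_integrand μ B _ _ _ u) (integrable_integrand μ B _ _ _ u)]
  obtain ⟨C₁, hC₁⟩ := exists_norm_integrand_le B (derivMap₁ E L) f (SchwartzMap.fderivCLM ℝ E V₂ g)
  obtain ⟨C₂, hC₂⟩ := exists_norm_integrand_le B (derivMap₂ E L)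
    (SchwartzMap.smulRightCLM ℝ V₁ B.flip f) g
  refine hasFDerivAt_integral_of_dominated_of_fderiv_le (s := Set.univ) (𝕜 := ℝ)
    (F' := fun u t => integrand B (derivMap₁ E L) f (SchwartzMap.fderivCLM ℝ E V₂ g) u t +
        integrand B (derivMap₂ E L) (SchwartzMap.smulRightCLM ℝ V₁ B.flip f) g u t)
    (bound := fun t => C₁ * ‖f t‖ + C₂ * ‖SchwartzMap.smulRightCLM ℝ V₁ B.flip f t‖) Filter.univ_mem
    (Eventually.of_forall fun x => (continuous_integrand B L f g x).aestronglyMeasurable)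
    (integrable_integrand μ B _ _ _ u)
    ?_
    (Eventually.of_forall fun t x _ => ?_) ?_
    (Eventually.of_forall fun t x _ => hasFDerivAt_integrand B L f g x t)
  · exact (integrable_integrand μ B _ _ _ u).1.add (integrable_integrand μ B _ _ _ u).1
  · exact (norm_add_le _ _).trans (add_le_add (hC₁ x t) (hC₂ x t))
  · exact ((f.integrable (μ := μ)).norm.const_mul _).add
      (((SchwartzMap.smulRightCLM ℝ V₁ B.flip f).integrable (μ := μ)).norm.const_mul _)

/-- The bound on the integral itself. -/
theorem exists_bound_zero (μ : Measure E) [μ.HasTemperateGrowth]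
    (B : E →L[ℝ] E →L[ℝ] ℝ) (L : V₁ →L[ℝ] V₂ →L[ℝ] V) (k : ℕ) :
    ∃ (p : Seminorm ℝ 𝓢(E, V₁)) (q : Seminorm ℝ 𝓢(E, V₂)), Continuous p ∧ Continuous q ∧
      ∀ (f : 𝓢(E, V₁)) (g : 𝓢(E, V₂)) (u : E),
        ‖u‖ ^ k * ‖∫ t, integrand B L f g u t ∂μ‖ ≤ p f * q g := by
  set r := μ.integrablePower
  set I : ℝ := ∫ t, (1 + ‖t‖) ^ (-(r : ℝ)) ∂μ with hI
  have hI0 : 0 ≤ I := integral_nonneg fun t => by positivity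
  let P (W : Type) [NormedAddCommGroup W] [NormedSpace ℝ W] (m : ℕ × ℕ) : Seminorm ℝ 𝓢(E, W) :=
    (Finset.Iic m).sup (fun m => SchwartzMap.seminorm ℝ m.1 m.2)
  have hP (W : Type) [NormedAddCommGroup W] [NormedSpace ℝ W] (m : ℕ × ℕ) : Continuous (P W m) := by
    have h (i : ℕ × ℕ) : Continuous (SchwartzMap.seminorm ℝ i.1 i.2 : Seminorm ℝ 𝓢(E, W)) :=
      (schwartz_withSeminorms ℝ E W).continuous_seminorm i
    have h' : ∀ s : Finset (ℕ × ℕ), Continuous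
        (s.sup (fun m => SchwartzMap.seminorm ℝ m.1 m.2) : Seminorm ℝ 𝓢(E, W)) := by
      intro s
      classical
      induction s using Finset.induction with
      | empty => simpa using! continuous_const
      | insert a s ha ih => 
        rw [Finset.sup_insert]
        exact (h a).sup ih
    exact h' _
  refine ⟨(‖L‖₊ * 2 ^ (k + r) * I.toNNReal : NNReal) • P V₁ (k + r, 0),
    (2 ^ k : NNReal) • P V₂ (k, 0), (hP _ _).const_smul _, (hP _ _).const_smul _, fun f g u => ?_⟩
  have hb : ∀ t, ‖u‖ ^ k * ‖integrand B L f g u t‖ ≤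
      (‖L‖ * (2 ^ (k + r) * P V₁ (k + r, 0) f) * (2 ^ k * P V₂ (k, 0) g)) *
        (1 + ‖t‖) ^ (-(r : ℝ)) := fun t => by
    have h1 := SchwartzMap.one_add_le_sup_seminorm_apply (𝕜 := ℝ) (m := (k + r, 0)) le_rfl le_rfl f t
    have h2 := SchwartzMap.one_add_le_sup_seminorm_apply (𝕜 := ℝ) (m := (k, 0)) le_rfl le_rfl g (u + t)
    rw [norm_iteratedFDeriv_zero] at h1 h2
    have hu : ‖u‖ ≤ (1 + ‖t‖) * (1 + ‖u + t‖) := by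
      have := norm_sub_le (u + t) t
      rw [add_sub_cancel_right] at this
      nlinarith [norm_nonneg t, norm_nonneg (u + t)]
    have ht : 0 < (1 + ‖t‖) := by positivity
    rw [Real.rpow_neg ht.le, Real.rpow_natCast, ← div_eq_mul_inv, le_div_iff₀ (by positivity)]
    calc ‖u‖ ^ k * ‖integrand B L f g u t‖ * (1 + ‖t‖) ^ r
        ≤ ((1 + ‖t‖) * (1 + ‖u + t‖)) ^ k * (‖L‖ * ‖f t‖ * ‖g (u + t)‖) * (1 + ‖t‖) ^ r := by
          gcongr
          exact norm_integrand B L f g u t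
      _ = ‖L‖ * ((1 + ‖t‖) ^ (k + r) * ‖f t‖) * ((1 + ‖u + t‖) ^ k * ‖g (u + t)‖) := by
          rw [mul_pow, pow_add]; ring
      _ ≤ _ := by gcongr
  calc ‖u‖ ^ k * ‖∫ t, integrand B L f g u t ∂μ‖
      ≤ ‖u‖ ^ k * ∫ t, ‖integrand B L f g u t‖ ∂μ := by
        gcongr; exact norm_integral_le_integral_norm _
    _ = ∫ t, ‖u‖ ^ k * ‖integrand B L f g u t‖ ∂μ := (integral_const_mul _ _).symm
    _ ≤ ∫ t, (‖L‖ * (2 ^ (k + r) * P V₁ (k + r, 0) f) * (2 ^ k * P V₂ (k, 0) g)) *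
        (1 + ‖t‖) ^ (-(r : ℝ)) ∂μ :=
        integral_mono ((integrable_integrand μ B L f g u).norm.const_mul _)
          (Measure.integrable_pow_neg_integrablePower μ |>.const_mul _) hb
    _ = _ := by
        rw [integral_const_mul, ← hI]
        simp [NNReal.smul_def, hI0]
        ring

/-- The bound on all derivatives of the integral, by induction on the order. -/
theorem exists_bound (μ : Measure E) [μ.HasTemperateGrowth] (B : E →L[ℝ] E →L[ℝ] ℝ) (k n : ℕ) :
    ∀ {V₁ V₂ V : Type} [NormedAddCommGroup V₁] [NormedSpace ℝ V₁] [NormedAddCommGroup V₂]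
      [NormedSpace ℝ V₂] [NormedAddCommGroup V] [NormedSpace ℝ V] [NormedSpace ℂ V]
      [SMulCommClass ℝ ℂ V] [IsScalarTower ℝ ℂ V] (L : V₁ →L[ℝ] V₂ →L[ℝ] V),
    ∃ (p : Seminorm ℝ 𝓢(E, V₁)) (q : Seminorm ℝ 𝓢(E, V₂)), Continuous p ∧ Continuous q ∧
      ∀ (f : 𝓢(E, V₁)) (g : 𝓢(E, V₂)), ContDiff ℝ n (fun u => ∫ t, integrand B L f g u t ∂μ) ∧
        ∀ u : E, ‖u‖ ^ k * ‖iteratedFDeriv ℝ n (fun u => ∫ t, integrand B L f g u t ∂μ) u‖ ≤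
          p f * q g := by
  induction n with
  | zero =>
    intro V₁ V₂ V _ _ _ _ _ _ _ _ _ L
    obtain ⟨p, q, hp, hq, h⟩ := exists_bound_zero μ B L k
    refine ⟨p, q, hp, hq, fun f g => ⟨?_, fun u => ?_⟩⟩
    · exact contDiff_zero.2 (continuous_iff_continuousAt.2 fun u =>
        (hasFDerivAt_integral μ B L f g u).continuousAt)
    · rw [norm_iteratedFDeriv_zero]
      exact h f g u
  | succ n ih =>
    intro V₁ V₂ V _ _ _ _ _ _ _ _ _ L
    obtain ⟨p₁, q₁, hp₁, hq₁, h₁⟩ := ih (derivMap₁ E L)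
    obtain ⟨p₂, q₂, hp₂, hq₂, h₂⟩ := ih (derivMap₂ E L)
    refine ⟨p₁ + p₂.comp (SchwartzMap.smulRightCLM ℝ V₁ B.flip).toLinearMap,
      q₁.comp (SchwartzMap.fderivCLM ℝ E V₂).toLinearMap + q₂,
      hp₁.add (hp₂.comp (SchwartzMap.smulRightCLM ℝ V₁ B.flip).continuous),
      (hq₁.comp (SchwartzMap.fderivCLM ℝ E V₂).continuous).add hq₂, fun f g => ?_⟩
    have hd : fderiv ℝ (fun u => ∫ t, integrand B L f g u t ∂μ) =
        (fun u => ∫ t, integrand B (derivMap₁ E L) f (SchwartzMap.fderivCLM ℝ E V₂ g) u t ∂μ) +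
        fun u => ∫ t, integrand B (derivMap₂ E L)
          (SchwartzMap.smulRightCLM ℝ V₁ B.flip f) g u t ∂μ :=
      funext fun u => (hasFDerivAt_integral μ B L f g u).fderiv
    obtain ⟨c₁, b₁⟩ := h₁ f (SchwartzMap.fderivCLM ℝ E V₂ g)
    obtain ⟨c₂, b₂⟩ := h₂ (SchwartzMap.smulRightCLM ℝ V₁ B.flip f) g
    refine ⟨?_, fun u => ?_⟩
    · rw [Nat.cast_succ, contDiff_succ_iff_fderiv]
      refine ⟨fun u => (hasFDerivAt_integral μ B L f g u).differentiableAt, by simp, ?_⟩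
      rw [hd]
      exact c₁.add c₂
    · rw [← norm_iteratedFDeriv_fderiv, hd, iteratedFDeriv_add c₁ c₂]
      have h3 := mul_le_mul_of_nonneg_left (norm_add_le
        (iteratedFDeriv ℝ n (fun u => ∫ t, integrand B (derivMap₁ E L) f
          (SchwartzMap.fderivCLM ℝ E V₂ g) u t ∂μ) u)
        (iteratedFDeriv ℝ n (fun u => ∫ t, integrand B (derivMap₂ E L)
          (SchwartzMap.smulRightCLM ℝ V₁ B.flip f) g u t ∂μ) u)) (pow_nonneg (norm_nonneg u) k)
      refine h3.trans ?_
      rw [mul_add]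
      refine (add_le_add (b₁ u) (b₂ u)).trans ?_
      change _ ≤ (p₁ f + p₂ (SchwartzMap.smulRightCLM ℝ V₁ B.flip f)) *
        (q₁ (SchwartzMap.fderivCLM ℝ E V₂ g) + q₂ g)
      nlinarith [mul_nonneg (apply_nonneg p₁ f) (apply_nonneg q₂ g),
        mul_nonneg (apply_nonneg p₂ (SchwartzMap.smulRightCLM ℝ V₁ B.flip f))
          (apply_nonneg q₁ (SchwartzMap.fderivCLM ℝ E V₂ g))]

end

end TwistedIntegral

namespace Moyal

noncomputable section

/-- Phase space `ℝ^{2N}`: the coordinates `inl i` are the `q_i`, the coordinates `inr i` the `p_i`. -/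
abbrev PhaseSpace (N : ℕ) : Type := EuclideanSpace ℝ (Fin N ⊕ Fin N)

/-- The symplectic scalar product `u'Jv = ∑ i, (q_i p̃_i - p_i q̃_i)`. -/
def symp {N : ℕ} (u v : PhaseSpace N) : ℝ :=
  ∑ i : Fin N, (u (Sum.inl i) * v (Sum.inr i) - u (Sum.inr i) * v (Sum.inl i))

/-- The normalized Haar measure `dx = (2π)^{-N} d^{2N}x`. -/
def phaseMeasure (N : ℕ) : Measure (PhaseSpace N) :=
  ENNReal.ofReal ((2 * Real.pi) ^ N)⁻¹ • volume

instance instIsAddHaarMeasurePhaseMeasure (N : ℕ) : (phaseMeasure N).IsAddHaarMeasure :=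
  Measure.IsAddHaarMeasure.smul _ (by simp; positivity) ENNReal.ofReal_ne_top

/-- The symplectic scalar product as a continuous bilinear form. -/
def sympCLM (N : ℕ) : PhaseSpace N →L[ℝ] PhaseSpace N →L[ℝ] ℝ :=
  (LinearMap.mk₂ ℝ symp
    (fun u u' v => by
      simp only [symp, PiLp.add_apply, ← Finset.sum_add_distrib]
      exact Finset.sum_congr rfl fun i _ => by ring)
    (fun c u v => by
      simp only [symp, PiLp.smul_apply, smul_eq_mul, Finset.mul_sum]
      exact Finset.sum_congr rfl fun i _ => by ring)
    (fun u v v' => by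
      simp only [symp, PiLp.add_apply, ← Finset.sum_add_distrib]
      exact Finset.sum_congr rfl fun i _ => by ring)
    (fun c u v => by
      simp only [symp, PiLp.smul_apply, smul_eq_mul, Finset.mul_sum]
      exact Finset.sum_congr rfl fun i _ => by ring)).toContinuousBilinearMap

theorem sympCLM_apply {N : ℕ} (u v : PhaseSpace N) : sympCLM N u v = symp u v := rfl

/-- The linear map `(q, p) ↦ (p, -q) / 2π`, which turns the Fourier transform of Mathlib into a
symplectic Fourier transform. -/
def rotate (N : ℕ) : PhaseSpace N ≃L[ℝ] PhaseSpace N :=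
  (LinearEquiv.ofLinearMap
    { toFun := fun s => WithLp.toLp 2 (Sum.elim (fun i => (2 * Real.pi)⁻¹ * s (Sum.inr i))
        fun i => -((2 * Real.pi)⁻¹ * s (Sum.inl i)))
      map_add' := fun s t => by ext (i | i) <;> simp <;> ring
      map_smul' := fun c s => by ext (i | i) <;> simp <;> ring }
    { toFun := fun s => WithLp.toLp 2 (Sum.elim (fun i => -(2 * Real.pi * s (Sum.inr i)))
        fun i => 2 * Real.pi * s (Sum.inl i))
      map_add' := fun s t => by ext (i | i) <;> simp <;> ring
      map_smul' := fun c s => by ext (i | i) <;> simp <;> ring }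
    (by ext s (i | i) <;> simp <;> field_simp)
    (by ext s (i | i) <;> simp <;> field_simp)).toContinuousLinearEquiv

theorem inner_rotate {N : ℕ} (s w : PhaseSpace N) :
    inner ℝ w (rotate N s) = -(2 * Real.pi)⁻¹ * symp s w := by
  simp only [rotate, PiLp.inner_apply, Fintype.sum_sum_type, symp, Finset.mul_sum]
  rw [← Finset.sum_add_distrib]
  refine Finset.sum_congr rfl fun i _ => ?_
  simp
  ring

/-- The symplectic Fourier transform `g ↦ (s ↦ ∫ g(w) e^{i s'Jw} dw)` on the Schwartz space. -/
def sympFourier (N : ℕ) : 𝓢(PhaseSpace N, ℂ) →L[ℂ] 𝓢(PhaseSpace N, ℂ) :=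
  (((2 * Real.pi) ^ N)⁻¹ : ℂ) • (SchwartzMap.compCLMOfContinuousLinearEquiv ℂ (rotate N)).comp
    (FourierTransform.fourierCLM ℂ 𝓢(PhaseSpace N, ℂ))

theorem sympFourier_apply {N : ℕ} (g : 𝓢(PhaseSpace N, ℂ)) (s : PhaseSpace N) :
    sympFourier N g s = ∫ w, g w * Complex.exp (Complex.I * symp s w) ∂phaseMeasure N := by
  have h : sympFourier N g s = (((2 * Real.pi) ^ N)⁻¹ : ℂ) * FourierTransform.fourier
    (g : PhaseSpace N → ℂ) (rotate N s) := rfl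
  rw [h, phaseMeasure, integral_smul_measure, ENNReal.toReal_ofReal (by positivity),
    Real.fourier_eq, Complex.real_smul]
  congr 1
  · push_cast; rfl
  · refine integral_congr_ae (Eventually.of_forall fun w => ?_)
    simp only [Circle.smul_def, Real.fourierChar_apply, inner_rotate, smul_eq_mul]
    rw [mul_comm]
    congr 2
    push_cast
    have : (Real.pi : ℂ) ≠ 0 := by exact_mod_cast Real.pi_ne_zero
    field_simp

/-- The double integral defining the twisted product, written as a single integral. -/
theorem twisted_integral_eq {N : ℕ} (f g : 𝓢(PhaseSpace N, ℂ)) (u : PhaseSpace N) :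
    ∫ s, ∫ t, f (u + s) * g (u + t) * Complex.exp (Complex.I * symp s t)
      ∂phaseMeasure N ∂phaseMeasure N =
    ∫ s, TwistedIntegral.integrand (sympCLM N) (ContinuousLinearMap.mul ℝ ℂ)
      (sympFourier N g) f u s ∂phaseMeasure N := by
  refine integral_congr_ae (Eventually.of_forall fun s => ?_)
  have h1 : ∫ t, g (u + t) * Complex.exp (Complex.I * symp s t) ∂phaseMeasure N =
      Complex.exp (Complex.I * symp u s) * sympFourier N g s := by
    rw [sympFourier_apply, ← integral_const_mul, ← integral_add_left_eq_self (μ := phaseMeasure N)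
      (fun w => Complex.exp (Complex.I * symp u s) *
        (g w * Complex.exp (Complex.I * symp s w))) u]
    refine integral_congr_ae (Eventually.of_forall fun t => ?_)
    have h2 : symp s (u + t) = symp s t - symp u s := by
      simp only [symp, PiLp.add_apply, ← Finset.sum_sub_distrib]
      exact Finset.sum_congr rfl fun i _ => by ring
    simp only [h2]
    rw [mul_left_comm, ← Complex.exp_add]
    congr 2
    push_cast
    ring
  simp only [mul_assoc]
  rw [integral_const_mul, h1]
  simp only [TwistedIntegral.integrand, sympCLM_apply, ContinuousLinearMap.mul_apply',
    smul_eq_mul]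
  rw [mul_comm Complex.I]
  ring

theorem exists_twisted_bound (N k n : ℕ) :
    ∃ p q : Seminorm ℝ 𝓢(PhaseSpace N, ℂ), Continuous p ∧ Continuous q ∧
      ∀ f g : 𝓢(PhaseSpace N, ℂ),
        ContDiff ℝ n (fun u => ∫ s, ∫ t, f (u + s) * g (u + t) * Complex.exp (Complex.I * symp s t)
          ∂phaseMeasure N ∂phaseMeasure N) ∧
        ∀ u, ‖u‖ ^ k * ‖iteratedFDeriv ℝ n (fun u => ∫ s, ∫ t, f (u + s) * g (u + t) *
          Complex.exp (Complex.I * symp s t) ∂phaseMeasure N ∂phaseMeasure N) u‖ ≤ p f * q g := by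
  obtain ⟨p, q, hp, hq, h⟩ := TwistedIntegral.exists_bound (phaseMeasure N) (sympCLM N) k n
    (ContinuousLinearMap.mul ℝ ℂ)
  refine ⟨q, p.comp (((sympFourier N).restrictScalars ℝ).toLinearMap), hq,
    hp.comp (sympFourier N).continuous, fun f g => ?_⟩
  simp only [twisted_integral_eq, mul_comm (q f)]
  exact h (sympFourier N g) f

/-- The twisted product `(f × g)(u) = ∬ f(u+s) g(u+t) e^{i s'Jt} ds dt` of Schwartz functions. -/
def twistedProduct {N : ℕ} (f g : 𝓢(PhaseSpace N, ℂ)) : 𝓢(PhaseSpace N, ℂ) where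
  toFun u := ∫ s, ∫ t, f (u + s) * g (u + t) * Complex.exp (Complex.I * symp s t)
    ∂phaseMeasure N ∂phaseMeasure N
  smooth' := contDiff_infty.2 fun n => by
    obtain ⟨p, q, -, -, h⟩ := exists_twisted_bound N 0 n
    exact (h f g).1
  decay' k n := by
    obtain ⟨p, q, -, -, h⟩ := exists_twisted_bound N k n
    exact ⟨_, (h f g).2⟩

theorem twistedProduct_eq {N : ℕ} (f g : 𝓢(PhaseSpace N, ℂ)) (u : PhaseSpace N) :
    twistedProduct f g u = ∫ s, TwistedIntegral.integrand (sympCLM N) (ContinuousLinearMap.mul ℝ ℂ)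
      (sympFourier N g) f u s ∂phaseMeasure N :=
  twisted_integral_eq f g u

theorem twistedProduct_add_left {N : ℕ} (f f' g : 𝓢(PhaseSpace N, ℂ)) :
    twistedProduct (f + f') g = twistedProduct f g + twistedProduct f' g := by
  ext u
  rw [add_apply, twistedProduct_eq, twistedProduct_eq, twistedProduct_eq,
    ← integral_add (TwistedIntegral.integrable_integrand _ _ _ _ _ u)
      (TwistedIntegral.integrable_integrand _ _ _ _ _ u)]
  simp [TwistedIntegral.integrand, mul_add]

theorem twistedProduct_add_right {N : ℕ} (f g g' : 𝓢(PhaseSpace N, ℂ)) :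
    twistedProduct f (g + g') = twistedProduct f g + twistedProduct f g' := by
  ext u
  rw [add_apply, twistedProduct_eq, twistedProduct_eq, twistedProduct_eq,
    ← integral_add (TwistedIntegral.integrable_integrand _ _ _ _ _ u)
      (TwistedIntegral.integrable_integrand _ _ _ _ _ u)]
  simp [TwistedIntegral.integrand, mul_add]

theorem twistedProduct_smul_left {N : ℕ} (c : ℂ) (f g : 𝓢(PhaseSpace N, ℂ)) :
    twistedProduct (c • f) g = c • twistedProduct f g := by
  ext u
  rw [smul_apply, twistedProduct_eq, twistedProduct_eq, ← integral_smul]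
  simp [TwistedIntegral.integrand, mul_left_comm]

theorem twistedProduct_smul_right {N : ℕ} (c : ℂ) (f g : 𝓢(PhaseSpace N, ℂ)) :
    twistedProduct f (c • g) = c • twistedProduct f g := by
  ext u
  rw [smul_apply, twistedProduct_eq, twistedProduct_eq, ← integral_smul]
  simp [TwistedIntegral.integrand, mul_left_comm, mul_assoc]

/-- A linear map of the Schwartz space into itself whose seminorms are bounded by continuous
seminorms is continuous. -/
theorem continuous_of_bound {N : ℕ} (A : 𝓢(PhaseSpace N, ℂ) →ₗ[ℂ] 𝓢(PhaseSpace N, ℂ))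
    (h : ∀ k n : ℕ, ∃ (C : ℝ) (p : Seminorm ℝ 𝓢(PhaseSpace N, ℂ)), 0 ≤ C ∧ Continuous p ∧ ∀ f u,
      ‖u‖ ^ k * ‖iteratedFDeriv ℝ n (A f) u‖ ≤ C * p f) : Continuous A := by
  change Continuous (A.restrictScalars ℝ)
  refine WithSeminorms.continuous_of_continuous_comp (schwartz_withSeminorms ℝ (PhaseSpace N) ℂ) _
    fun i => ?_
  obtain ⟨C, p, hC, hp, hb⟩ := h i.1 i.2
  refine Seminorm.continuous_of_le (q := C.toNNReal • p) (hp.const_smul _) fun f => ?_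
  refine SchwartzMap.seminorm_le_bound ℝ i.1 i.2 _ (apply_nonneg _ _) fun u => ?_
  simpa [NNReal.smul_def, hC] using! hb f u

/-- Left multiplication `g ↦ f × g`, as a continuous linear map of the Schwartz space. -/
def mulLeftCLM {N : ℕ} (f : 𝓢(PhaseSpace N, ℂ)) : 𝓢(PhaseSpace N, ℂ) →L[ℂ] 𝓢(PhaseSpace N, ℂ) where
  toFun g := twistedProduct f g
  map_add' := twistedProduct_add_right f
  map_smul' c g := twistedProduct_smul_right c f g
  cont := continuous_of_bound
    { toFun := fun g => twistedProduct f g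
      map_add' := twistedProduct_add_right f
      map_smul' := fun c g => twistedProduct_smul_right c f g } fun k n => by
    obtain ⟨p, q, hp, hq, h⟩ := exists_twisted_bound N k n
    exact ⟨p f, q, apply_nonneg _ _, hq, fun g => (h f g).2⟩

/-- Right multiplication `g ↦ g × f`, as a continuous linear map of the Schwartz space. -/
def mulRightCLM {N : ℕ} (f : 𝓢(PhaseSpace N, ℂ)) :
    𝓢(PhaseSpace N, ℂ) →L[ℂ] 𝓢(PhaseSpace N, ℂ) where
  toFun g := twistedProduct g f
  map_add' g g' := twistedProduct_add_left g g' f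
  map_smul' c g := twistedProduct_smul_left c g f
  cont := continuous_of_bound
    { toFun := fun g => twistedProduct g f
      map_add' := fun g g' => twistedProduct_add_left g g' f
      map_smul' := fun c g => twistedProduct_smul_left c g f } fun k n => by
    obtain ⟨p, q, hp, hq, h⟩ := exists_twisted_bound N k n
    exact ⟨q f, p, apply_nonneg _ _, hp, fun g u => ((h g f).2 u).trans_eq (mul_comm _ _)⟩

/-! ### Tempered distributions and the Moyal algebra -/

/-- The tempered distribution `h ↦ ∫ f(x) h(x) dx` of a Schwartz function `f`. -/
def ofSchwartz {N : ℕ} (f : 𝓢(PhaseSpace N, ℂ)) : 𝓢'(PhaseSpace N, ℂ) :=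
  SchwartzMap.toTemperedDistributionCLM (PhaseSpace N) ℂ (phaseMeasure N) f

/-- The tempered distribution `T × f`, given by `⟨T × f, h⟩ = ⟨T, f × h⟩`. -/
def distMul {N : ℕ} (T : 𝓢'(PhaseSpace N, ℂ)) (f : 𝓢(PhaseSpace N, ℂ)) : 𝓢'(PhaseSpace N, ℂ) :=
  PointwiseConvergenceCLM.precomp ℂ (mulLeftCLM f) T

/-- The tempered distribution `f × T`, given by `⟨f × T, h⟩ = ⟨T, h × f⟩`. -/
def mulDist {N : ℕ} (f : 𝓢(PhaseSpace N, ℂ)) (T : 𝓢'(PhaseSpace N, ℂ)) : 𝓢'(PhaseSpace N, ℂ) :=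
  PointwiseConvergenceCLM.precomp ℂ (mulRightCLM f) T

theorem distMul_apply {N : ℕ} (T : 𝓢'(PhaseSpace N, ℂ)) (f h : 𝓢(PhaseSpace N, ℂ)) :
    distMul T f h = T (twistedProduct f h) := rfl

theorem mulDist_apply {N : ℕ} (T : 𝓢'(PhaseSpace N, ℂ)) (f h : 𝓢(PhaseSpace N, ℂ)) :
    mulDist f T h = T (twistedProduct h f) := rfl

/-- The space `M_L` of the `S` such that `S × f` is a Schwartz function for all Schwartz `f`. -/
def moyalLeft (N : ℕ) : Set 𝓢'(PhaseSpace N, ℂ) :=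
  {S | ∀ f : 𝓢(PhaseSpace N, ℂ), ∃ k : 𝓢(PhaseSpace N, ℂ), distMul S f = ofSchwartz k}

/-- The space `M_R` of the `R` such that `f × R` is a Schwartz function for all Schwartz `f`. -/
def moyalRight (N : ℕ) : Set 𝓢'(PhaseSpace N, ℂ) :=
  {R | ∀ f : 𝓢(PhaseSpace N, ℂ), ∃ k : 𝓢(PhaseSpace N, ℂ), mulDist f R = ofSchwartz k}

/-- The Moyal algebra `M = M_L ∩ M_R`. -/
def moyalAlgebra (N : ℕ) : Set 𝓢'(PhaseSpace N, ℂ) :=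
  moyalLeft N ∩ moyalRight N

/-! ### Locally convex spaces of functions

All spaces of functions are subspaces of the space of all functions on `ℝ^{2N}`. Their topologies
are explicit terms, because a subspace already carries the (here irrelevant) topology of pointwise
convergence as an instance. -/

/-- The topology generated by a family of seminorms. -/
abbrev seminormTopology {ι W : Type} [Nonempty ι] [AddCommGroup W] [Module ℂ W]
    (p : SeminormFamily ℂ W ι) : TopologicalSpace W :=
  p.moduleFilterBasis.topology

/-- The seminorm `f ↦ sup_x ‖D f x‖` of a linear map `D` into bounded functions. -/
def supSeminorm {W X G : Type} [AddCommGroup W] [Module ℂ W] [NormedAddCommGroup G]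
    [NormedSpace ℂ G] (D : W →ₗ[ℂ] (X → G)) (hD : ∀ f, BddAbove (Set.range fun x => ‖D f x‖)) :
    Seminorm ℂ W :=
  Seminorm.of (fun f => ⨆ x, ‖D f x‖)
    (fun f g => by
      refine Real.iSup_le (fun x => ?_) (add_nonneg (Real.iSup_nonneg fun x => norm_nonneg _)
        (Real.iSup_nonneg fun x => norm_nonneg _))
      rw [map_add]
      exact (norm_add_le _ _).trans (add_le_add (le_ciSup (hD f) x) (le_ciSup (hD g) x)))
    (fun c f => by
      simp only [map_smul, Pi.smul_apply, norm_smul]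
      rw [Real.mul_iSup_of_nonneg (norm_nonneg c)])

theorem supSeminorm_apply {W X G : Type} [AddCommGroup W] [Module ℂ W] [NormedAddCommGroup G]
    [NormedSpace ℂ G] (D : W →ₗ[ℂ] (X → G)) (hD : ∀ f, BddAbove (Set.range fun x => ‖D f x‖))
    (f : W) : supSeminorm D hD f = ⨆ x, ‖D f x‖ := rfl

/-- The projective topology on an intersection of function spaces: the weakest topology for which
all inclusions into the given spaces are continuous. -/
@[reducible] def projectiveTopology {X : Type} {W : ℕ → Submodule ℂ (X → ℂ)}
    (τ : ∀ k, TopologicalSpace (W k)) : TopologicalSpace (⨅ k, W k : Submodule ℂ (X → ℂ)) :=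
  ⨅ k, TopologicalSpace.induced (Submodule.inclusion (iInf_le W k)) (τ k)

/-- The inductive topology on an increasing union (= sum) of function spaces: the strongest locally
convex vector space topology for which all inclusions of the given spaces are continuous. In the
order of Mathlib, a stronger topology is a smaller one. -/
@[reducible] def inductiveTopology {X : Type} {W : ℕ → Submodule ℂ (X → ℂ)}
    (τ : ∀ k, TopologicalSpace (W k)) : TopologicalSpace (⨆ k, W k : Submodule ℂ (X → ℂ)) :=
  sInf {σ | @IsTopologicalAddGroup _ σ _ ∧ @ContinuousSMul ℂ _ _ _ σ ∧
    @LocallyConvexSpace ℝ _ _ _ _ _ σ ∧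
    ∀ k, @Continuous _ _ (τ k) σ (Submodule.inclusion (le_iSup W k))}

/-- The dual space: linear functionals on `F` that are continuous for the topology `τ`. -/
def TopDual {X : Type} (F : Submodule ℂ (X → ℂ)) (τ : TopologicalSpace F) : Type :=
  {S : F →ₗ[ℂ] ℂ // @Continuous _ _ τ _ S}

/-- The inclusion of the Schwartz space into a function space. -/
def schwartzIncl {N : ℕ} (F : Submodule ℂ (PhaseSpace N → ℂ))
    (hF : ∀ f : 𝓢(PhaseSpace N, ℂ), (f : PhaseSpace N → ℂ) ∈ F) : 𝓢(PhaseSpace N, ℂ) →ₗ[ℂ] F where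
  toFun f := ⟨f, hF f⟩
  map_add' _ _ := rfl
  map_smul' _ _ := rfl

/-- The restriction to the Schwartz space of an element of the dual space of `F`, when the
inclusion of the Schwartz space into `F` is continuous. -/
def TopDual.restrict {N : ℕ} {F : Submodule ℂ (PhaseSpace N → ℂ)} {τ : TopologicalSpace F}
    (hF : ∀ f : 𝓢(PhaseSpace N, ℂ), (f : PhaseSpace N → ℂ) ∈ F)
    (hτ : @Continuous _ _ _ τ (schwartzIncl F hF)) (S : TopDual F τ) : 𝓢'(PhaseSpace N, ℂ) :=
  ContinuousLinearMap.toPointwiseConvergenceCLM ℂ (RingHom.id ℂ) 𝓢(PhaseSpace N, ℂ) ℂ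
    { toLinearMap := S.1.comp (schwartzIncl F hF)
      cont := @Continuous.comp _ _ _ _ τ _ _ _ S.2 hτ }

theorem TopDual.restrict_apply {N : ℕ} {F : Submodule ℂ (PhaseSpace N → ℂ)}
    {τ : TopologicalSpace F} (hF : ∀ f : 𝓢(PhaseSpace N, ℂ), (f : PhaseSpace N → ℂ) ∈ F)
    (hτ : @Continuous _ _ _ τ (schwartzIncl F hF)) (S : TopDual F τ) (h : 𝓢(PhaseSpace N, ℂ)) :
    S.restrict hF hτ h = S.1 ⟨h, hF h⟩ := rfl

theorem continuous_to_seminormTopology {N : ℕ} {ι W : Type} [Nonempty ι] [AddCommGroup W]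
    [Module ℂ W] (p : SeminormFamily ℂ W ι) (A : 𝓢(PhaseSpace N, ℂ) →ₗ[ℂ] W)
    (h : ∀ i, ∃ q : Seminorm ℂ 𝓢(PhaseSpace N, ℂ), Continuous q ∧ ∀ f, p i (A f) ≤ q f) :
    @Continuous _ _ _ (seminormTopology p) A := by
  let _ := seminormTopology p
  refine WithSeminorms.continuous_of_continuous_comp (q := p) ⟨rfl⟩ A fun i => ?_
  obtain ⟨q, hq, hb⟩ := h i
  exact Seminorm.continuous_of_le hq hb

/-! ### The space of smooth functions -/

/-- The space `E_2` of smooth functions on `ℝ^{2N}`. -/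
def smoothSpace (N : ℕ) : Submodule ℂ (PhaseSpace N → ℂ) where
  carrier := {f | ContDiff ℝ ∞ f}
  add_mem' {f g} (hf : ContDiff ℝ ∞ f) (hg : ContDiff ℝ ∞ g) := hf.add hg
  zero_mem' := (contDiff_const : ContDiff ℝ ∞ fun _ : PhaseSpace N => (0 : ℂ))
  smul_mem' c f (hf : ContDiff ℝ ∞ f) := hf.const_smul c

theorem contDiff_of_mem_smoothSpace {N : ℕ} (f : smoothSpace N) (j : ℕ) : ContDiff ℝ j f.1 :=
  contDiff_infty.1 f.2 j

/-- The derivatives of order `j`, restricted to a compact set. -/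
def smoothDeriv (N : ℕ) (K : TopologicalSpace.Compacts (PhaseSpace N)) (j : ℕ) :
    smoothSpace N →ₗ[ℂ] (K → PhaseSpace N [×j]→L[ℝ] ℂ) where
  toFun f u := iteratedFDeriv ℝ j f.1 u
  map_add' f g := by
    ext1 u
    exact iteratedFDeriv_add_apply
      (contDiff_of_mem_smoothSpace f j).contDiffAt (contDiff_of_mem_smoothSpace g j).contDiffAt
  map_smul' c f := by
    ext1 u
    exact iteratedFDeriv_const_smul_apply (contDiff_of_mem_smoothSpace f j).contDiffAt

theorem bddAbove_smoothDeriv {N : ℕ} (K : TopologicalSpace.Compacts (PhaseSpace N)) (j : ℕ)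
    (f : smoothSpace N) : BddAbove (Set.range fun u => ‖smoothDeriv N K j f u‖) := by
  have hc : Continuous fun u => ‖iteratedFDeriv ℝ j f.1 u‖ :=
    ((contDiff_of_mem_smoothSpace f j).continuous_iteratedFDeriv le_rfl).norm
  obtain ⟨C, hC⟩ := K.isCompact.bddAbove_image hc.continuousOn
  exact ⟨C, by rintro _ ⟨u, rfl⟩; exact hC ⟨u, u.2, rfl⟩⟩

/-- The seminorms `sup_{u ∈ K} ‖D^j f(u)‖`, for `K` compact and `j ∈ ℕ`. -/
def smoothSeminorms (N : ℕ) :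
    SeminormFamily ℂ (smoothSpace N) (TopologicalSpace.Compacts (PhaseSpace N) × ℕ) :=
  fun i => supSeminorm (smoothDeriv N i.1 i.2) (bddAbove_smoothDeriv i.1 i.2)

/-- The topology of uniform convergence of all derivatives on compact sets. -/
@[reducible] def smoothTopology (N : ℕ) : TopologicalSpace (smoothSpace N) :=
  seminormTopology (smoothSeminorms N)

theorem schwartz_mem_smoothSpace {N : ℕ} (f : 𝓢(PhaseSpace N, ℂ)) :
    (f : PhaseSpace N → ℂ) ∈ smoothSpace N :=
  f.smooth ⊤

theorem continuous_seminorm {N : ℕ} (j : ℕ) :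
    Continuous (SchwartzMap.seminorm ℂ 0 j : Seminorm ℂ 𝓢(PhaseSpace N, ℂ)) :=
  (schwartz_withSeminorms ℂ (PhaseSpace N) ℂ).continuous_seminorm (0, j)

theorem continuous_schwartz_smoothSpace (N : ℕ) : @Continuous _ _ _ (smoothTopology N)
    (schwartzIncl (smoothSpace N) schwartz_mem_smoothSpace) :=
  continuous_to_seminormTopology _ _ fun i => ⟨SchwartzMap.seminorm ℂ 0 i.2, continuous_seminorm _,
    fun f => Real.iSup_le (fun _ => SchwartzMap.norm_iteratedFDeriv_le_seminorm ℂ f _ _)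
      (apply_nonneg _ _)⟩

/-- The dual space `E_2'` of `E_2`: the distributions of compact support. -/
abbrev SmoothDual (N : ℕ) : Type := TopDual (smoothSpace N) (smoothTopology N)

/-- An element of `E_2'` as a tempered distribution. -/
def SmoothDual.toTempered {N : ℕ} (S : SmoothDual N) : 𝓢'(PhaseSpace N, ℂ) :=
  S.restrict schwartz_mem_smoothSpace (continuous_schwartz_smoothSpace N)

/-! ### Weighted spaces of differentiable functions -/

/-- The derivatives of order `j`, weighted: `(1 + u²)^{-a} D^j f(u)`. -/
def weightedDeriv {N : ℕ} (a : ℝ) (j : ℕ) (f : PhaseSpace N → ℂ) (u : PhaseSpace N) :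
    PhaseSpace N [×j]→L[ℝ] ℂ :=
  (1 + ‖u‖ ^ 2) ^ (-a) • iteratedFDeriv ℝ j f u

theorem weightedDeriv_add {N : ℕ} (a : ℝ) {j m : ℕ} (hj : j ≤ m) {f g : PhaseSpace N → ℂ}
    (hf : ContDiff ℝ m f) (hg : ContDiff ℝ m g) :
    weightedDeriv a j (f + g) = weightedDeriv a j f + weightedDeriv a j g := by
  ext1 u
  simp only [weightedDeriv, Pi.add_apply]
  rw [iteratedFDeriv_add_apply (hf.of_le (mod_cast hj)).contDiffAt
    (hg.of_le (mod_cast hj)).contDiffAt, smul_add]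

theorem weightedDeriv_smul {N : ℕ} (a : ℝ) {j m : ℕ} (hj : j ≤ m) (c : ℂ) {f : PhaseSpace N → ℂ}
    (hf : ContDiff ℝ m f) : weightedDeriv a j (c • f) = c • weightedDeriv a j f := by
  ext1 u
  simp only [weightedDeriv, Pi.smul_apply]
  rw [iteratedFDeriv_const_smul_apply (hf.of_le (mod_cast hj)).contDiffAt, smul_comm]

/-- The space of the `C^m` functions `f` such that `(1 + u²)^{-a_j} D^j f(u)` vanishes at infinity
for all `j ≤ m`. Here `D^j f(u)` collects all partial derivatives `∂^α f(u)` with `|α| = j`. -/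
def weightedSpace (N : ℕ) (a : ℕ → ℝ) (m : ℕ) : Submodule ℂ (PhaseSpace N → ℂ) where
  carrier := {f | ContDiff ℝ m f ∧
    ∀ j ≤ m, Tendsto (weightedDeriv (a j) j f) (cocompact (PhaseSpace N)) (𝓝 0)}
  add_mem' hf hg := ⟨hf.1.add hg.1, fun j hj => by
    rw [weightedDeriv_add (a j) hj hf.1 hg.1]
    simpa using! (hf.2 j hj).add (hg.2 j hj)⟩
  zero_mem' := ⟨contDiff_const, fun j _ => by
    have : weightedDeriv (a j) j (0 : PhaseSpace N → ℂ) = fun _ => 0 := by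
      ext1 u
      simp [weightedDeriv, Pi.zero_def]
    rw [this]
    exact tendsto_const_nhds⟩
  smul_mem' c f hf := ⟨hf.1.const_smul c, fun j hj => by
    rw [weightedDeriv_smul (a j) hj c hf.1]
    have h := (hf.2 j hj).const_smul c
    have h0 : c • (0 : PhaseSpace N [×j]→L[ℝ] ℂ) = 0 := by ext; simp
    rw [h0] at h
    exact h⟩

/-- The weighted derivatives of order `j ≤ m`, as a linear map. -/
def weightedDerivLM (N : ℕ) (a : ℕ → ℝ) (m : ℕ) (j : Fin (m + 1)) :
    weightedSpace N a m →ₗ[ℂ] (PhaseSpace N → PhaseSpace N [×j]→L[ℝ] ℂ) where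
  toFun f := weightedDeriv (a j) j f.1
  map_add' f g := weightedDeriv_add (a j) (Nat.lt_succ_iff.1 j.2) f.2.1 g.2.1
  map_smul' c f := weightedDeriv_smul (a j) (Nat.lt_succ_iff.1 j.2) c f.2.1

theorem continuous_weightedDeriv {N : ℕ} (a : ℝ) {j m : ℕ} (hj : j ≤ m) {f : PhaseSpace N → ℂ}
    (hf : ContDiff ℝ m f) : Continuous (weightedDeriv a j f) := by
  refine Continuous.smul (Continuous.rpow_const (by fun_prop) fun u => Or.inl ?_)
    (hf.continuous_iteratedFDeriv (mod_cast hj))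
  positivity

theorem bddAbove_weightedDeriv {N : ℕ} (a : ℕ → ℝ) (m : ℕ) (j : Fin (m + 1))
    (f : weightedSpace N a m) : BddAbove (Set.range fun u => ‖weightedDerivLM N a m j f u‖) := by
  have hj := Nat.lt_succ_iff.1 j.2
  let F : ZeroAtInftyContinuousMap (PhaseSpace N) (PhaseSpace N [×j]→L[ℝ] ℂ) :=
    ⟨⟨weightedDeriv (a j) j f.1, continuous_weightedDeriv _ hj f.2.1⟩, f.2.2 j hj⟩
  exact ⟨‖F.toBCF‖, by rintro _ ⟨u, rfl⟩; exact F.toBCF.norm_coe_le_norm u⟩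

/-- The norm `sup {(1 + u²)^{-a_j} ‖D^j f(u)‖ : u ∈ ℝ^{2N}, j ≤ m}`. -/
def weightedSeminorm (N : ℕ) (a : ℕ → ℝ) (m : ℕ) : Seminorm ℂ (weightedSpace N a m) :=
  Finset.univ.sup fun j : Fin (m + 1) =>
    supSeminorm (weightedDerivLM N a m j) (bddAbove_weightedDeriv a m j)

/-- The topology given by the norm. -/
@[reducible] def weightedTopology (N : ℕ) (a : ℕ → ℝ) (m : ℕ) : TopologicalSpace (weightedSpace N a m) :=
  seminormTopology fun _ : Unit => weightedSeminorm N a m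

theorem norm_weightedDeriv_le {N : ℕ} {a b : ℝ} (h : a ≤ b) (j : ℕ) (f : PhaseSpace N → ℂ)
    (u : PhaseSpace N) : ‖weightedDeriv b j f u‖ ≤ ‖weightedDeriv a j f u‖ := by
  simp only [weightedDeriv, norm_smul]
  have h0 : 0 ≤ (1 + ‖u‖ ^ 2 : ℝ) := by positivity
  rw [Real.norm_of_nonneg (Real.rpow_nonneg h0 _), Real.norm_of_nonneg (Real.rpow_nonneg h0 _)]
  gcongr
  nlinarith [norm_nonneg u]

theorem weightedSpace_mono {N : ℕ} {a b : ℕ → ℝ} (h : ∀ j, a j ≤ b j) (m : ℕ) :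
    weightedSpace N a m ≤ weightedSpace N b m := fun f hf =>
  ⟨hf.1, fun j hj => squeeze_zero_norm (fun u => norm_weightedDeriv_le (h j) j f u)
    (tendsto_zero_iff_norm_tendsto_zero.1 (hf.2 j hj))⟩

theorem schwartz_mem_weightedSpace {N : ℕ} {a : ℕ → ℝ} (ha : ∀ j, 0 ≤ a j) (m : ℕ)
    (f : 𝓢(PhaseSpace N, ℂ)) : (f : PhaseSpace N → ℂ) ∈ weightedSpace N a m := by
  refine weightedSpace_mono ha m ⟨f.smooth m, fun j _ => ?_⟩
  obtain ⟨C, hC⟩ := f.decay 1 j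
  have hC' : ∀ᶠ u : PhaseSpace N in cocompact _,
      ‖weightedDeriv 0 j (f : PhaseSpace N → ℂ) u‖ ≤ C / ‖u‖ := by
    filter_upwards [tendsto_norm_cocompact_atTop.eventually_gt_atTop 0] with u hu
    rw [le_div_iff₀ hu]
    simpa [weightedDeriv, mul_comm] using! hC.2 u
  exact squeeze_zero_norm' hC' (tendsto_const_nhds.div_atTop tendsto_norm_cocompact_atTop)

theorem exists_seminorm_ge (N m : ℕ) : ∃ q : Seminorm ℂ 𝓢(PhaseSpace N, ℂ), Continuous q ∧
    ∀ j ≤ m, ∀ f, SchwartzMap.seminorm ℂ 0 j f ≤ q f := by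
  induction m with
  | zero => exact ⟨_, continuous_seminorm 0, fun j hj f => by rw [Nat.le_zero.1 hj]⟩
  | succ m ih =>
    obtain ⟨q, hq, h⟩ := ih
    refine ⟨q + SchwartzMap.seminorm ℂ 0 (m + 1), hq.add (continuous_seminorm _),
      fun j hj f => ?_⟩
    change _ ≤ q f + SchwartzMap.seminorm ℂ 0 (m + 1) f
    rcases Nat.le_succ_iff.1 hj with hj | rfl
    · exact (h j hj f).trans (le_add_of_nonneg_right (apply_nonneg _ _))
    · exact le_add_of_nonneg_left (apply_nonneg _ _)

theorem continuous_schwartz_weightedSpace (N : ℕ) {a : ℕ → ℝ} (ha : ∀ j, 0 ≤ a j) (m : ℕ) :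
    @Continuous _ _ _ (weightedTopology N a m)
      (schwartzIncl (weightedSpace N a m) (schwartz_mem_weightedSpace ha m)) := by
  obtain ⟨q, hq, h⟩ := exists_seminorm_ge N m
  refine continuous_to_seminormTopology _ _ fun _ => ⟨q, hq, fun f => ?_⟩
  refine Seminorm.finset_sup_apply_le (apply_nonneg _ _) fun j _ => ?_
  refine Real.iSup_le (fun u => ?_) (apply_nonneg _ _)
  refine (norm_weightedDeriv_le (ha j) j f u).trans ?_
  refine le_trans ?_ (h j (Nat.lt_succ_iff.1 j.2) f)
  simpa [weightedDeriv] using! SchwartzMap.norm_iteratedFDeriv_le_seminorm ℂ f j u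

/-! ### The space `O_T` -/

/-- The space `V_k^m` of the `C^m` functions `f` such that `(1 + u²)^{-k-|α|/2} ∂^α f(u)` vanishes
at infinity for `|α| ≤ m`. -/
abbrev spaceVkm (N k m : ℕ) : Submodule ℂ (PhaseSpace N → ℂ) :=
  weightedSpace N (fun j => k + j / 2) m

/-- The space `V_k = ⋂_m V_k^m`. -/
abbrev spaceVk (N k : ℕ) : Submodule ℂ (PhaseSpace N → ℂ) := ⨅ m, spaceVkm N k m

/-- The projective topology of `V_k`. -/
@[reducible] def topologyVk (N k : ℕ) : TopologicalSpace (spaceVk N k) :=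
  projectiveTopology fun m => weightedTopology N (fun j => k + j / 2) m

/-- The space `O_T = ⋃_k V_k`. -/
abbrev spaceOT (N : ℕ) : Submodule ℂ (PhaseSpace N → ℂ) := ⨆ k, spaceVk N k

/-- The inductive topology of `O_T`. -/
@[reducible] def topologyOT (N : ℕ) : TopologicalSpace (spaceOT N) :=
  inductiveTopology fun k => topologyVk N k

/-- The space `O_T` is indeed the union of the spaces `V_k`. -/
theorem mem_spaceOT {N : ℕ} {f : PhaseSpace N → ℂ} :
    f ∈ spaceOT N ↔ ∃ k : ℕ, ∀ m : ℕ, f ∈ spaceVkm N k m := by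
  have h : Monotone (spaceVk N) := fun k l hkl =>
    iInf_mono fun m => weightedSpace_mono (fun j => by gcongr) m
  rw [Submodule.mem_iSup_of_directed _ h.directed_le]
  simp [Submodule.mem_iInf]

theorem schwartz_mem_spaceVk {N : ℕ} (k : ℕ) (f : 𝓢(PhaseSpace N, ℂ)) :
    (f : PhaseSpace N → ℂ) ∈ spaceVk N k :=
  (Submodule.mem_iInf _).2 fun m => schwartz_mem_weightedSpace (fun j => by positivity) m f

theorem schwartz_mem_spaceOT {N : ℕ} (f : 𝓢(PhaseSpace N, ℂ)) :
    (f : PhaseSpace N → ℂ) ∈ spaceOT N :=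
  le_iSup (spaceVk N) 0 (schwartz_mem_spaceVk 0 f)

theorem continuous_schwartz_projective {N : ℕ} {W : ℕ → Submodule ℂ (PhaseSpace N → ℂ)}
    (τ : ∀ k, TopologicalSpace (W k)) (hW : ∀ k, ∀ f : 𝓢(PhaseSpace N, ℂ), ⇑f ∈ W k)
    (hF : ∀ f : 𝓢(PhaseSpace N, ℂ), ⇑f ∈ ⨅ k, W k)
    (h : ∀ k, @Continuous _ _ _ (τ k) (schwartzIncl (W k) (hW k))) :
    @Continuous _ _ _ (projectiveTopology τ) (schwartzIncl _ hF) :=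
  continuous_iInf_rng.2 fun k => continuous_induced_rng.2 (h k)

theorem continuous_schwartz_inductive {N : ℕ} {W : ℕ → Submodule ℂ (PhaseSpace N → ℂ)}
    (τ : ∀ k, TopologicalSpace (W k)) (k : ℕ) (hW : ∀ f : 𝓢(PhaseSpace N, ℂ), ⇑f ∈ W k)
    (hF : ∀ f : 𝓢(PhaseSpace N, ℂ), ⇑f ∈ ⨆ k, W k)
    (h : @Continuous _ _ _ (τ k) (schwartzIncl (W k) hW)) :
    @Continuous _ _ _ (inductiveTopology τ) (schwartzIncl _ hF) :=
  continuous_sInf_rng.2 fun σ hσ => @Continuous.comp _ _ _ _ (τ k) σ _ _ (hσ.2.2.2 k) h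

theorem continuous_schwartz_spaceOT (N : ℕ) :
    @Continuous _ _ _ (topologyOT N) (schwartzIncl (spaceOT N) schwartz_mem_spaceOT) :=
  continuous_schwartz_inductive _ 0 (schwartz_mem_spaceVk 0) _
    (continuous_schwartz_projective _ _ _ fun m => continuous_schwartz_weightedSpace N
      (fun j => by positivity) m)

/-- The dual space `O_T'`. -/
abbrev OTDual (N : ℕ) : Type := TopDual (spaceOT N) (topologyOT N)

/-- An element of `O_T'` as a tempered distribution. -/
def OTDual.toTempered {N : ℕ} (S : OTDual N) : 𝓢'(PhaseSpace N, ℂ) :=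
  S.restrict schwartz_mem_spaceOT (continuous_schwartz_spaceOT N)

/-! ### The space `O_M` -/

/-- The space `S_{-k}^m` of the `C^m` functions `f` such that `(1 + u²)^{-k} ∂^α f(u)` vanishes at
infinity for `|α| ≤ m`. -/
abbrev spaceSkm (N k m : ℕ) : Submodule ℂ (PhaseSpace N → ℂ) :=
  weightedSpace N (fun _ => k) m

/-- The space `O_C^m = ⋃_k S_{-k}^m`. -/
abbrev spaceOCm (N m : ℕ) : Submodule ℂ (PhaseSpace N → ℂ) := ⨆ k, spaceSkm N k m

/-- The inductive topology of `O_C^m`. -/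
@[reducible] def topologyOCm (N m : ℕ) : TopologicalSpace (spaceOCm N m) :=
  inductiveTopology fun k => weightedTopology N (fun _ => k) m

/-- The space `O_M = ⋂_m O_C^m`. -/
abbrev spaceOM (N : ℕ) : Submodule ℂ (PhaseSpace N → ℂ) := ⨅ m, spaceOCm N m

/-- The projective topology of `O_M`. -/
@[reducible] def topologyOM (N : ℕ) : TopologicalSpace (spaceOM N) :=
  projectiveTopology fun m => topologyOCm N m

/-- The space `O_M` is indeed the intersection of the unions of the spaces `S_{-k}^m`. -/
theorem mem_spaceOM {N : ℕ} {f : PhaseSpace N → ℂ} :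
    f ∈ spaceOM N ↔ ∀ m : ℕ, ∃ k : ℕ, f ∈ spaceSkm N k m := by
  have h (m : ℕ) : Monotone fun k => spaceSkm N k m := fun k l hkl =>
    weightedSpace_mono (fun j => by gcongr) m
  rw [Submodule.mem_iInf]
  exact forall_congr' fun m => Submodule.mem_iSup_of_directed _ (h m).directed_le

theorem schwartz_mem_spaceSkm {N : ℕ} (k m : ℕ) (f : 𝓢(PhaseSpace N, ℂ)) :
    (f : PhaseSpace N → ℂ) ∈ spaceSkm N k m :=
  schwartz_mem_weightedSpace (fun j => by positivity) m f

theorem schwartz_mem_spaceOCm {N : ℕ} (m : ℕ) (f : 𝓢(PhaseSpace N, ℂ)) :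
    (f : PhaseSpace N → ℂ) ∈ spaceOCm N m :=
  le_iSup (fun k => spaceSkm N k m) 0 (schwartz_mem_spaceSkm 0 m f)

theorem schwartz_mem_spaceOM {N : ℕ} (f : 𝓢(PhaseSpace N, ℂ)) :
    (f : PhaseSpace N → ℂ) ∈ spaceOM N :=
  (Submodule.mem_iInf _).2 fun m => schwartz_mem_spaceOCm m f

theorem continuous_schwartz_spaceOM (N : ℕ) :
    @Continuous _ _ _ (topologyOM N) (schwartzIncl (spaceOM N) schwartz_mem_spaceOM) :=
  continuous_schwartz_projective _ schwartz_mem_spaceOCm _ fun m =>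
    continuous_schwartz_inductive _ 0 (schwartz_mem_spaceSkm 0 m) _
      (continuous_schwartz_weightedSpace N (fun j => by positivity) m)

/-- The dual space `O_M'`. -/
abbrev OMDual (N : ℕ) : Type := TopDual (spaceOM N) (topologyOM N)

/-- An element of `O_M'` as a tempered distribution. -/
def OMDual.toTempered {N : ℕ} (S : OMDual N) : 𝓢'(PhaseSpace N, ℂ) :=
  S.restrict schwartz_mem_spaceOM (continuous_schwartz_spaceOM N)

/-! ### Twisted products of elements of `O_T'` and tempered distributions -/

/-- The tempered distribution `T` is given by the function `φ`: `⟨T, h⟩ = ∫ φ(x) h(x) dx`. -/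
def IsGivenBy {N : ℕ} (T : 𝓢'(PhaseSpace N, ℂ)) (φ : PhaseSpace N → ℂ) : Prop :=
  ∀ h : 𝓢(PhaseSpace N, ℂ), Integrable (fun u => φ u * h u) (phaseMeasure N) ∧
    T h = ∫ u, φ u * h u ∂phaseMeasure N

/-- The tempered distribution `P` is the twisted product `S × T` of `S ∈ O_T'` and `T ∈ S_2'`,
defined by transposition: for every Schwartz function `h`, the tempered distribution `T × h` is (given
by) a function `φ` in `O_T`, and `⟨P, h⟩ = ⟨S, φ⟩`. -/
def IsProductLeft {N : ℕ} (S : OTDual N) (T P : 𝓢'(PhaseSpace N, ℂ)) : Prop :=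
  ∀ h : 𝓢(PhaseSpace N, ℂ), ∃ φ : spaceOT N, IsGivenBy (distMul T h) φ ∧ P h = S.1 φ

/-- The tempered distribution `P` is the twisted product `T × S` of `T ∈ S_2'` and `S ∈ O_T'`,
defined by transposition: for every Schwartz function `h`, the tempered distribution `h × T` is (given
by) a function `φ` in `O_T`, and `⟨P, h⟩ = ⟨S, φ⟩`. -/
def IsProductRight {N : ℕ} (T : 𝓢'(PhaseSpace N, ℂ)) (S : OTDual N)
    (P : 𝓢'(PhaseSpace N, ℂ)) : Prop :=
  ∀ h : 𝓢(PhaseSpace N, ℂ), ∃ φ : spaceOT N, IsGivenBy (mulDist h T) φ ∧ P h = S.1 φ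

end

end Moyal

open Moyal

/-! For a bilinear form `B = ±J` let `K_x φ(w) = e^{iB(x,w)} φ(w - x)` be the twisted translates.
Writing out the symplectic Fourier transform `F` gives `h × g = ∫ g(x) K_x(Fh) dx`, so by
transposition `T × h` is the function `x ↦ ⟨T, K_x(Fh)⟩`; multiplication on the other side has the
same form with `-J` and a reflected transform. Everything reduces to the growth and smoothness of
these matrix coefficients.

A derivative of order `j` of `K_x φ` costs at most a factor `(1 + x²)^{j/2}`, and Peetre's
inequality moves a weight `(1 + w²)^{-a}` to `x` (`exists_norm_weightedDeriv_twistShift_le`). In the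
norms of `V_k`, where `a = k + j/2`, the two effects leave exactly `(1 + x²)^{-k}`, whatever the
order. Differentiation in `x` replaces `φ` by another Schwartz function and adds a linear factor, so
each derivative of a coefficient costs at most half a power
(`exists_norm_iteratedFDeriv_matrixCoeff_le`). Two consequences follow. A functional that is bounded
on every `V_k` has Schwartz coefficients (`IsBoundedVk.exists_schwartz`); this covers the three dual
spaces, since every `V_k` embeds continuously in `E_2`, `O_M` and `O_T`. A general tempered `T` has
coefficients in `V_k` for large `k`, continuously in `φ` (`exists_seminorm_matrixCoeff_le`), so that
`⟨S, T × h⟩` makes sense for `S ∈ O_T'` and is continuous in `h`.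

The transposition formulas are a Fubini theorem for `S` and `T`. On a product `f × g`, both `⟨T × S,
f × g⟩` and `⟨T, S × (f × g)⟩` equal `∫ (S × f)(x) (g × T)(x) dx`; for the first, `S` is exchanged
with an integral that converges in `V_k` for large `k`. The difference `D` of the two functionals
vanishes on products, so the continuous functions `x ↦ ⟨D, K_x(Ff)⟩` vanish. At `x = 0` this says
`⟨D, Ff⟩ = 0`, and `F` is surjective, whence `D = 0` without factoring Schwartz functions as
products.

Functionals are exchanged with integrals by one mechanism, `integral_comp_of_bounded`: a weighted
space embeds isometrically in a Banach space of tuples of bounded continuous functions, the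
functional extends by Hahn–Banach, and Bochner integration commutes with the extension. -/

namespace Moyal

noncomputable section

/-! ### Weights -/

/-- The weight `(1 + u²)^r`. -/
def weight {N : ℕ} (r : ℝ) (u : PhaseSpace N) : ℝ := (1 + ‖u‖ ^ 2) ^ r

section Weight

variable {N : ℕ}

theorem one_le_one_add_sq (u : PhaseSpace N) : 1 ≤ 1 + ‖u‖ ^ 2 := by
  nlinarith [sq_nonneg ‖u‖]

theorem weight_pos (r : ℝ) (u : PhaseSpace N) : 0 < weight r u :=
  Real.rpow_pos_of_pos (by positivity) r

theorem weight_zero (u : PhaseSpace N) : weight 0 u = 1 := Real.rpow_zero _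

theorem weight_add (r s : ℝ) (u : PhaseSpace N) : weight (r + s) u = weight r u * weight s u :=
  Real.rpow_add (by positivity) r s

theorem weight_mono {r s : ℝ} (h : r ≤ s) (u : PhaseSpace N) : weight r u ≤ weight s u :=
  Real.rpow_le_rpow_of_exponent_le (one_le_one_add_sq u) h

theorem weight_neg_mul (r : ℝ) (u : PhaseSpace N) : weight (-r) u * weight r u = 1 := by
  rw [← weight_add, neg_add_cancel, weight_zero]

theorem one_le_weight {r : ℝ} (h : 0 ≤ r) (u : PhaseSpace N) : 1 ≤ weight r u :=
  (weight_zero u).symm.trans_le (weight_mono h u)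

theorem continuous_weight (r : ℝ) : Continuous (weight r : PhaseSpace N → ℝ) :=
  Continuous.rpow_const (by fun_prop) fun u => Or.inl (by positivity)

theorem norm_pow_le_weight (j : ℕ) (u : PhaseSpace N) : ‖u‖ ^ j ≤ weight (j / 2) u := by
  rw [weight, div_eq_mul_one_div, mul_comm, Real.rpow_mul (by positivity), Real.rpow_natCast,
    ← Real.sqrt_eq_rpow]
  gcongr
  exact Real.le_sqrt_of_sq_le (by linarith)

theorem norm_le_weight (u : PhaseSpace N) : ‖u‖ ≤ weight (1 / 2) u := by
  simpa using! norm_pow_le_weight 1 u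

theorem one_add_sq_le (u v : PhaseSpace N) :
    1 + ‖u‖ ^ 2 ≤ 2 * (1 + ‖v‖ ^ 2) * (1 + ‖u - v‖ ^ 2) := by
  have h : ‖u‖ ≤ ‖v‖ + ‖u - v‖ := by
    simpa using! norm_add_le v (u - v)
  have h2 : ‖u‖ ^ 2 ≤ (‖v‖ + ‖u - v‖) ^ 2 := by gcongr
  nlinarith [sq_nonneg (‖v‖ - ‖u - v‖), mul_nonneg (sq_nonneg ‖v‖) (sq_nonneg ‖u - v‖)]

/-- Peetre's inequality. -/
theorem weight_le_mul (b : ℝ) (u v : PhaseSpace N) :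
    weight b u ≤ 2 ^ |b| * weight b v * weight |b| (u - v) := by
  rcases le_total 0 b with hb | hb
  · rw [abs_of_nonneg hb, weight, weight, weight, ← Real.mul_rpow (by positivity) (by positivity),
      ← Real.mul_rpow (by positivity) (by positivity)]
    exact Real.rpow_le_rpow (by positivity) (one_add_sq_le u v) hb
  · rw [abs_of_nonpos hb]
    have h : weight (-b) v ≤ 2 ^ (-b) * weight (-b) u * weight (-b) (u - v) := by
      rw [weight, weight, weight, ← Real.mul_rpow (by positivity) (by positivity),
        ← Real.mul_rpow (by positivity) (by positivity)]
      refine Real.rpow_le_rpow (by positivity) ?_ (by linarith)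
      rw [norm_sub_rev]
      exact one_add_sq_le v u
    calc weight b u = weight b u * (weight (-b) v * weight b v) := by
          rw [weight_neg_mul, mul_one]
      _ ≤ weight b u * ((2 ^ (-b) * weight (-b) u * weight (-b) (u - v)) * weight b v) := by
          have := weight_pos b u
          have := weight_pos b v
          gcongr
      _ = (weight (-b) u * weight b u) * (2 ^ (-b) * weight b v * weight (-b) (u - v)) := by ring
      _ = _ := by rw [weight_neg_mul, one_mul]

theorem weight_le_pow (b : ℝ) (u : PhaseSpace N) : weight b u ≤ (1 + ‖u‖) ^ (2 * ⌈|b|⌉₊) := by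
  calc weight b u ≤ weight (⌈|b|⌉₊ : ℝ) u := weight_mono ((le_abs_self b).trans (Nat.le_ceil _)) u
    _ = (1 + ‖u‖ ^ 2) ^ ⌈|b|⌉₊ := Real.rpow_natCast _ _
    _ ≤ _ := by
      rw [pow_mul]
      gcongr
      nlinarith [norm_nonneg u]

theorem norm_weightedDeriv (a : ℝ) (j : ℕ) (f : PhaseSpace N → ℂ) (u : PhaseSpace N) :
    ‖weightedDeriv a j f u‖ = weight (-a) u * ‖iteratedFDeriv ℝ j f u‖ := by
  rw [weightedDeriv, norm_smul, ← weight, Real.norm_of_nonneg (weight_pos (-a) u).le]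

theorem integrable_weight {r : ℝ} (hr : r < -N) :
    Integrable (weight r : PhaseSpace N → ℝ) (phaseMeasure N) := by
  have h : (Module.finrank ℝ (PhaseSpace N) : ℝ) < -(2 * r) := by
    simp
    linarith
  convert! integrable_rpow_neg_one_add_norm_sq (μ := phaseMeasure N) h using 2 with u
  rw [weight]
  congr 1
  ring

/-- Any weighted derivatives of a Schwartz function are bounded by a continuous seminorm. -/
theorem exists_seminorm_weight (N : ℕ) (b : ℝ) (n : ℕ) :
    ∃ q : Seminorm ℂ 𝓢(PhaseSpace N, ℂ), Continuous q ∧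
      ∀ (φ : 𝓢(PhaseSpace N, ℂ)) (u : PhaseSpace N), ∀ i ≤ n,
      weight b u * ‖iteratedFDeriv ℝ i φ u‖ ≤ q φ := by
  set m : ℕ × ℕ := (2 * ⌈|b|⌉₊, n)
  have h' : ∀ s : Finset (ℕ × ℕ), Continuous
      (s.sup (fun m => SchwartzMap.seminorm ℂ m.1 m.2) : Seminorm ℂ 𝓢(PhaseSpace N, ℂ)) := by
    intro s
    classical
    induction s using Finset.induction with
    | empty => simpa using! continuous_const
    | insert a s ha ih =>
      rw [Finset.sup_insert]
      exact ((schwartz_withSeminorms ℂ (PhaseSpace N) ℂ).continuous_seminorm a).sup ih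
  refine ⟨(2 ^ m.1 : NNReal) • (Finset.Iic m).sup (fun m => SchwartzMap.seminorm ℂ m.1 m.2),
    (h' _).const_smul _, fun φ u i hi => ?_⟩
  calc weight b u * ‖iteratedFDeriv ℝ i φ u‖
      ≤ (1 + ‖u‖) ^ (2 * ⌈|b|⌉₊) * ‖iteratedFDeriv ℝ i φ u‖ := by
        gcongr
        exact weight_le_pow b u
    _ ≤ _ := SchwartzMap.one_add_le_sup_seminorm_apply (𝕜 := ℂ) (m := m) le_rfl hi φ u

/-- A Schwartz function belongs to all weighted spaces. -/
theorem schwartz_mem_weightedSpace_of_weight (a : ℕ → ℝ) (m : ℕ) (f : 𝓢(PhaseSpace N, ℂ)) :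
    (f : PhaseSpace N → ℂ) ∈ weightedSpace N a m := by
  refine ⟨f.smooth m, fun j _ => ?_⟩
  -- The additional half power of the weight yields a factor `‖u‖`, hence decay like `1 / ‖u‖`.
  obtain ⟨q, -, hq⟩ := exists_seminorm_weight N (1 / 2 - a j) j
  refine squeeze_zero_norm' (a := fun u => q f / ‖u‖) ?_
    (tendsto_const_nhds.div_atTop (tendsto_norm_cocompact_atTop (E := PhaseSpace N)))
  filter_upwards [tendsto_norm_cocompact_atTop.eventually_gt_atTop 0] with u hu
  rw [le_div_iff₀ hu, norm_weightedDeriv]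
  refine le_trans ?_ (hq f u j le_rfl)
  rw [sub_eq_add_neg, weight_add, mul_comm, mul_assoc]
  have := weight_pos (-a j) u
  gcongr
  exact norm_le_weight u

end Weight

/-! ### Twisted translations -/

section Phase

variable {N : ℕ} (B : PhaseSpace N →L[ℝ] PhaseSpace N →L[ℝ] ℝ)

theorem iteratedDeriv_exp_mul_I (n : ℕ) : iteratedDeriv n (fun t : ℝ => Complex.exp (t * Complex.I)) =
    fun t : ℝ => Complex.I ^ n * Complex.exp (t * Complex.I) := by
  induction n with
  | zero => simp
  | succ n ih =>
    rw [iteratedDeriv_succ, ih]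
    ext t
    have h : HasDerivAt (fun t : ℝ => Complex.exp (t * Complex.I))
        (Complex.exp (t * Complex.I) * (1 * Complex.I)) t :=
      ((Complex.ofRealCLM.hasDerivAt (x := t)).mul_const Complex.I).cexp
    rw [(h.const_mul _).deriv, pow_succ]
    ring

/-- The phase `e^{i B(x, w)}`. -/
def phase (x w : PhaseSpace N) : ℂ := Complex.exp (B x w * Complex.I)

theorem contDiff_phase : ContDiff ℝ ∞ fun p : PhaseSpace N × PhaseSpace N => phase B p.1 p.2 := by
  have h : ContDiff ℝ ∞ fun p : PhaseSpace N × PhaseSpace N => B p.1 p.2 :=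
    B.isBoundedBilinearMap.contDiff
  exact ((Complex.ofRealCLM.contDiff.comp h).mul contDiff_const).cexp

theorem contDiff_phase_right (x : PhaseSpace N) : ContDiff ℝ ∞ (phase B x) :=
  (contDiff_phase B).comp (contDiff_prodMk_right x)

/-- The phase is `t ↦ e^{it}`, all of whose derivatives have modulus one, composed with a linear
functional of norm at most `‖B‖ ‖x‖`. -/
theorem norm_iteratedFDeriv_phase_le (n : ℕ) (x w : PhaseSpace N) :
    ‖iteratedFDeriv ℝ n (phase B x) w‖ ≤ (‖B‖ * ‖x‖) ^ n := by
  have hc : ContDiff ℝ n (fun t : ℝ => Complex.exp (t * Complex.I)) :=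
    (Complex.ofRealCLM.contDiff.mul contDiff_const).cexp
  have h : phase B x = (fun t : ℝ => Complex.exp (t * Complex.I)) ∘ B x := rfl
  rw [h, (B x).iteratedFDeriv_comp_right hc w le_rfl]
  refine (ContinuousMultilinearMap.norm_compContinuousLinearMap_le _ _).trans ?_
  rw [norm_iteratedFDeriv_eq_norm_iteratedDeriv, iteratedDeriv_exp_mul_I]
  simp only [norm_mul, norm_pow, Complex.norm_I, one_pow, one_mul,
    Complex.norm_exp_ofReal_mul_I, Finset.prod_const, Finset.card_univ, Fintype.card_fin]
  gcongr
  exact B.le_opNorm x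

theorem hasTemperateGrowth_phase (x : PhaseSpace N) : (phase B x).HasTemperateGrowth :=
  ⟨contDiff_phase_right B x, fun n => ⟨0, (‖B‖ * ‖x‖) ^ n, fun w => by
    simpa using! norm_iteratedFDeriv_phase_le B n x w⟩⟩

/-- The twisted translation `φ ↦ (w ↦ e^{i B(x, w)} φ(w - x))`. -/
def twistShift (x : PhaseSpace N) : 𝓢(PhaseSpace N, ℂ) →L[ℂ] 𝓢(PhaseSpace N, ℂ) :=
  (SchwartzMap.smulLeftCLM ℂ (phase B x)).comp (SchwartzMap.compSubConstCLM ℂ x)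

theorem twistShift_apply (x : PhaseSpace N) (φ : 𝓢(PhaseSpace N, ℂ)) (w : PhaseSpace N) :
    twistShift B x φ w = phase B x w * φ (w - x) := by
  rw [twistShift, ContinuousLinearMap.comp_apply,
    SchwartzMap.smulLeftCLM_apply_apply (hasTemperateGrowth_phase B x),
    SchwartzMap.compSubConstCLM_apply, smul_eq_mul]

theorem twistShift_zero (φ : 𝓢(PhaseSpace N, ℂ)) : twistShift B 0 φ = φ := by
  ext w
  simp [twistShift_apply, phase]

theorem coe_twistShift (x : PhaseSpace N) (φ : 𝓢(PhaseSpace N, ℂ)) :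
    ⇑(twistShift B x φ) = fun w => phase B x w * φ (w - x) :=
  funext (twistShift_apply B x φ)

theorem norm_iteratedFDeriv_twistShift_le (n : ℕ) (x : PhaseSpace N) (φ : 𝓢(PhaseSpace N, ℂ))
    (w : PhaseSpace N) : ‖iteratedFDeriv ℝ n (twistShift B x φ) w‖ ≤
      ∑ i ∈ Finset.range (n + 1), (n.choose i : ℝ) * (‖B‖ * ‖x‖) ^ i *
        ‖iteratedFDeriv ℝ (n - i) φ (w - x)‖ := by
  rw [coe_twistShift]
  have h2 : ContDiff ℝ ∞ fun w => φ (w - x) := (φ.smooth ⊤).comp (contDiff_id.sub contDiff_const)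
  refine (norm_iteratedFDeriv_mul_le (contDiff_phase_right B x) h2 w (n := n)
    (mod_cast le_top)).trans ?_
  refine Finset.sum_le_sum fun i _ => ?_
  rw [iteratedFDeriv_comp_sub]
  gcongr
  exact norm_iteratedFDeriv_phase_le B i x w

/-- The weighted derivatives of twisted translates. -/
theorem exists_norm_weightedDeriv_twistShift_le (a : ℝ) (n : ℕ) :
    ∃ q : Seminorm ℂ 𝓢(PhaseSpace N, ℂ), Continuous q ∧ ∀ φ x w,
      ‖weightedDeriv a n (twistShift B x φ) w‖ ≤ weight (n / 2 - a) x * q φ := by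
  -- The decay of `φ` at `w - x` pays for the factor `weight |a| (w - x)` in Peetre's inequality.
  obtain ⟨q, hq, h⟩ := exists_seminorm_weight N |a| n
  set C : ℝ := 2 ^ |a| * (∑ i ∈ Finset.range (n + 1), (n.choose i : ℝ) * ‖B‖ ^ i) with hC
  have hC0 : 0 ≤ C := by positivity
  refine ⟨C.toNNReal • q, hq.const_smul _, fun φ x w => ?_⟩
  rw [norm_weightedDeriv]
  have h1 : ‖iteratedFDeriv ℝ n (twistShift B x φ) w‖ * weight |a| (w - x) ≤
      (∑ i ∈ Finset.range (n + 1), (n.choose i : ℝ) * ‖B‖ ^ i) * (weight (n / 2) x * q φ) := by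
    refine (mul_le_mul_of_nonneg_right (norm_iteratedFDeriv_twistShift_le B n x φ w)
      (weight_pos _ _).le).trans ?_
    rw [Finset.sum_mul, Finset.sum_mul]
    refine Finset.sum_le_sum fun i hi => ?_
    have hi' : i ≤ n := Nat.lt_succ_iff.1 (Finset.mem_range.1 hi)
    -- Only derivatives that fall on the phase produce powers of `x`, and there are at most `n` of
    -- them.
    have h3 : ‖x‖ ^ i ≤ weight (n / 2) x :=
      (norm_pow_le_weight i x).trans (weight_mono (by gcongr) x)
    have h4 := h φ (w - x) (n - i) (Nat.sub_le _ _)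
    have h5 := weight_pos (n / 2) x
    calc (n.choose i : ℝ) * (‖B‖ * ‖x‖) ^ i * ‖iteratedFDeriv ℝ (n - i) φ (w - x)‖ *
          weight |a| (w - x) = (n.choose i : ℝ) * ‖B‖ ^ i * (‖x‖ ^ i *
          (weight |a| (w - x) * ‖iteratedFDeriv ℝ (n - i) φ (w - x)‖)) := by ring
      _ ≤ _ := by
        have := weight_pos |a| (w - x)
        gcongr
  have h2 := weight_le_mul (-a) w x
  rw [abs_neg] at h2
  calc weight (-a) w * ‖iteratedFDeriv ℝ n (twistShift B x φ) w‖
      ≤ (2 ^ |a| * weight (-a) x * weight |a| (w - x)) *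
        ‖iteratedFDeriv ℝ n (twistShift B x φ) w‖ := by gcongr
    _ = 2 ^ |a| * weight (-a) x *
        (‖iteratedFDeriv ℝ n (twistShift B x φ) w‖ * weight |a| (w - x)) := by ring
    _ ≤ 2 ^ |a| * weight (-a) x * ((∑ i ∈ Finset.range (n + 1), (n.choose i : ℝ) * ‖B‖ ^ i) *
        (weight (n / 2) x * q φ)) := by
        have := weight_pos (-a) x
        gcongr
    _ = weight (n / 2 - a) x * (C * q φ) := by rw [sub_eq_add_neg, weight_add, hC]; ring
    _ = _ := by simp [NNReal.smul_def, hC0]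

end Phase

/-! ### Norms of twisted translates in weighted spaces -/

/-- The inclusion of the Schwartz space into a weighted space. -/
def schwartzWeighted (N : ℕ) (a : ℕ → ℝ) (m : ℕ) : 𝓢(PhaseSpace N, ℂ) →ₗ[ℂ] weightedSpace N a m :=
  schwartzIncl _ (schwartz_mem_weightedSpace_of_weight a m)

theorem weightedSeminorm_le {N : ℕ} {a : ℕ → ℝ} {m : ℕ} {f : weightedSpace N a m} {c : ℝ}
    (hc : 0 ≤ c) (h : ∀ j ≤ m, ∀ u, ‖weightedDeriv (a j) j f.1 u‖ ≤ c) :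
    weightedSeminorm N a m f ≤ c :=
  Seminorm.finset_sup_apply_le hc fun j _ =>
    Real.iSup_le (fun u => h j (Nat.lt_succ_iff.1 j.2) u) hc

theorem norm_weightedDeriv_le_weightedSeminorm {N : ℕ} {a : ℕ → ℝ} {m : ℕ}
    (f : weightedSpace N a m) {j : ℕ} (hj : j ≤ m) (u : PhaseSpace N) :
    ‖weightedDeriv (a j) j f.1 u‖ ≤ weightedSeminorm N a m f := by
  let i : Fin (m + 1) := ⟨j, Nat.lt_succ_iff.2 hj⟩
  have h1 : ‖weightedDerivLM N a m i f u‖ ≤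
      supSeminorm (weightedDerivLM N a m i) (bddAbove_weightedDeriv a m i) f := by
    rw [supSeminorm_apply]
    exact le_ciSup (bddAbove_weightedDeriv a m i f) u
  have h2 : supSeminorm (weightedDerivLM N a m i) (bddAbove_weightedDeriv a m i) ≤
      weightedSeminorm N a m :=
    Finset.le_sup (f := fun j : Fin (m + 1) =>
      supSeminorm (weightedDerivLM N a m j) (bddAbove_weightedDeriv a m j)) (Finset.mem_univ i)
  exact h1.trans (Seminorm.le_def.1 h2 f)

theorem exists_finset_seminorm_ge {N : ℕ} {ι : Type*} (s : Finset ι)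
    (p : ι → Seminorm ℂ 𝓢(PhaseSpace N, ℂ)) (hp : ∀ i ∈ s, Continuous (p i)) :
    ∃ q : Seminorm ℂ 𝓢(PhaseSpace N, ℂ), Continuous q ∧ ∀ i ∈ s, ∀ φ, p i φ ≤ q φ := by
  classical
  refine ⟨s.sup p, ?_, fun i hi φ => Seminorm.le_def.1 (Finset.le_sup hi) φ⟩
  induction s using Finset.induction with
  | empty => simpa using! continuous_const
  | insert a s ha ih =>
    rw [Finset.sup_insert]
    exact (hp a (Finset.mem_insert_self a s)).sup
      (ih fun i hi => hp i (Finset.mem_insert_of_mem hi))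

/-- The norm of twisted translates in a weighted space. -/
theorem exists_weightedSeminorm_twistShift_le {N : ℕ}
    (B : PhaseSpace N →L[ℝ] PhaseSpace N →L[ℝ] ℝ) (a : ℕ → ℝ) (m : ℕ) {r : ℝ}
    (hr : ∀ j ≤ m, j / 2 - a j ≤ r) :
    ∃ q : Seminorm ℂ 𝓢(PhaseSpace N, ℂ), Continuous q ∧ ∀ φ x,
      weightedSeminorm N a m (schwartzWeighted N a m (twistShift B x φ)) ≤ weight r x * q φ := by
  choose p hp h using fun j : ℕ => exists_norm_weightedDeriv_twistShift_le B (a j) j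
  obtain ⟨q, hq, hpq⟩ := exists_finset_seminorm_ge (Finset.Iic m) p fun j _ => hp j
  refine ⟨q, hq, fun φ x => weightedSeminorm_le
    (mul_nonneg (weight_pos _ _).le (apply_nonneg _ _)) fun j hj u => ?_⟩
  refine (h j φ x u).trans ?_
  exact mul_le_mul (weight_mono (hr j hj) x) (hpq j (Finset.mem_Iic.2 hj) φ) (apply_nonneg _ _)
    (weight_pos _ _).le

/-! ### Integrals in weighted spaces -/

/-- The Banach space in which a weighted space embeds by means of the weighted derivatives. -/
def DerivTuple (N m : ℕ) : Type :=
  (j : Fin (m + 1)) → BoundedContinuousFunction (PhaseSpace N) (PhaseSpace N [×j]→L[ℝ] ℂ)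

instance (N m : ℕ) : NormedAddCommGroup (DerivTuple N m) :=
  Pi.normedAddCommGroup (G := fun j : Fin (m + 1) =>
    BoundedContinuousFunction (PhaseSpace N) (PhaseSpace N [×j]→L[ℝ] ℂ))

instance (N m : ℕ) : NormedSpace ℂ (DerivTuple N m) :=
  Pi.normedSpace (E := fun j : Fin (m + 1) =>
    BoundedContinuousFunction (PhaseSpace N) (PhaseSpace N [×j]→L[ℝ] ℂ))

instance (N m : ℕ) : CompleteSpace (DerivTuple N m) :=
  Pi.complete (fun j : Fin (m + 1) =>
    BoundedContinuousFunction (PhaseSpace N) (PhaseSpace N [×j]→L[ℝ] ℂ))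

/-- The isometric embedding of a weighted space into a Banach space. -/
def toDerivTuple (N : ℕ) (a : ℕ → ℝ) (m : ℕ) : weightedSpace N a m →ₗ[ℂ] DerivTuple N m where
  toFun f j := BoundedContinuousFunction.ofNormedAddCommGroup (weightedDeriv (a j) j f.1)
    (continuous_weightedDeriv _ (Nat.lt_succ_iff.1 j.2) f.2.1) (weightedSeminorm N a m f)
    (norm_weightedDeriv_le_weightedSeminorm f (Nat.lt_succ_iff.1 j.2))
  map_add' f g := by
    refine funext fun j => BoundedContinuousFunction.ext fun u => ?_
    exact congrFun (weightedDeriv_add (a j) (Nat.lt_succ_iff.1 j.2) f.2.1 g.2.1) u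
  map_smul' c f := by
    refine funext fun j => BoundedContinuousFunction.ext fun u => ?_
    exact congrFun (weightedDeriv_smul (a j) (Nat.lt_succ_iff.1 j.2) c f.2.1) u

section

variable {N : ℕ} {a : ℕ → ℝ} {m : ℕ}

theorem norm_toDerivTuple (f : weightedSpace N a m) :
    ‖toDerivTuple N a m f‖ = weightedSeminorm N a m f := by
  refine le_antisymm ?_ ?_
  · refine (pi_norm_le_iff_of_nonneg (apply_nonneg _ _)).2 fun j => ?_
    refine (BoundedContinuousFunction.norm_le (apply_nonneg _ _)).2 fun u => ?_
    exact norm_weightedDeriv_le_weightedSeminorm f (Nat.lt_succ_iff.1 j.2) u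
  · refine weightedSeminorm_le (norm_nonneg _) fun j hj u => ?_
    let i : Fin (m + 1) := ⟨j, Nat.lt_succ_iff.2 hj⟩
    exact ((toDerivTuple N a m f i).norm_coe_le_norm u).trans
      (norm_le_pi_norm (toDerivTuple N a m f) i)

/-- A functional that is bounded with respect to the norm pulled back along a linear map factors
through this map. -/
theorem exists_clm_comp_eq {V Y : Type} [AddCommGroup V] [Module ℂ V] [NormedAddCommGroup Y]
    [NormedSpace ℂ Y] (c : V →ₗ[ℂ] Y) (l : V →ₗ[ℂ] ℂ) (C : ℝ) (h : ∀ v, ‖l v‖ ≤ C * ‖c v‖) :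
    ∃ L : Y →L[ℂ] ℂ, ∀ v, L (c v) = l v := by
  -- A linear section of `c` over its range transports `l` to a bounded functional there, which
  -- Hahn–Banach extends.
  obtain ⟨σ, hσ⟩ := c.rangeRestrict.exists_rightInverse_of_surjective (LinearMap.range_rangeRestrict c)
  have hσ' (y : LinearMap.range c) : c (σ y) = y := congrArg Subtype.val (LinearMap.congr_fun hσ y)
  let f : StrongDual ℂ (LinearMap.range c) := (l.comp σ).mkContinuous C fun y => by
    refine (h (σ y)).trans_eq ?_
    rw [hσ']
    rfl
  obtain ⟨L, hL, -⟩ := exists_extension_norm_eq (LinearMap.range c) f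
  refine ⟨L, fun v => ?_⟩
  have h1 : L (c v) = l (σ (c.rangeRestrict v)) := hL (c.rangeRestrict v)
  -- The map `c` kills this vector, so the bound forces `l` to kill it too; the choice of section
  -- does not matter.
  have h2 := h (v - σ (c.rangeRestrict v))
  rw [map_sub, map_sub, hσ', show ((c.rangeRestrict v : LinearMap.range c) : Y) = c v from rfl,
    sub_self, norm_zero, mul_zero] at h2
  rw [h1]
  exact (sub_eq_zero.1 (norm_le_zero_iff.1 h2)).symm

/-- Evaluation of a derivative. -/
def evalDeriv (N : ℕ) {m : ℕ} (j : Fin (m + 1)) (u : PhaseSpace N) :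
    DerivTuple N m →L[ℂ] (PhaseSpace N [×j]→L[ℝ] ℂ) :=
  (BoundedContinuousFunction.evalCLM ℂ u).comp (ContinuousLinearMap.proj
    (φ := fun j : Fin (m + 1) =>
      BoundedContinuousFunction (PhaseSpace N) (PhaseSpace N [×j]→L[ℝ] ℂ)) j)

theorem iteratedFDeriv_eq_weight_smul (f : weightedSpace N a m) (j : Fin (m + 1))
    (u : PhaseSpace N) :
    iteratedFDeriv ℝ j f.1 u = weight (a j) u • evalDeriv N j u (toDerivTuple N a m f) := by
  have h : evalDeriv N j u (toDerivTuple N a m f) = weight (-a j) u • iteratedFDeriv ℝ j f.1 u :=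
    rfl
  rw [h, smul_smul, mul_comm, weight_neg_mul, one_smul]

variable {X : Type} [MeasurableSpace X] {μ : Measure X} {Ψ : X → weightedSpace N a m}

theorem integrable_iteratedFDeriv (hΨ : Integrable (fun s => toDerivTuple N a m (Ψ s)) μ)
    (j : Fin (m + 1)) (u : PhaseSpace N) :
    Integrable (fun s => iteratedFDeriv ℝ j (Ψ s).1 u) μ := by
  simp only [iteratedFDeriv_eq_weight_smul]
  exact ((evalDeriv N j u).integrable_comp hΨ).smul (weight (a j) u)

theorem integral_iteratedFDeriv (hΨ : Integrable (fun s => toDerivTuple N a m (Ψ s)) μ)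
    (j : Fin (m + 1)) (u : PhaseSpace N) :
    ∫ s, iteratedFDeriv ℝ j (Ψ s).1 u ∂μ =
      weight (a j) u • evalDeriv N j u (∫ s, toDerivTuple N a m (Ψ s) ∂μ) := by
  simp only [iteratedFDeriv_eq_weight_smul]
  rw [integral_smul, (evalDeriv N j u).integral_comp_comm hΨ]

/-- Currying of the first variable, as a continuous linear map. -/
def curryLeftCLM (N n : ℕ) : (PhaseSpace N [×(n + 1)]→L[ℝ] ℂ) →L[ℝ]
    (PhaseSpace N →L[ℝ] (PhaseSpace N [×n]→L[ℝ] ℂ)) :=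
  (continuousMultilinearCurryLeftEquiv ℝ
    (fun _ : Fin (n + 1) => PhaseSpace N) ℂ).toContinuousLinearEquiv.toContinuousLinearMap

theorem integral_curryLeft {n : ℕ} {F : X → PhaseSpace N [×(n + 1)]→L[ℝ] ℂ} (hF : Integrable F μ) :
    ∫ s, (F s).curryLeft ∂μ = (∫ s, F s ∂μ).curryLeft := by
  have h := ContinuousLinearMap.integral_comp_comm (𝕜 := ℝ)
    (Fₗ := PhaseSpace N →L[ℝ] (PhaseSpace N [×n]→L[ℝ] ℂ)) (curryLeftCLM N n) hF
  exact h

/-- Differentiation under the integral sign: on a ball around `u` the weight is bounded, so a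
multiple of the norm of `Ψ s` dominates the next derivative. -/
theorem hasFDerivAt_integral_iteratedFDeriv
    (hΨ : Integrable (fun s => toDerivTuple N a m (Ψ s)) μ) {n : ℕ} (hn : n < m)
    (u : PhaseSpace N) :
    HasFDerivAt (fun u => ∫ s, iteratedFDeriv ℝ n (Ψ s).1 u ∂μ)
      (∫ s, iteratedFDeriv ℝ (n + 1) (Ψ s).1 u ∂μ).curryLeft u := by
  let j : Fin (m + 1) := ⟨n, by omega⟩
  let j' : Fin (m + 1) := ⟨n + 1, by omega⟩
  have h1 (x : PhaseSpace N) := integrable_iteratedFDeriv hΨ j x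
  have h2 (x : PhaseSpace N) := integrable_iteratedFDeriv hΨ j' x
  obtain ⟨M, hM⟩ := (isCompact_closedBall u 1).bddAbove_image
    (continuous_weight (N := N) (a j')).continuousOn
  have hF (s : X) (x : PhaseSpace N) : HasFDerivAt (fun x => iteratedFDeriv ℝ n (Ψ s).1 x)
      (iteratedFDeriv ℝ (n + 1) (Ψ s).1 x).curryLeft x := by
    have h4 : DifferentiableAt ℝ (iteratedFDeriv ℝ n (Ψ s).1) x :=
      ((Ψ s).2.1.differentiable_iteratedFDeriv (by exact_mod_cast hn)) x
    exact h4.hasFDerivAt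
  have hb (s : X) (x : PhaseSpace N) (hx : x ∈ Metric.ball u 1) :
      ‖(iteratedFDeriv ℝ (n + 1) (Ψ s).1 x).curryLeft‖ ≤ M * ‖toDerivTuple N a m (Ψ s)‖ := by
    have hx' : weight (a j') x ≤ M :=
      hM ⟨x, Metric.ball_subset_closedBall hx, rfl⟩
    rw [ContinuousMultilinearMap.curryLeft_norm]
    have h5 : ‖evalDeriv N j' x (toDerivTuple N a m (Ψ s))‖ ≤ ‖toDerivTuple N a m (Ψ s)‖ :=
      ((toDerivTuple N a m (Ψ s) j').norm_coe_le_norm x).trans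
        (norm_le_pi_norm (toDerivTuple N a m (Ψ s)) j')
    have h6 : iteratedFDeriv ℝ (n + 1) (Ψ s).1 x =
      weight (a j') x • evalDeriv N j' x (toDerivTuple N a m (Ψ s)) :=
      iteratedFDeriv_eq_weight_smul (Ψ s) j' x
    rw [h6, norm_smul, Real.norm_of_nonneg (weight_pos _ _).le]
    exact mul_le_mul hx' h5 (norm_nonneg _) ((weight_pos _ _).le.trans hx')
  have hm : AEStronglyMeasurable (fun s => (iteratedFDeriv ℝ (n + 1) (Ψ s).1 u).curryLeft) μ :=
    (curryLeftCLM N n).continuous.comp_aestronglyMeasurable (h2 u).1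
  rw [← integral_curryLeft (h2 u)]
  exact hasFDerivAt_integral_of_dominated_of_fderiv_le (𝕜 := ℝ) (s := Metric.ball u 1)
    (F := fun x s => iteratedFDeriv ℝ n (Ψ s).1 x)
    (F' := fun x s => (iteratedFDeriv ℝ (n + 1) (Ψ s).1 x).curryLeft)
    (bound := fun s => M * ‖toDerivTuple N a m (Ψ s)‖) (Metric.ball_mem_nhds u one_pos)
    (Eventually.of_forall fun x => (h1 x).1) (h1 u) hm
    (Eventually.of_forall hb) (hΨ.norm.const_mul M)
    (Eventually.of_forall fun s x _ => hF s x)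

/-- This identifies a Bochner integral in the large Banach space with a pointwise integral. The
integrated derivatives form a Taylor series of `Φ` up to order `m`, hence are its derivatives.
Completeness of the weighted space is not needed, because `Φ` is given as an element of it. -/
theorem toDerivTuple_eq_integral (hΨ : Integrable (fun s => toDerivTuple N a m (Ψ s)) μ)
    (Φ : weightedSpace N a m) (hΦ : ∀ u, Φ.1 u = ∫ s, (Ψ s).1 u ∂μ) :
    toDerivTuple N a m Φ = ∫ s, toDerivTuple N a m (Ψ s) ∂μ := by
  have hT : HasFTaylorSeriesUpTo m Φ.1
      fun u n => ∫ s, iteratedFDeriv ℝ n (Ψ s).1 u ∂μ := by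
    refine ⟨fun u => ?_, fun n hn u => ?_, fun n hn => ?_⟩
    · rw [hΦ]
      have h := integrable_iteratedFDeriv hΨ 0 u
      have h2 := (continuousMultilinearCurryFin0 ℝ (PhaseSpace N) ℂ).toContinuousLinearEquiv.integral_comp_comm
        (μ := μ) (fun s => iteratedFDeriv ℝ 0 (Ψ s).1 u)
      exact h2.symm
    · exact hasFDerivAt_integral_iteratedFDeriv hΨ (by exact_mod_cast hn) u
    · let j : Fin (m + 1) := ⟨n, Nat.lt_succ_iff.2 (by exact_mod_cast hn)⟩
      have h : (fun u => ∫ s, iteratedFDeriv ℝ n (Ψ s).1 u ∂μ) =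
          fun u => weight (a j) u • (∫ s, toDerivTuple N a m (Ψ s) ∂μ) j u :=
        funext fun u => integral_iteratedFDeriv hΨ j u
      rw [h]
      exact (continuous_weight _).smul ((∫ s, toDerivTuple N a m (Ψ s) ∂μ) j).continuous
  refine funext fun j => BoundedContinuousFunction.ext fun u => ?_
  have h1 : iteratedFDeriv ℝ j Φ.1 u = ∫ s, iteratedFDeriv ℝ j (Ψ s).1 u ∂μ :=
    (hT.eq_iteratedFDeriv (by exact_mod_cast Nat.lt_succ_iff.1 j.2) u).symm
  rw [iteratedFDeriv_eq_weight_smul, integral_iteratedFDeriv hΨ] at h1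
  exact smul_right_injective _ (weight_pos (a j) u).ne' h1

/-- A functional that is bounded by a weighted norm commutes with integrals. -/
theorem integral_comp_of_bounded {V : Type} [AddCommGroup V] [Module ℂ V]
    (c : V →ₗ[ℂ] weightedSpace N a m) (l : V →ₗ[ℂ] ℂ) (C : ℝ)
    (hl : ∀ v, ‖l v‖ ≤ C * weightedSeminorm N a m (c v)) (Ψ : X → V) (Φ : V)
    (hΨ : Integrable (fun s => toDerivTuple N a m (c (Ψ s))) μ)
    (hΦ : ∀ u, (c Φ).1 u = ∫ s, (c (Ψ s)).1 u ∂μ) :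
    Integrable (fun s => l (Ψ s)) μ ∧ l Φ = ∫ s, l (Ψ s) ∂μ := by
  obtain ⟨L, hL⟩ := exists_clm_comp_eq ((toDerivTuple N a m).comp c) l C fun v =>
    (hl v).trans_eq (by rw [← norm_toDerivTuple]; rfl)
  have hL' (v : V) : l v = L (toDerivTuple N a m (c v)) := (hL v).symm
  simp only [hL']
  refine ⟨L.integrable_comp hΨ, ?_⟩
  rw [toDerivTuple_eq_integral hΨ (c Φ) hΦ]
  exact (L.integral_comp_comm hΨ).symm

end

/-! ### Continuity and integrals of twisted translates -/

/-- Serves to make the derivatives of `K_x φ` at `w` jointly continuous in `(x, w)`. -/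
theorem contDiff_iteratedFDeriv_uncurry {E F : Type} [NormedAddCommGroup E] [NormedSpace ℝ E]
    [NormedAddCommGroup F] [NormedSpace ℝ F] {G : E → E → F}
    (h : ContDiff ℝ ∞ fun p : E × E => G p.1 p.2) (n : ℕ) :
    ContDiff ℝ ∞ fun p : E × E => iteratedFDeriv ℝ n (G p.1) p.2 := by
  induction n with
  | zero =>
    simp only [iteratedFDeriv_zero_eq_comp]
    exact (continuousMultilinearCurryFin0 ℝ E F).symm.contDiff.comp h
  | succ n ih =>
    simp only [iteratedFDeriv_succ_eq_comp_left]
    have hc : ContDiff ℝ ∞ (continuousMultilinearCurryLeftEquiv ℝ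
        (fun _ : Fin (n + 1) => E) F).symm := by
      exact LinearIsometryEquiv.contDiff (E := E →L[ℝ] (E [×n]→L[ℝ] F)) (F := E [×(n + 1)]→L[ℝ] F) _
    refine hc.comp ?_
    refine ContDiff.fderiv (f := fun p : E × E => iteratedFDeriv ℝ n (G p.1)) (g := Prod.snd)
      (n := ∞) ?_ contDiff_snd le_rfl
    exact ih.comp ((contDiff_fst.comp contDiff_fst).prodMk contDiff_snd)

section

variable {N : ℕ} (B : PhaseSpace N →L[ℝ] PhaseSpace N →L[ℝ] ℝ)

theorem continuous_weightedDeriv_twistShift (a : ℝ) (j : ℕ) (φ : 𝓢(PhaseSpace N, ℂ)) :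
    Continuous fun p : PhaseSpace N × PhaseSpace N => weightedDeriv a j (twistShift B p.1 φ) p.2 := by
  refine ((continuous_weight (-a)).comp continuous_snd).smul ?_
  simp only [coe_twistShift]
  refine (contDiff_iteratedFDeriv_uncurry (G := fun x w => phase B x w * φ (w - x)) ?_ j).continuous
  exact (contDiff_phase B).mul ((φ.smooth ⊤).comp (contDiff_snd.sub contDiff_fst))

theorem tendsto_weight_cocompact {r : ℝ} (hr : r < 0) :
    Tendsto (weight r : PhaseSpace N → ℝ) (cocompact _) (𝓝 0) := by
  have h1 : Tendsto (fun u : PhaseSpace N => 1 + ‖u‖ ^ 2) (cocompact _) atTop :=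
    tendsto_atTop_add_const_left _ _
      ((tendsto_pow_atTop two_ne_zero).comp (tendsto_norm_cocompact_atTop (E := PhaseSpace N)))
  have h2 := (tendsto_rpow_neg_atTop (neg_pos.2 hr)).comp h1
  rw [neg_neg] at h2
  exact h2

/-- Uniform convergence in `w` is checked separately outside a compact set, where the weighted
derivatives are small uniformly for `x` near `x₀`, and on the compact set, where joint continuity
suffices. The lemma provides the measurability needed for Bochner integrals. -/
theorem continuous_toDerivTuple_twistShift (a : ℕ → ℝ) (m : ℕ) (φ : 𝓢(PhaseSpace N, ℂ)) :
    Continuous fun x => toDerivTuple N a m (schwartzWeighted N a m (twistShift B x φ)) := by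
  refine continuous_pi fun j => continuous_iff_continuousAt.2 fun x₀ => ?_
  refine BoundedContinuousFunction.tendsto_iff_tendstoUniformly.2
    (Metric.tendstoUniformly_iff.2 fun ε hε => ?_)
  -- The bound for a weight stronger by half a power leaves the factor `weight (-(1 / 2)) w`, which
  -- tends to zero at infinity.
  obtain ⟨q, -, hq⟩ := exists_norm_weightedDeriv_twistShift_le B (a j - 1 / 2) j
  obtain ⟨M, hM⟩ := (isCompact_closedBall x₀ 1).bddAbove_image
    (continuous_weight (N := N) (j / 2 - (a j - 1 / 2))).continuousOn
  have hM0 : 0 ≤ M := (weight_pos _ x₀).le.trans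
    (hM ⟨x₀, Metric.mem_closedBall_self zero_le_one, rfl⟩)
  have hb (x : PhaseSpace N) (hx : x ∈ Metric.closedBall x₀ 1) (w : PhaseSpace N) :
      ‖weightedDeriv (a j) j (twistShift B x φ) w‖ ≤ weight (-(1 / 2)) w * (M * q φ) := by
    have h1 : ‖weightedDeriv (a j) j (twistShift B x φ) w‖ =
        weight (-(1 / 2)) w * ‖weightedDeriv (a j - 1 / 2) j (twistShift B x φ) w‖ := by
      rw [norm_weightedDeriv, norm_weightedDeriv, ← mul_assoc, ← weight_add]
      congr 2
      ring
    rw [h1]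
    have := weight_pos (-(1 / 2)) w
    have := apply_nonneg q φ
    gcongr
    exact (hq φ x w).trans (mul_le_mul_of_nonneg_right (hM ⟨x, hx, rfl⟩) this)
  have h3 : ∀ᶠ w in cocompact (PhaseSpace N), weight (-(1 / 2)) w * (M * q φ) < ε / 2 := by
    have h := (tendsto_weight_cocompact (N := N) (r := -(1 / 2)) (by norm_num)).mul_const (M * q φ)
    rw [zero_mul] at h
    exact h.eventually_lt_const (half_pos hε)
  obtain ⟨K, hK, hKw⟩ := mem_cocompact.1 h3
  have h4 : ∀ᶠ x in 𝓝 x₀, ∀ w ∈ K, dist (weightedDeriv (a j) j (twistShift B x₀ φ) w)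
      (weightedDeriv (a j) j (twistShift B x φ) w) < ε := by
    refine hK.eventually_forall_of_forall_eventually fun w _ => ?_
    have hc := continuous_weightedDeriv_twistShift B (a j) j φ
    have hc2 : Continuous fun z : PhaseSpace N × PhaseSpace N =>
        dist (weightedDeriv (a j) j (twistShift B x₀ φ) z.2)
          (weightedDeriv (a j) j (twistShift B z.1 φ) z.2) :=
      (hc.comp (continuous_const.prodMk continuous_snd)).dist hc
    exact hc2.continuousAt.eventually_lt_const (by simpa using! hε)
  filter_upwards [h4, Metric.closedBall_mem_nhds x₀ one_pos] with x hx hxb w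
  by_cases hw : w ∈ K
  · exact hx w hw
  · have h5 := hKw hw
    refine (dist_le_norm_add_norm _ _).trans_lt ?_
    have h6 := hb x hxb w
    have h7 := hb x₀ (Metric.mem_closedBall_self zero_le_one) w
    have h8 : weight (-(1 / 2)) w * (M * q φ) < ε / 2 := h5
    exact (add_le_add h7 h6).trans_lt (by linarith)

variable {a : ℕ → ℝ} {m : ℕ}

/-- A superposition of twisted translates whose coefficients have controlled growth is integrable
in a weighted space. -/
theorem integrable_toDerivTuple_twistShift {r b C : ℝ} (hr : ∀ j ≤ m, j / 2 - a j ≤ r)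
    (hb : b + r < -N) {ρ : PhaseSpace N → ℂ} (hρ : Continuous ρ) (hC : ∀ s, ‖ρ s‖ ≤ C * weight b s)
    (φ : 𝓢(PhaseSpace N, ℂ)) :
    Integrable (fun s => toDerivTuple N a m (schwartzWeighted N a m (ρ s • twistShift B s φ)))
      (phaseMeasure N) := by
  obtain ⟨q, -, hq⟩ := exists_weightedSeminorm_twistShift_le B a m hr
  simp only [map_smul]
  refine Integrable.mono' ((integrable_weight hb).const_mul (C * q φ))
    (hρ.smul (continuous_toDerivTuple_twistShift B a m φ)).aestronglyMeasurable
    (Eventually.of_forall fun s => ?_)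
  rw [norm_smul, norm_toDerivTuple, weight_add]
  calc ‖ρ s‖ * weightedSeminorm N a m (schwartzWeighted N a m (twistShift B s φ))
      ≤ (C * weight b s) * (weight r s * q φ) :=
        mul_le_mul (hC s) (hq φ s) (apply_nonneg _ _) ((norm_nonneg _).trans (hC s))
    _ = _ := by ring

/-- Functionals that are bounded by a weighted norm commute with superpositions of twisted
translates. -/
theorem apply_integral_twistShift {V : Type} [AddCommGroup V] [Module ℂ V]
    (c : V →ₗ[ℂ] weightedSpace N a m) (l : V →ₗ[ℂ] ℂ) {C₀ : ℝ}
    (hl : ∀ v, ‖l v‖ ≤ C₀ * weightedSeminorm N a m (c v)) (e : 𝓢(PhaseSpace N, ℂ) →ₗ[ℂ] V)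
    (he : ∀ φ, c (e φ) = schwartzWeighted N a m φ) {r b C : ℝ} (hr : ∀ j ≤ m, j / 2 - a j ≤ r)
    (hb : b + r < -N) {ρ : PhaseSpace N → ℂ} (hρ : Continuous ρ) (hC : ∀ s, ‖ρ s‖ ≤ C * weight b s)
    (φ : 𝓢(PhaseSpace N, ℂ)) (Φ : V)
    (hΦ : ∀ u, (c Φ).1 u = ∫ s, ρ s * twistShift B s φ u ∂phaseMeasure N) :
    Integrable (fun s => ρ s * l (e (twistShift B s φ))) (phaseMeasure N) ∧
      l Φ = ∫ s, ρ s * l (e (twistShift B s φ)) ∂phaseMeasure N := by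
  have h := integral_comp_of_bounded (μ := phaseMeasure N) c l C₀ hl
    (fun s => e (ρ s • twistShift B s φ)) Φ
    (by simpa only [he] using! integrable_toDerivTuple_twistShift B hr hb hρ hC φ)
    (fun u => by simp only [he]; exact hΦ u)
  simpa only [map_smul, smul_eq_mul] using! h

end

/-! ### Bounds of tempered distributions -/

section

variable {N : ℕ}

/-- A tempered distribution as a linear map. -/
def temperedLM (T : 𝓢'(PhaseSpace N, ℂ)) : 𝓢(PhaseSpace N, ℂ) →ₗ[ℂ] ℂ where
  toFun φ := T φ
  map_add' := map_add T
  map_smul' := map_smul T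

/-- A tempered distribution is bounded by a weighted norm. -/
theorem exists_tempered_bound (T : 𝓢'(PhaseSpace N, ℂ)) : ∃ (K m : ℕ) (C : ℝ), 0 ≤ C ∧
    ∀ φ, ‖T φ‖ ≤ C * weightedSeminorm N (fun _ => -(K : ℝ)) m
      (schwartzWeighted N (fun _ => -(K : ℝ)) m φ) := by
  let q : Seminorm ℂ 𝓢(PhaseSpace N, ℂ) :=
    (normSeminorm ℂ ℂ).comp (temperedLM T)
  have hq : Continuous q := T.continuous.norm
  obtain ⟨s, C, -, h⟩ := Seminorm.bound_of_continuous
    (schwartz_withSeminorms ℂ (PhaseSpace N) ℂ) q hq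
  -- Finitely many Schwartz seminorms bound `T`; the largest power and the largest order among them
  -- dominate all. The negative exponent `-K` makes the weight a growing one.
  refine ⟨s.sup Prod.fst, s.sup Prod.snd, C, C.2, fun φ => ?_⟩
  refine (h φ).trans ?_
  rw [smul_apply, NNReal.smul_def, smul_eq_mul]
  gcongr
  refine Seminorm.finset_sup_apply_le (apply_nonneg _ _) fun i hi => ?_
  refine SchwartzMap.seminorm_le_bound ℂ i.1 i.2 φ (apply_nonneg _ _) fun u => ?_
  refine le_trans ?_ (norm_weightedDeriv_le_weightedSeminorm
    (schwartzWeighted N (fun _ => -((s.sup Prod.fst : ℕ) : ℝ)) (s.sup Prod.snd) φ)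
    (Finset.le_sup (f := Prod.snd) hi) u)
  rw [norm_weightedDeriv, neg_neg]
  refine mul_le_mul_of_nonneg_right ((norm_pow_le_weight i.1 u).trans (weight_mono ?_ u))
    (norm_nonneg _)
  have h1 : (i.1 : ℝ) ≤ (s.sup Prod.fst : ℕ) := by exact_mod_cast Finset.le_sup (f := Prod.fst) hi
  have h2 : (0 : ℝ) ≤ i.1 := by positivity
  linarith

/-- A Schwartz function decays faster than any weight. -/
theorem exists_norm_le_weight (f : 𝓢(PhaseSpace N, ℂ)) (b : ℝ) :
    ∃ C, ∀ u, ‖f u‖ ≤ C * weight b u := by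
  obtain ⟨q, -, hq⟩ := exists_seminorm_weight N (-b) 0
  refine ⟨q f, fun u => ?_⟩
  have h := hq f u 0 le_rfl
  rw [norm_iteratedFDeriv_zero] at h
  calc ‖f u‖ = (weight (-b) u * ‖f u‖) * weight b u := by
        rw [mul_right_comm, weight_neg_mul, one_mul]
    _ ≤ _ := by
        have := weight_pos b u
        gcongr

/-- Tempered distributions commute with superpositions of twisted translates. -/
theorem tempered_integral_twistShift (B : PhaseSpace N →L[ℝ] PhaseSpace N →L[ℝ] ℝ)
    (T : 𝓢'(PhaseSpace N, ℂ)) (ρ φ Φ : 𝓢(PhaseSpace N, ℂ))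
    (hΦ : ∀ u, Φ u = ∫ s, ρ s * twistShift B s φ u ∂phaseMeasure N) :
    Integrable (fun s => ρ s * T (twistShift B s φ)) (phaseMeasure N) ∧
      T Φ = ∫ s, ρ s * T (twistShift B s φ) ∂phaseMeasure N := by
  obtain ⟨K, m, C, -, hT⟩ := exists_tempered_bound T
  -- The translates grow at most like the power `m / 2 + K`; this decay of `ρ` brings the total
  -- exponent to `-N - 1`, below the threshold `-N` for integrability on `ℝ^{2N}`.
  obtain ⟨C', hC'⟩ := exists_norm_le_weight ρ (-N - 1 - (m / 2 + K))
  refine apply_integral_twistShift B (schwartzWeighted N (fun _ => -(K : ℝ)) m)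
    (temperedLM T) hT LinearMap.id (fun _ => rfl) (r := m / 2 + K)
    (fun j hj => ?_) ?_ ρ.continuous hC' φ Φ hΦ
  · rw [sub_neg_eq_add]
    gcongr
  · linarith

end

/-! ### The functions `x ↦ ⟨T, K_x φ⟩` -/

/-- Differentiability follows from a fundamental theorem of calculus along segments once the
candidate derivative is continuous. Thus `T` need only be exchanged with integrals, not with limits
of difference quotients. -/
theorem hasFDerivAt_of_integral_segment {E F : Type} [NormedAddCommGroup E] [NormedSpace ℝ E]
    [NormedAddCommGroup F] [NormedSpace ℝ F] [CompleteSpace F] {f : E → F} {g : E → E →L[ℝ] F}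
    (hg : Continuous g) (h : ∀ x v, f (x + v) - f x = ∫ t in (0 : ℝ)..1, g (x + t • v) v) (x : E) :
    HasFDerivAt f (g x) x := by
  rw [hasFDerivAt_iff_isLittleO_nhds_zero, Asymptotics.isLittleO_iff]
  intro ε hε
  obtain ⟨δ, hδ, hb⟩ := Metric.continuousAt_iff.1 (hg.continuousAt (x := x)) ε hε
  filter_upwards [Metric.ball_mem_nhds 0 hδ] with v hv
  have hc : Continuous fun t : ℝ => g (x + t • v) v := by fun_prop
  have h1 : f (x + v) - f x - g x v = ∫ t in (0 : ℝ)..1, (g (x + t • v) v - g x v) := by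
    rw [h, intervalIntegral.integral_sub (hc.intervalIntegrable _ _)
      (continuous_const.intervalIntegrable _ _)]
    simp
  rw [h1]
  refine (intervalIntegral.norm_integral_le_of_norm_le_const (C := ε * ‖v‖) fun t ht => ?_).trans ?_
  · rw [Set.uIoc_of_le zero_le_one] at ht
    rw [← sub_apply]
    refine ((g (x + t • v) - g x).le_opNorm v).trans ?_
    gcongr
    rw [← dist_eq_norm]
    refine (hb ?_).le
    rw [dist_eq_norm, add_sub_cancel_left, norm_smul, Real.norm_of_nonneg ht.1.le]
    rw [mem_ball_zero_iff] at hv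
    nlinarith [norm_nonneg v, ht.1, ht.2]
  · simp

section

variable {N : ℕ} (B : PhaseSpace N →L[ℝ] PhaseSpace N →L[ℝ] ℝ)

/-- The infinitesimal generator `φ ↦ i B(v, ·) φ - ∂_v φ` of the twisted translations. -/
def generator (v : PhaseSpace N) : 𝓢(PhaseSpace N, ℂ) →L[ℂ] 𝓢(PhaseSpace N, ℂ) :=
  Complex.I • SchwartzMap.smulLeftCLM ℂ (fun w => (B v w : ℂ)) -
    LineDeriv.lineDerivOpCLM ℂ 𝓢(PhaseSpace N, ℂ) v

theorem generator_apply (v : PhaseSpace N) (φ : 𝓢(PhaseSpace N, ℂ)) (w : PhaseSpace N) :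
    generator B v φ w = Complex.I * B v w * φ w - fderiv ℝ φ w v := by
  have h : (fun w => (B v w : ℂ)).HasTemperateGrowth :=
    (Complex.ofRealCLM.comp (B v)).hasTemperateGrowth
  have h1 : generator B v φ = Complex.I • SchwartzMap.smulLeftCLM ℂ (fun w => (B v w : ℂ)) φ -
    LineDeriv.lineDerivOp v φ := rfl
  rw [h1, sub_apply, smul_apply, SchwartzMap.smulLeftCLM_apply_apply h,
    SchwartzMap.lineDerivOp_apply_eq_fderiv]
  simp [mul_assoc]

theorem generator_add (v v' : PhaseSpace N) (φ : 𝓢(PhaseSpace N, ℂ)) :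
    generator B (v + v') φ = generator B v φ + generator B v' φ := by
  ext w
  simp only [generator_apply, add_apply, map_add, Complex.ofReal_add]
  ring

theorem generator_smul (c : ℝ) (v : PhaseSpace N) (φ : 𝓢(PhaseSpace N, ℂ)) :
    generator B (c • v) φ = (c : ℂ) • generator B v φ := by
  ext w
  simp only [generator_apply, smul_apply, map_smul, smul_eq_mul, Complex.ofReal_mul,
    Complex.real_smul]
  ring

/-- The function `x ↦ ⟨T, K_x φ⟩`. -/
def matrixCoeff (T : 𝓢'(PhaseSpace N, ℂ)) (φ : 𝓢(PhaseSpace N, ℂ)) (x : PhaseSpace N) : ℂ :=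
  T (twistShift B x φ)

theorem matrixCoeff_add (T : 𝓢'(PhaseSpace N, ℂ)) (φ ψ : 𝓢(PhaseSpace N, ℂ)) :
    matrixCoeff B T (φ + ψ) = matrixCoeff B T φ + matrixCoeff B T ψ := by
  ext x
  simp [matrixCoeff]

theorem matrixCoeff_smul (T : 𝓢'(PhaseSpace N, ℂ)) (c : ℂ) (φ : 𝓢(PhaseSpace N, ℂ)) :
    matrixCoeff B T (c • φ) = c • matrixCoeff B T φ := by
  ext x
  simp [matrixCoeff]

theorem continuous_matrixCoeff (T : 𝓢'(PhaseSpace N, ℂ)) (φ : 𝓢(PhaseSpace N, ℂ)) :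
    Continuous (matrixCoeff B T φ) := by
  obtain ⟨K, m, C, -, hT⟩ := exists_tempered_bound T
  obtain ⟨L, hL⟩ := exists_clm_comp_eq
    ((toDerivTuple N (fun _ => -(K : ℝ)) m).comp (schwartzWeighted N (fun _ => -(K : ℝ)) m))
    (temperedLM T) C fun v => (hT v).trans_eq (by rw [← norm_toDerivTuple]; rfl)
  have h : matrixCoeff B T φ = fun x => L (toDerivTuple N (fun _ => -(K : ℝ)) m
    (schwartzWeighted N (fun _ => -(K : ℝ)) m (twistShift B x φ))) :=
    funext fun x => (hL (twistShift B x φ)).symm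
  rw [h]
  exact L.continuous.comp (continuous_toDerivTuple_twistShift B _ m φ)

/-- The derivative of `x ↦ ⟨T, K_x φ⟩` in the direction `v`. -/
def matrixCoeffDeriv (T : 𝓢'(PhaseSpace N, ℂ)) (φ : 𝓢(PhaseSpace N, ℂ)) (v x : PhaseSpace N) : ℂ :=
  matrixCoeff B T (generator B v φ) x + Complex.I * B v x * matrixCoeff B T φ x

/-- With `y = x + t v`, the phase contributes `i B(v, w) = i B(v, w - y) + i B(v, y)`. The first
summand is part of the generator evaluated at `w - y`; the second does not depend on `w` and remains
a scalar when a functional is applied. -/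
theorem hasDerivAt_twistShift (φ : 𝓢(PhaseSpace N, ℂ)) (x v w : PhaseSpace N) (t : ℝ) :
    HasDerivAt (fun t : ℝ => twistShift B (x + t • v) φ w)
      (twistShift B (x + t • v) (generator B v φ) w +
        Complex.I * B v (x + t • v) * twistShift B (x + t • v) φ w) t := by
  have h1 : HasDerivAt (fun t : ℝ => phase B (x + t • v) w)
      (phase B (x + t • v) w * (B v w * Complex.I)) t := by
    have h0 : HasDerivAt (fun t : ℝ => B (x + t • v) w) (B v w) t := by
      have : (fun t : ℝ => B (x + t • v) w) = fun t : ℝ => B x w + t * B v w := by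
        ext t
        simp
      rw [this]
      simpa using! ((hasDerivAt_id t).mul_const (B v w)).const_add (B x w)
    exact (h0.ofReal_comp.mul_const Complex.I).cexp
  have h2 : HasDerivAt (fun t : ℝ => φ (w - (x + t • v)))
      (fderiv ℝ φ (w - (x + t • v)) (-v)) t := by
    have h0 : HasDerivAt (fun t : ℝ => w - (x + t • v)) (-v) t := by
      simpa using! (((hasDerivAt_id t).smul_const v).const_add x).const_sub w
    exact (φ.hasFDerivAt _).comp_hasDerivAt t h0
  have h3 := h1.mul h2
  simp only [twistShift_apply, generator_apply]
  convert! h3 using 1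
  simp only [map_sub, map_neg, Complex.ofReal_sub]
  ring

theorem twistShift_sub_eq_integral (φ : 𝓢(PhaseSpace N, ℂ)) (x v w : PhaseSpace N) :
    twistShift B (x + v) φ w - twistShift B x φ w =
      ∫ t in (0 : ℝ)..1, (twistShift B (x + t • v) (generator B v φ) w +
        Complex.I * B v (x + t • v) * twistShift B (x + t • v) φ w) := by
  rw [intervalIntegral.integral_eq_sub_of_hasDerivAt
    (fun t _ => hasDerivAt_twistShift B φ x v w t)]
  · simp
  · refine Continuous.intervalIntegrable ?_ _ _
    have hg := (generator B v φ).continuous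
    have hf := φ.continuous
    simp only [twistShift_apply, phase]
    fun_prop

/-- `T` is applied under the integral sign to the pointwise identity `twistShift_sub_eq_integral`.
-/
theorem matrixCoeff_sub_eq_integral (T : 𝓢'(PhaseSpace N, ℂ)) (φ : 𝓢(PhaseSpace N, ℂ))
    (x v : PhaseSpace N) : matrixCoeff B T φ (x + v) - matrixCoeff B T φ x =
      ∫ t in (0 : ℝ)..1, matrixCoeffDeriv B T φ v (x + t • v) := by
  obtain ⟨K, m, C, -, hT⟩ := exists_tempered_bound T
  have hc (ψ : 𝓢(PhaseSpace N, ℂ)) : Continuous fun t : ℝ => toDerivTuple N (fun _ => -(K : ℝ)) m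
      (schwartzWeighted N (fun _ => -(K : ℝ)) m (twistShift B (x + t • v) ψ)) :=
    (continuous_toDerivTuple_twistShift B _ m ψ).comp (by fun_prop)
  have h := integral_comp_of_bounded (μ := volume.restrict (Set.Ioc (0 : ℝ) 1))
    (schwartzWeighted N (fun _ => -(K : ℝ)) m) (temperedLM T) C hT
    (fun t : ℝ => twistShift B (x + t • v) (generator B v φ) +
        (Complex.I * B v (x + t • v)) • twistShift B (x + t • v) φ)
    (twistShift B (x + v) φ - twistShift B x φ) ?_ fun w => ?_
  · rw [intervalIntegral.integral_of_le zero_le_one]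
    have h2 := h.2
    rw [map_sub] at h2
    refine Eq.trans h2 (integral_congr_ae (Eventually.of_forall fun t => ?_))
    exact (map_add (temperedLM T) _ _).trans
      (congrArg _ (map_smul (temperedLM T) (Complex.I * (B v (x + t • v) : ℝ) : ℂ) _))
  · have hs : Continuous fun t : ℝ => Complex.I * (B v (x + t • v) : ℂ) := by fun_prop
    refine (Continuous.integrableOn_Icc ?_).mono_set Set.Ioc_subset_Icc_self
    have h := (hc (generator B v φ)).add (hs.smul (hc φ))
    refine h.congr fun t => ?_
    rw [map_add, map_add, map_smul, map_smul]
    rfl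
  · rw [← intervalIntegral.integral_of_le zero_le_one]
    exact twistShift_sub_eq_integral B φ x v w

/-- The derivative of `x ↦ ⟨T, K_x φ⟩`. -/
def matrixCoeffFDeriv (T : 𝓢'(PhaseSpace N, ℂ)) (φ : 𝓢(PhaseSpace N, ℂ)) (x : PhaseSpace N) :
    PhaseSpace N →L[ℝ] ℂ :=
  LinearMap.toContinuousLinearMap
    { toFun := fun v => matrixCoeffDeriv B T φ v x
      map_add' := fun v v' => by
        simp only [matrixCoeffDeriv, generator_add, matrixCoeff_add, Pi.add_apply, map_add,
          Complex.ofReal_add, add_apply]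
        ring
      map_smul' := fun c v => by
        simp only [matrixCoeffDeriv, generator_smul, matrixCoeff_smul, Pi.smul_apply, map_smul,
          smul_apply, smul_eq_mul, Complex.ofReal_mul, RingHom.id_apply, Complex.real_smul]
        ring }

theorem matrixCoeffFDeriv_apply (T : 𝓢'(PhaseSpace N, ℂ)) (φ : 𝓢(PhaseSpace N, ℂ))
    (x v : PhaseSpace N) : matrixCoeffFDeriv B T φ x v = matrixCoeffDeriv B T φ v x := rfl

theorem hasFDerivAt_matrixCoeff (T : 𝓢'(PhaseSpace N, ℂ)) (φ : 𝓢(PhaseSpace N, ℂ))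
    (x : PhaseSpace N) : HasFDerivAt (matrixCoeff B T φ) (matrixCoeffFDeriv B T φ x) x := by
  refine hasFDerivAt_of_integral_segment (continuous_clm_apply.2 fun v => ?_)
    (fun x v => matrixCoeff_sub_eq_integral B T φ x v) x
  simp only [matrixCoeffFDeriv_apply, matrixCoeffDeriv]
  have h1 := continuous_matrixCoeff B T φ
  have h2 := continuous_matrixCoeff B T (generator B v φ)
  fun_prop

/-- The linear map `c ↦ (x ↦ x_i c)`. -/
def coordSMul (i : Fin N ⊕ Fin N) : ℂ →L[ℝ] (PhaseSpace N →L[ℝ] ℂ) :=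
  ContinuousLinearMap.smulRightL ℝ (PhaseSpace N) ℂ (EuclideanSpace.proj i)

/-- In coordinates the derivative is built from finitely many scalar functions, each a coefficient
plus a linear function times a coefficient. This form makes induction on the order possible, for all
`φ` at once. -/
theorem fderiv_matrixCoeff (T : 𝓢'(PhaseSpace N, ℂ)) (φ : 𝓢(PhaseSpace N, ℂ)) :
    fderiv ℝ (matrixCoeff B T φ) = fun x => ∑ i, coordSMul i
      (matrixCoeffDeriv B T φ (EuclideanSpace.single i 1) x) := by
  ext x v
  rw [(hasFDerivAt_matrixCoeff B T φ x).fderiv]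
  have hv : v = ∑ i, v i • EuclideanSpace.single i (1 : ℝ) := by
    simpa using! ((EuclideanSpace.basisFun (Fin N ⊕ Fin N) ℝ).sum_repr v).symm
  conv_lhs => rw [hv]
  rw [map_sum, sum_apply]
  refine Finset.sum_congr rfl fun i _ => ?_
  rw [map_smul, matrixCoeffFDeriv_apply]
  rfl

theorem contDiff_matrixCoeff (T : 𝓢'(PhaseSpace N, ℂ)) (φ : 𝓢(PhaseSpace N, ℂ)) :
    ContDiff ℝ ∞ (matrixCoeff B T φ) := by
  refine contDiff_infty.2 fun n => ?_
  induction n generalizing φ with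
  | zero => exact contDiff_zero.2 (continuous_matrixCoeff B T φ)
  | succ n ih =>
    rw [Nat.cast_succ, contDiff_succ_iff_fderiv]
    refine ⟨fun x => (hasFDerivAt_matrixCoeff B T φ x).differentiableAt, by simp, ?_⟩
    rw [fderiv_matrixCoeff]
    refine ContDiff.sum fun i _ => (coordSMul i).contDiff.comp ?_
    refine (ih _).add (ContDiff.mul (contDiff_const.mul ?_) (ih φ))
    exact (Complex.ofRealCLM.comp (B _)).contDiff

theorem contDiff_matrixCoeffDeriv (T : 𝓢'(PhaseSpace N, ℂ)) (φ : 𝓢(PhaseSpace N, ℂ))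
    (v : PhaseSpace N) : ContDiff ℝ ∞ (matrixCoeffDeriv B T φ v) := by
  refine (contDiff_matrixCoeff B T _).add (ContDiff.mul (contDiff_const.mul ?_)
    (contDiff_matrixCoeff B T φ))
  exact (Complex.ofRealCLM.comp (B _)).contDiff

theorem exists_norm_iteratedFDeriv_clm_le (L : PhaseSpace N →L[ℝ] ℂ) (n : ℕ) :
    ∃ C, 0 ≤ C ∧ ∀ x, ‖iteratedFDeriv ℝ n L x‖ ≤ C * weight (1 / 2) x := by
  refine ⟨‖L‖, norm_nonneg _, fun x => ?_⟩
  have hx := one_le_weight (N := N) (r := 1 / 2) (by norm_num) x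
  rcases n with _ | _ | n
  · rw [norm_iteratedFDeriv_zero]
    exact (L.le_opNorm x).trans (by gcongr; exact norm_le_weight x)
  · rw [norm_iteratedFDeriv_one, L.fderiv]
    nlinarith [norm_nonneg L]
  · rw [← norm_iteratedFDeriv_fderiv, ← norm_iteratedFDeriv_fderiv]
    have h : fderiv ℝ L = fun _ => L := funext fun x => L.fderiv
    rw [h]
    have h2 : fderiv ℝ (fun _ : PhaseSpace N => L) = fun _ => 0 := by
      ext1 x
      exact fderiv_const_apply L
    rw [h2]
    have h3 : iteratedFDeriv ℝ n (fun _ : PhaseSpace N =>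
        (0 : PhaseSpace N →L[ℝ] PhaseSpace N →L[ℝ] ℂ)) x = 0 := by
      simp
    rw [h3, norm_zero]
    positivity

/-- A first derivative has two terms: the coefficient of `generator B v φ`, which grows no faster
than that of `φ`, and a linear factor times the coefficient, which costs half a power. The bound
must hold for all `φ` with one seminorm, since the induction applies it to the generator. Strong
induction is used because the Leibniz rule brings in all lower orders. -/
theorem exists_norm_iteratedFDeriv_matrixCoeff_le {T : 𝓢'(PhaseSpace N, ℂ)} {r : ℝ}
    (h : ∃ q : Seminorm ℂ 𝓢(PhaseSpace N, ℂ), Continuous q ∧ ∀ φ x,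
      ‖matrixCoeff B T φ x‖ ≤ weight r x * q φ) (n : ℕ) :
    ∃ q : Seminorm ℂ 𝓢(PhaseSpace N, ℂ), Continuous q ∧ ∀ φ x,
      ‖iteratedFDeriv ℝ n (matrixCoeff B T φ) x‖ ≤ weight (r + n / 2) x * q φ := by
  induction n using Nat.strong_induction_on with
  | _ n ih =>
    rcases n with _ | n
    · simpa using! h
    choose! q hq hqb using ih
    let e (i : Fin N ⊕ Fin N) : PhaseSpace N := EuclideanSpace.single i 1
    let L (i : Fin N ⊕ Fin N) : PhaseSpace N →L[ℝ] ℂ :=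
      Complex.I • Complex.ofRealCLM.comp (B (e i))
    choose C hC0 hC using fun (i : Fin N ⊕ Fin N) (k : ℕ) => exists_norm_iteratedFDeriv_clm_le (L i) k
    -- The first term bounds the coefficient of the generator, the sum comes from the Leibniz rule
    -- for the linear factor.
    let p (i : Fin N ⊕ Fin N) : Seminorm ℂ 𝓢(PhaseSpace N, ℂ) :=
      (q n).comp (generator B (e i)).toLinearMap +
        ∑ k ∈ Finset.range (n + 1), ((n.choose k : NNReal) * (C i k).toNNReal) • q (n - k)
    have hp0 (i : Fin N ⊕ Fin N) (φ : 𝓢(PhaseSpace N, ℂ)) : p i φ = q n (generator B (e i) φ) +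
        ∑ k ∈ Finset.range (n + 1), (n.choose k : ℝ) * C i k * q (n - k) φ := by
      have h1 : p i φ = q n (generator B (e i) φ) + (∑ k ∈ Finset.range (n + 1),
        ((n.choose k : NNReal) * (C i k).toNNReal) • q (n - k) : Seminorm ℂ _) φ := rfl
      rw [h1, sum_apply]
      simp [NNReal.smul_def, hC0]
    have hpc (i : Fin N ⊕ Fin N) : Continuous (p i) := by
      have : (p i : 𝓢(PhaseSpace N, ℂ) → ℝ) = fun φ => q n (generator B (e i) φ) +
        ∑ k ∈ Finset.range (n + 1), (n.choose k : ℝ) * C i k * q (n - k) φ := funext (hp0 i)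
      rw [this]
      refine ((hq n (Nat.lt_succ_self n)).comp (generator B (e i)).continuous).add ?_
      exact continuous_finsetSum _ fun k _ => (hq (n - k) (by omega)).const_mul _
    have hd (i : Fin N ⊕ Fin N) (φ : 𝓢(PhaseSpace N, ℂ)) (x : PhaseSpace N) :
        ‖iteratedFDeriv ℝ n (matrixCoeffDeriv B T φ (e i)) x‖ ≤
          weight (r + (n + 1) / 2) x * p i φ := by
      have h1 : matrixCoeffDeriv B T φ (e i) = matrixCoeff B T (generator B (e i) φ) +
        fun x => L i x * matrixCoeff B T φ x := rfl
      have c1 : ContDiff ℝ n (matrixCoeff B T (generator B (e i) φ)) :=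
        contDiff_infty.1 (contDiff_matrixCoeff B T _) n
      have c2 : ContDiff ℝ n (matrixCoeff B T φ) := contDiff_infty.1 (contDiff_matrixCoeff B T _) n
      rw [h1, iteratedFDeriv_add_apply c1.contDiffAt ((L i).contDiff.mul c2).contDiffAt, hp0,
        mul_add]
      refine (norm_add_le _ _).trans (add_le_add ?_ ?_)
      · refine (hqb n (Nat.lt_succ_self n) _ x).trans ?_
        have := apply_nonneg (q n) (generator B (e i) φ)
        gcongr
        exact weight_mono (by gcongr; linarith) x
      · refine (norm_iteratedFDeriv_mul_le (L i).contDiff c2 x le_rfl).trans ?_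
        rw [Finset.mul_sum]
        refine Finset.sum_le_sum fun k hk => ?_
        have h2 := hC i k x
        have h3 := hqb (n - k) (by omega) φ x
        have h4 := weight_pos (1 / 2) x
        have h5 := apply_nonneg (q (n - k)) φ
        have h6 := hC0 i k
        have h7 : weight (1 / 2) x * weight (r + (n - k : ℕ) / 2) x ≤
            weight (r + (n + 1) / 2) x := by
          rw [← weight_add]
          refine weight_mono ?_ x
          have : ((n - k : ℕ) : ℝ) ≤ n := by exact_mod_cast Nat.sub_le n k
          linarith
        calc (n.choose k : ℝ) * ‖iteratedFDeriv ℝ k (L i) x‖ *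
              ‖iteratedFDeriv ℝ (n - k) (matrixCoeff B T φ) x‖
            ≤ (n.choose k : ℝ) * (C i k * weight (1 / 2) x) *
              (weight (r + (n - k : ℕ) / 2) x * q (n - k) φ) := by gcongr
          _ = (weight (1 / 2) x * weight (r + (n - k : ℕ) / 2) x) *
              ((n.choose k : ℝ) * C i k * q (n - k) φ) := by ring
          _ ≤ _ := by gcongr
    refine ⟨∑ i, ‖coordSMul i‖₊ • p i, ?_, fun φ x => ?_⟩
    · have : ((∑ i, ‖coordSMul i‖₊ • p i : Seminorm ℂ 𝓢(PhaseSpace N, ℂ)) :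
          𝓢(PhaseSpace N, ℂ) → ℝ) = fun φ => ∑ i, ‖coordSMul i‖ * p i φ := by
        ext φ
        rw [sum_apply]
        rfl
      rw [this]
      exact continuous_finsetSum _ fun i _ => (hpc i).const_mul _
    · rw [← norm_iteratedFDeriv_fderiv, fderiv_matrixCoeff, sum_apply]
      have hs (i : Fin N ⊕ Fin N) : ContDiff ℝ n fun x => coordSMul i
          (matrixCoeffDeriv B T φ (EuclideanSpace.single i 1) x) :=
        (coordSMul i).contDiff.comp (contDiff_infty.1 (contDiff_matrixCoeffDeriv B T φ _) n)
      rw [iteratedFDeriv_fun_sum_apply fun i _ => (hs i).contDiffAt]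
      refine (norm_sum_le _ _).trans ?_
      rw [Finset.mul_sum]
      refine Finset.sum_le_sum fun i _ => ?_
      have h1 := (coordSMul i).norm_iteratedFDeriv_comp_left (n := n) (N := n)
        (f := matrixCoeffDeriv B T φ (e i)) (x := x)
        (contDiff_infty.1 (contDiff_matrixCoeffDeriv B T φ _) n).contDiffAt le_rfl
      refine h1.trans ?_
      have h2 : (‖coordSMul i‖₊ • p i) φ = ‖coordSMul i‖ * p i φ := rfl
      rw [h2, mul_left_comm]
      push_cast
      gcongr
      exact hd i φ x

end

/-! ### Functionals on the spaces `V_k` -/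

section

variable {N : ℕ}

/-- The norms of the space `V_k`. -/
def seminormVk (N k m : ℕ) : Seminorm ℂ (spaceVk N k) :=
  (weightedSeminorm N (fun j => k + j / 2) m).comp
    (Submodule.inclusion (iInf_le (fun m => spaceVkm N k m) m))

theorem withSeminorms_topologyVk (N k : ℕ) :
    @WithSeminorms ℂ (spaceVk N k) (Σ _ : ℕ, Unit) _ _ _
      (SeminormFamily.sigma fun m (_ : Unit) => seminormVk N k m) (topologyVk N k) := by
  refine @withSeminorms_iInf ℂ (spaceVk N k) ℕ _ _ _ (fun _ => Unit)
    (fun m _ => seminormVk N k m)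
    (fun m => TopologicalSpace.induced (Submodule.inclusion (iInf_le (fun m => spaceVkm N k m) m))
      (weightedTopology N (fun j => k + j / 2) m)) fun m => ?_
  let _ := weightedTopology N (fun j => k + j / 2) m
  have h : WithSeminorms (fun _ : Unit => weightedSeminorm N (fun j => k + j / 2) m) := ⟨rfl⟩
  exact LinearMap.withSeminorms_induced h _

theorem continuous_seminormVk (N k m : ℕ) :
    @Continuous _ _ (topologyVk N k) _ (seminormVk N k m) := by
  let _ := topologyVk N k
  exact (withSeminorms_topologyVk N k).continuous_seminorm ⟨m, ()⟩

theorem weightedSeminorm_inclusion_le {a b : ℕ → ℝ} {m m' : ℕ} (hm : m ≤ m')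
    (hab : ∀ j ≤ m, a j ≤ b j) {f : PhaseSpace N → ℂ} (hf : f ∈ weightedSpace N a m')
    (hf' : f ∈ weightedSpace N b m) :
    weightedSeminorm N b m ⟨f, hf'⟩ ≤ weightedSeminorm N a m' ⟨f, hf⟩ :=
  weightedSeminorm_le (apply_nonneg _ _) fun j hj u => (norm_weightedDeriv_le (hab j hj) j f u).trans
    (norm_weightedDeriv_le_weightedSeminorm ⟨f, hf⟩ (hj.trans hm) u)

theorem seminormVk_mono {k m m' : ℕ} (h : m ≤ m') (f : spaceVk N k) :
    seminormVk N k m f ≤ seminormVk N k m' f :=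
  weightedSeminorm_inclusion_le h (fun _ _ => le_rfl) _ _

/-- A continuous functional on `V_k` is bounded by one of the norms. -/
theorem exists_bound_of_continuous {k : ℕ} (l : spaceVk N k →ₗ[ℂ] ℂ)
    (hl : @Continuous _ _ (topologyVk N k) _ l) :
    ∃ (m : ℕ) (C : ℝ), 0 ≤ C ∧ ∀ f, ‖l f‖ ≤ C * seminormVk N k m f := by
  let _ := topologyVk N k
  let q : Seminorm ℂ (spaceVk N k) := (normSeminorm ℂ ℂ).comp l
  have hq : Continuous q := hl.norm
  obtain ⟨s, C, -, h⟩ := Seminorm.bound_of_continuous (withSeminorms_topologyVk N k) q hq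
  refine ⟨s.sup Sigma.fst, C, C.2, fun f => (h f).trans ?_⟩
  rw [smul_apply, NNReal.smul_def, smul_eq_mul]
  gcongr
  exact Seminorm.finset_sup_apply_le (apply_nonneg _ _) fun i hi =>
    seminormVk_mono (Finset.le_sup (f := Sigma.fst) hi) f

/-- A linear map on `V_k` is continuous if seminorms are bounded by the norms of `V_k`. -/
theorem continuous_Vk_of_bound {k : ℕ} {W ι : Type} [AddCommGroup W] [Module ℂ W] [Nonempty ι]
    (p : SeminormFamily ℂ W ι) (A : spaceVk N k →ₗ[ℂ] W)
    (h : ∀ i, ∃ (m : ℕ) (C : NNReal), ∀ f, p i (A f) ≤ C * seminormVk N k m f) :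
    @Continuous _ _ (topologyVk N k) (seminormTopology p) A := by
  let _ := topologyVk N k
  let _ := seminormTopology p
  have hk := withSeminorms_topologyVk N k
  have := hk.topologicalAddGroup
  refine WithSeminorms.continuous_of_continuous_comp (q := p) ⟨rfl⟩ A fun i => ?_
  obtain ⟨m, C, hb⟩ := h i
  exact Seminorm.continuous_of_le (q := C • seminormVk N k m)
    ((continuous_seminormVk N k m).const_smul C) hb

theorem spaceVk_le_spaceOT (N k : ℕ) : spaceVk N k ≤ spaceOT N := le_iSup (spaceVk N) k

theorem continuous_inclusion_OT (N k : ℕ) : @Continuous _ _ (topologyVk N k) (topologyOT N)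
    (Submodule.inclusion (spaceVk_le_spaceOT N k)) :=
  continuous_sInf_rng.2 fun _ hσ => hσ.2.2.2 k

theorem mem_spaceVkm {k : ℕ} {f : PhaseSpace N → ℂ} (hf : f ∈ spaceVk N k) (m : ℕ) :
    f ∈ spaceVkm N k m := (Submodule.mem_iInf _).1 hf m

theorem spaceVk_le_smoothSpace (N k : ℕ) : spaceVk N k ≤ smoothSpace N := fun _ hf =>
  contDiff_infty.2 fun m => (mem_spaceVkm hf m).1

/-- On a compact set the weights are bounded, so uniform bounds of derivatives follow from the norms
of `V_k`. -/
theorem continuous_inclusion_smooth (N k : ℕ) :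
    @Continuous _ _ (topologyVk N k) (smoothTopology N)
      (Submodule.inclusion (spaceVk_le_smoothSpace N k)) := by
  refine continuous_Vk_of_bound _ _ fun i => ?_
  obtain ⟨M, hM⟩ := i.1.isCompact.bddAbove_image
    (continuous_weight (N := N) (k + i.2 / 2)).continuousOn
  refine ⟨i.2, M.toNNReal, fun f => ?_⟩
  refine Real.iSup_le (fun u => ?_) (mul_nonneg M.toNNReal.2 (apply_nonneg _ _))
  have h1 : ‖weightedDeriv (k + i.2 / 2) i.2 f.1 u‖ ≤ seminormVk N k i.2 f :=
    norm_weightedDeriv_le_weightedSeminorm (a := fun j => k + j / 2)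
      ⟨f.1, mem_spaceVkm f.2 i.2⟩ le_rfl u.1
  have h2 : weight (k + i.2 / 2) u.1 ≤ M.toNNReal :=
    (hM ⟨u.1, u.2, rfl⟩).trans (Real.le_coe_toNNReal M)
  have h3 : smoothDeriv N i.1 i.2 (Submodule.inclusion (spaceVk_le_smoothSpace N k) f) u =
    iteratedFDeriv ℝ i.2 f.1 u := rfl
  rw [norm_weightedDeriv] at h1
  rw [h3]
  calc ‖iteratedFDeriv ℝ i.2 f.1 u‖ = weight (k + i.2 / 2) u.1 *
        (weight (-(k + i.2 / 2)) u.1 * ‖iteratedFDeriv ℝ i.2 f.1 u‖) := by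
        rw [← mul_assoc, mul_comm (weight _ _), weight_neg_mul, one_mul]
    _ ≤ _ := mul_le_mul h2 h1 (mul_nonneg (weight_pos _ _).le (norm_nonneg _)) M.toNNReal.2

theorem weightedSpace_mono_of_le {a b : ℕ → ℝ} {m : ℕ} (h : ∀ j ≤ m, a j ≤ b j) :
    weightedSpace N a m ≤ weightedSpace N b m := fun f hf =>
  ⟨hf.1, fun j hj => squeeze_zero_norm (fun u => norm_weightedDeriv_le (h j hj) j f u)
    (tendsto_zero_iff_norm_tendsto_zero.1 (hf.2 j hj))⟩

/-- For orders `j ≤ m` the exponent `k + j / 2` is at most `k + m`. The index may depend on `m`,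
because in `O_M` the intersection over `m` stands outside the union. -/
theorem spaceVk_le_spaceSkm (N k m : ℕ) : spaceVk N k ≤ spaceSkm N (k + m) m := fun _ hf =>
  weightedSpace_mono_of_le (fun j hj => by
    have : (j : ℝ) ≤ m := by exact_mod_cast hj
    have : (0 : ℝ) ≤ j := by positivity
    push_cast
    linarith) (mem_spaceVkm hf m)

theorem spaceVk_le_spaceOCm (N k m : ℕ) : spaceVk N k ≤ spaceOCm N m :=
  (spaceVk_le_spaceSkm N k m).trans (le_iSup (fun k => spaceSkm N k m) (k + m))

theorem spaceVk_le_spaceOM (N k : ℕ) : spaceVk N k ≤ spaceOM N :=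
  le_iInf fun m => spaceVk_le_spaceOCm N k m

theorem continuous_inclusion_Skm (N k m : ℕ) :
    @Continuous _ _ (topologyVk N k) (weightedTopology N (fun _ => (k + m : ℕ)) m)
      (Submodule.inclusion (spaceVk_le_spaceSkm N k m)) := by
  refine continuous_Vk_of_bound _ _ fun _ => ⟨m, 1, fun f => ?_⟩
  rw [NNReal.coe_one, one_mul]
  refine weightedSeminorm_inclusion_le le_rfl (fun j hj => ?_) (mem_spaceVkm f.2 m)
    (spaceVk_le_spaceSkm N k m f.2)
  have : (j : ℝ) ≤ m := by exact_mod_cast hj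
  have : (0 : ℝ) ≤ j := by positivity
  push_cast
  linarith

theorem continuous_inclusion_OM (N k : ℕ) :
    @Continuous _ _ (topologyVk N k) (topologyOM N)
      (Submodule.inclusion (spaceVk_le_spaceOM N k)) := by
  refine continuous_iInf_rng.2 fun m => continuous_induced_rng.2 ?_
  refine continuous_sInf_rng.2 fun σ hσ => ?_
  exact @Continuous.comp _ _ _ (topologyVk N k) (weightedTopology N (fun _ => (k + m : ℕ)) m) σ _ _
    (hσ.2.2.2 (k + m)) (continuous_inclusion_Skm N k m)

/-- An element of the dual space of a space in which `V_k` is continuously embedded. -/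
theorem TopDual.exists_bound {k : ℕ} {F : Submodule ℂ (PhaseSpace N → ℂ)} {τ : TopologicalSpace F}
    (h : spaceVk N k ≤ F) (hc : @Continuous _ _ (topologyVk N k) τ (Submodule.inclusion h))
    (S : TopDual F τ) : ∃ (m : ℕ) (C : ℝ), 0 ≤ C ∧
      ∀ f : spaceVk N k, ‖S.1 (Submodule.inclusion h f)‖ ≤ C * seminormVk N k m f :=
  exists_bound_of_continuous (S.1.comp (Submodule.inclusion h))
    (@Continuous.comp _ _ _ (topologyVk N k) τ _ _ _ S.2 hc)

/-- The inclusion of the Schwartz space into `V_k`. -/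
def schwartzVk (N k : ℕ) : 𝓢(PhaseSpace N, ℂ) →ₗ[ℂ] spaceVk N k :=
  schwartzIncl _ (schwartz_mem_spaceVk k)

/-- A tempered distribution that is continuous with respect to the topologies of all `V_k`. -/
def IsBoundedVk (S : 𝓢'(PhaseSpace N, ℂ)) : Prop :=
  ∀ k : ℕ, ∃ (m : ℕ) (C : ℝ), 0 ≤ C ∧ ∀ φ, ‖S φ‖ ≤ C * weightedSeminorm N (fun j => k + j / 2) m
    (schwartzWeighted N (fun j => k + j / 2) m φ)

theorem isBoundedVk_restrict {F : Submodule ℂ (PhaseSpace N → ℂ)} {τ : TopologicalSpace F}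
    (h : ∀ k, spaceVk N k ≤ F)
    (hc : ∀ k, @Continuous _ _ (topologyVk N k) τ (Submodule.inclusion (h k)))
    (hF : ∀ f : 𝓢(PhaseSpace N, ℂ), (f : PhaseSpace N → ℂ) ∈ F)
    (hτ : @Continuous _ _ _ τ (schwartzIncl F hF)) (S : TopDual F τ) :
    IsBoundedVk (S.restrict hF hτ) := fun k => by
  obtain ⟨m, C, hC, hb⟩ := S.exists_bound (h k) (hc k)
  exact ⟨m, C, hC, fun φ => hb (schwartzVk N k φ)⟩

theorem SmoothDual.isBoundedVk (S : SmoothDual N) : IsBoundedVk S.toTempered :=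
  isBoundedVk_restrict (spaceVk_le_smoothSpace N) (continuous_inclusion_smooth N) _ _ S

theorem OMDual.isBoundedVk (S : OMDual N) : IsBoundedVk S.toTempered :=
  isBoundedVk_restrict (spaceVk_le_spaceOM N) (continuous_inclusion_OM N) _ _ S

theorem OTDual.isBoundedVk (S : OTDual N) : IsBoundedVk S.toTempered :=
  isBoundedVk_restrict (spaceVk_le_spaceOT N) (continuous_inclusion_OT N) _ _ S

/-! ### Growth of the functions `x ↦ ⟨T, K_x φ⟩` -/

variable (B : PhaseSpace N →L[ℝ] PhaseSpace N →L[ℝ] ℝ)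

theorem exists_norm_matrixCoeff_le_of_bound {T : 𝓢'(PhaseSpace N, ℂ)} {a : ℕ → ℝ} {m : ℕ} {C : ℝ}
    (hC : 0 ≤ C)
    (hT : ∀ φ, ‖T φ‖ ≤ C * weightedSeminorm N a m (schwartzWeighted N a m φ)) {r : ℝ}
    (hr : ∀ j ≤ m, j / 2 - a j ≤ r) :
    ∃ q : Seminorm ℂ 𝓢(PhaseSpace N, ℂ), Continuous q ∧ ∀ φ x,
      ‖matrixCoeff B T φ x‖ ≤ weight r x * q φ := by
  obtain ⟨q, hq, hb⟩ := exists_weightedSeminorm_twistShift_le B a m hr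
  refine ⟨C.toNNReal • q, hq.const_smul _, fun φ x => (hT _).trans ?_⟩
  rw [smul_apply, NNReal.smul_def, smul_eq_mul, Real.coe_toNNReal _ hC, mul_left_comm]
  gcongr
  exact hb φ x

theorem exists_norm_matrixCoeff_le (T : 𝓢'(PhaseSpace N, ℂ)) :
    ∃ r : ℝ, ∃ q : Seminorm ℂ 𝓢(PhaseSpace N, ℂ), Continuous q ∧ ∀ φ x,
      ‖matrixCoeff B T φ x‖ ≤ weight r x * q φ := by
  obtain ⟨K, m, C, hC, hT⟩ := exists_tempered_bound T
  refine ⟨m / 2 + K, exists_norm_matrixCoeff_le_of_bound B hC hT fun j hj => ?_⟩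
  rw [sub_neg_eq_add]
  gcongr

/-- With the exponents `k + j / 2` of `V_k`, the loss `j / 2` from differentiating the phase
cancels. The decay rate is therefore independent of the order `m` of the norm that bounds `S`,
although this order is unknown. -/
theorem IsBoundedVk.exists_norm_matrixCoeff_le {S : 𝓢'(PhaseSpace N, ℂ)} (hS : IsBoundedVk S)
    (k : ℕ) : ∃ q : Seminorm ℂ 𝓢(PhaseSpace N, ℂ), Continuous q ∧ ∀ φ x,
      ‖matrixCoeff B S φ x‖ ≤ weight (-k) x * q φ := by
  obtain ⟨m, C, hC, hb⟩ := hS k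
  exact exists_norm_matrixCoeff_le_of_bound B hC hb fun j _ => by linarith

/-- For `S` bounded on all `V_k`, the functions `x ↦ ⟨S, K_x φ⟩` are Schwartz functions, which depend
continuously on `φ`. -/
theorem IsBoundedVk.exists_schwartz {S : 𝓢'(PhaseSpace N, ℂ)} (hS : IsBoundedVk S) :
    ∃ A : 𝓢(PhaseSpace N, ℂ) →L[ℂ] 𝓢(PhaseSpace N, ℂ), ∀ φ x, A φ x = matrixCoeff B S φ x := by
  have hb (k n : ℕ) : ∃ q : Seminorm ℂ 𝓢(PhaseSpace N, ℂ), Continuous q ∧ ∀ φ x,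
      ‖x‖ ^ k * ‖iteratedFDeriv ℝ n (matrixCoeff B S φ) x‖ ≤ q φ := by
    -- The factor `‖x‖ ^ k` costs `k / 2` and the derivative `n / 2`, so decay of order `k + n` is
    -- more than enough.
    obtain ⟨q, hq, h⟩ := exists_norm_iteratedFDeriv_matrixCoeff_le B
      (hS.exists_norm_matrixCoeff_le B (k + n)) n
    refine ⟨q, hq, fun φ x => ?_⟩
    have h1 : weight (k / 2) x * weight (-(k + n : ℕ) + n / 2) x ≤ 1 := by
      rw [← weight_add, ← weight_zero x]
      refine weight_mono ?_ x
      push_cast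
      have : (0 : ℝ) ≤ k := by positivity
      have : (0 : ℝ) ≤ n := by positivity
      linarith
    calc ‖x‖ ^ k * ‖iteratedFDeriv ℝ n (matrixCoeff B S φ) x‖
        ≤ weight (k / 2) x * (weight (-(k + n : ℕ) + n / 2) x * q φ) := by
          have := weight_pos (k / 2) x
          gcongr
          · exact norm_pow_le_weight k x
          · exact h φ x
      _ = (weight (k / 2) x * weight (-(k + n : ℕ) + n / 2) x) * q φ := by ring
      _ ≤ 1 * q φ := by gcongr
      _ = q φ := one_mul _
  let A : 𝓢(PhaseSpace N, ℂ) →ₗ[ℂ] 𝓢(PhaseSpace N, ℂ) :=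
    { toFun := fun φ => ⟨matrixCoeff B S φ, contDiff_matrixCoeff B S φ, fun k n => by
        obtain ⟨q, -, hq⟩ := hb k n
        exact ⟨q φ, hq φ⟩⟩
      map_add' := fun φ ψ => by
        ext x
        exact congrFun (matrixCoeff_add B S φ ψ) x
      map_smul' := fun c φ => by
        ext x
        exact congrFun (matrixCoeff_smul B S c φ) x }
  refine ⟨⟨A, continuous_of_bound A fun k n => ?_⟩, fun φ x => rfl⟩
  obtain ⟨q, hq, h⟩ := hb k n
  exact ⟨1, q.restrictScalars ℝ, zero_le_one, hq, fun φ u => by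
    rw [one_mul]
    exact h φ u⟩

/-- The functions `x ↦ ⟨T, K_x φ⟩` belong to `V_k` for large `k`. -/
theorem exists_seminorm_matrixCoeff_le {T : 𝓢'(PhaseSpace N, ℂ)} {r : ℝ}
    (h : ∃ q : Seminorm ℂ 𝓢(PhaseSpace N, ℂ), Continuous q ∧ ∀ φ x,
      ‖matrixCoeff B T φ x‖ ≤ weight r x * q φ) {k : ℕ} (hk : r < k) :
    ∃ A : 𝓢(PhaseSpace N, ℂ) →ₗ[ℂ] spaceVk N k, (∀ φ, (A φ).1 = matrixCoeff B T φ) ∧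
      ∀ m, ∃ q : Seminorm ℂ 𝓢(PhaseSpace N, ℂ), Continuous q ∧ ∀ φ, seminormVk N k m (A φ) ≤ q φ := by
  choose q hq hqb using fun n => exists_norm_iteratedFDeriv_matrixCoeff_le B h n
  -- The growth `j / 2` of the derivative cancels against the weight of `V_k`; the remaining
  -- exponent `r - k` is negative, which gives both the bound and the vanishing at infinity.
  have hb (j : ℕ) (φ : 𝓢(PhaseSpace N, ℂ)) (x : PhaseSpace N) :
      ‖weightedDeriv (k + j / 2) j (matrixCoeff B T φ) x‖ ≤ weight (r - k) x * q j φ := by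
    rw [norm_weightedDeriv]
    calc weight (-(k + j / 2)) x * ‖iteratedFDeriv ℝ j (matrixCoeff B T φ) x‖
        ≤ weight (-(k + j / 2)) x * (weight (r + j / 2) x * q j φ) := by
          have := weight_pos (-(k + j / 2)) x
          gcongr
          exact hqb j φ x
      _ = _ := by
        rw [← mul_assoc, ← weight_add]
        congr 2
        ring
  have hmem (φ : 𝓢(PhaseSpace N, ℂ)) : matrixCoeff B T φ ∈ spaceVk N k := by
    refine (Submodule.mem_iInf _).2 fun m => ⟨contDiff_infty.1 (contDiff_matrixCoeff B T φ) m,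
      fun j _ => squeeze_zero_norm (fun x => hb j φ x) ?_⟩
    have := (tendsto_weight_cocompact (N := N) (r := r - k) (by linarith)).mul_const (q j φ)
    rwa [zero_mul] at this
  let A : 𝓢(PhaseSpace N, ℂ) →ₗ[ℂ] spaceVk N k :=
    { toFun := fun φ => ⟨matrixCoeff B T φ, hmem φ⟩
      map_add' := fun φ ψ => Subtype.ext (matrixCoeff_add B T φ ψ)
      map_smul' := fun c φ => Subtype.ext (matrixCoeff_smul B T c φ) }
  refine ⟨A, fun φ => rfl, fun m => ?_⟩
  obtain ⟨p, hp, hqp⟩ := exists_finset_seminorm_ge (Finset.Iic m) q fun j _ => hq j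
  refine ⟨p, hp, fun φ => weightedSeminorm_le (apply_nonneg _ _) fun j hj u => (hb j φ u).trans ?_⟩
  calc weight (r - k) u * q j φ ≤ 1 * p φ := by
        refine mul_le_mul ?_ (hqp j (Finset.mem_Iic.2 hj) φ) (apply_nonneg _ _) zero_le_one
        rw [← weight_zero u]
        exact weight_mono (by linarith) u
    _ = p φ := one_mul _

end

/-! ### The twisted product as a superposition of twisted translates -/

section

variable {N : ℕ}

theorem symp_swap (u v : PhaseSpace N) : symp u v = -symp v u := by
  simp only [symp, ← Finset.sum_neg_distrib]
  exact Finset.sum_congr rfl fun i _ => by ring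

theorem symp_self (u : PhaseSpace N) : symp u u = 0 := by
  have := symp_swap u u
  linarith

theorem symp_add_left (u v w : PhaseSpace N) : symp (u + v) w = symp u w + symp v w := by
  simp only [← sympCLM_apply, map_add, add_apply]

theorem symp_add_right (u v w : PhaseSpace N) : symp u (v + w) = symp u v + symp u w := by
  simp only [← sympCLM_apply, map_add]

theorem symp_sub_left (u v w : PhaseSpace N) : symp (u - v) w = symp u w - symp v w := by
  simp only [← sympCLM_apply, map_sub, sub_apply]

theorem symp_sub_right (u v w : PhaseSpace N) : symp u (v - w) = symp u v - symp u w := by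
  simp only [← sympCLM_apply, map_sub]

theorem phase_sympCLM (u v : PhaseSpace N) :
    phase (sympCLM N) u v = Complex.exp (symp u v * Complex.I) := rfl

theorem phase_neg_sympCLM (u v : PhaseSpace N) :
    phase (-sympCLM N) u v = Complex.exp (symp v u * Complex.I) := by
  rw [phase, symp_swap]
  rfl

/-- The reflection `φ ↦ φ(-·)`. -/
def reflect (N : ℕ) : 𝓢(PhaseSpace N, ℂ) →L[ℂ] 𝓢(PhaseSpace N, ℂ) :=
  SchwartzMap.compCLMOfContinuousLinearEquiv ℂ (ContinuousLinearEquiv.neg ℝ)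

theorem reflect_apply (φ : 𝓢(PhaseSpace N, ℂ)) (u : PhaseSpace N) : reflect N φ u = φ (-u) := rfl

theorem reflect_surjective (N : ℕ) : Function.Surjective (reflect N) := fun φ =>
  ⟨reflect N φ, by ext u; simp [reflect_apply]⟩

theorem sympFourier_surjective (N : ℕ) : Function.Surjective (sympFourier N) := fun φ => by
  let ψ : 𝓢(PhaseSpace N, ℂ) :=
    SchwartzMap.compCLMOfContinuousLinearEquiv ℂ (rotate N).symm φ
  refine ⟨((2 * Real.pi) ^ N : ℂ) • FourierTransformInv.fourierInv ψ, ?_⟩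
  rw [map_smul]
  ext s
  have h1 : sympFourier N (FourierTransformInv.fourierInv ψ) s = (((2 * Real.pi) ^ N)⁻¹ : ℂ) *
      (FourierTransform.fourier (FourierTransformInv.fourierInv ψ) : 𝓢(PhaseSpace N, ℂ))
        (rotate N s) := rfl
  have h2 : ψ (rotate N s) = φ s := by
    change φ ((rotate N).symm (rotate N s)) = φ s
    rw [ContinuousLinearEquiv.symm_apply_apply]
  have h3 : ((2 * Real.pi) ^ N : ℂ) ≠ 0 := by
    have : (Real.pi : ℂ) ≠ 0 := by exact_mod_cast Real.pi_ne_zero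
    exact pow_ne_zero _ (mul_ne_zero two_ne_zero this)
  rw [smul_apply, h1, FourierTransform.fourier_fourierInv_eq, h2, smul_eq_mul,
    mul_inv_cancel_left₀ h3]

/-- The transform of `g` is written out and the integrals are exchanged. After a translation by `u`,
the inner integral is the transform of `h` at `u - x`, and the remaining phase is `e^{i x'Ju}`. -/
theorem twistedProduct_eq_integral_left (h g : 𝓢(PhaseSpace N, ℂ)) (u : PhaseSpace N) :
    twistedProduct h g u =
      ∫ x, g x * twistShift (sympCLM N) x (sympFourier N h) u ∂phaseMeasure N := by
  rw [twistedProduct_eq]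
  let F : PhaseSpace N → PhaseSpace N → ℂ := fun s x =>
    Complex.exp (symp u s * Complex.I) * (h (u + s) * g x) * Complex.exp (symp s x * Complex.I)
  have hF : Integrable (Function.uncurry F) ((phaseMeasure N).prod (phaseMeasure N)) := by
    have h1 : Integrable (fun s => h (u + s)) (phaseMeasure N) :=
      (h.integrable (μ := phaseMeasure N)).comp_add_left u
    refine (h1.mul_prod (g.integrable (μ := phaseMeasure N))).mono ?_
      (Eventually.of_forall fun p => ?_)
    · refine Continuous.aestronglyMeasurable ?_
      have hh := h.continuous
      have hg := g.continuous
      simp only [F, Function.uncurry_def, ← sympCLM_apply]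
      fun_prop
    · simp [F, Function.uncurry_def, Complex.norm_exp_ofReal_mul_I]
  have e1 (s : PhaseSpace N) : TwistedIntegral.integrand (sympCLM N) (ContinuousLinearMap.mul ℝ ℂ)
      (sympFourier N g) h u s = ∫ x, F s x ∂phaseMeasure N := by
    simp only [TwistedIntegral.integrand, sympCLM_apply, ContinuousLinearMap.mul_apply',
      smul_eq_mul, sympFourier_apply]
    rw [← integral_mul_const, ← integral_const_mul]
    refine integral_congr_ae (Eventually.of_forall fun x => ?_)
    simp only [F, mul_comm Complex.I]
    ring
  have e2 (x : PhaseSpace N) : ∫ s, F s x ∂phaseMeasure N =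
      g x * twistShift (sympCLM N) x (sympFourier N h) u := by
    rw [twistShift_apply, sympFourier_apply, ← integral_const_mul, ← integral_const_mul]
    refine Eq.trans ?_ (integral_add_left_eq_self (μ := phaseMeasure N) _ u)
    refine integral_congr_ae (Eventually.of_forall fun s => ?_)
    simp only [F, phase_sympCLM]
    have e : Complex.exp (symp u s * Complex.I) * Complex.exp (symp s x * Complex.I) =
        Complex.exp (symp x u * Complex.I) *
          Complex.exp (Complex.I * symp (u - x) (u + s)) := by
      rw [← Complex.exp_add, ← Complex.exp_add]
      congr 1
      rw [symp_sub_left, symp_add_right, symp_add_right, symp_self, symp_swap s x]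
      push_cast
      ring
    calc _ = (h (u + s) * g x) * (Complex.exp (symp u s * Complex.I) *
          Complex.exp (symp s x * Complex.I)) := by ring
      _ = _ := by rw [e]; ring
  calc _ = ∫ s, ∫ x, F s x ∂phaseMeasure N ∂phaseMeasure N :=
        integral_congr_ae (Eventually.of_forall e1)
    _ = ∫ x, ∫ s, F s x ∂phaseMeasure N ∂phaseMeasure N := integral_integral_swap hF
    _ = _ := integral_congr_ae (Eventually.of_forall e2)

theorem twistedProduct_eq_integral_right (h g : 𝓢(PhaseSpace N, ℂ)) (u : PhaseSpace N) :
    twistedProduct g h u =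
      ∫ x, g x * twistShift (-sympCLM N) x (reflect N (sympFourier N h)) u ∂phaseMeasure N := by
  rw [twistedProduct_eq]
  refine Eq.trans ?_ (integral_add_left_eq_self (μ := phaseMeasure N) _ u)
  refine integral_congr_ae (Eventually.of_forall fun s => ?_)
  simp only [TwistedIntegral.integrand, sympCLM_apply, ContinuousLinearMap.mul_apply',
    smul_eq_mul, twistShift_apply, reflect_apply, phase_neg_sympCLM]
  rw [symp_add_right, symp_self, zero_add, show -(u - (u + s)) = s by abel]
  ring

/-- Here the translations act on the factor `g` itself and not on a transform: right multiplication
by `h` is a superposition of the operators `K_s`. This form yields associativity. -/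
theorem twistedProduct_eq_integral_shift (g h : 𝓢(PhaseSpace N, ℂ)) (u : PhaseSpace N) :
    twistedProduct g h u =
      ∫ s, reflect N (sympFourier N h) s * twistShift (sympCLM N) s g u ∂phaseMeasure N := by
  rw [twistedProduct_eq, ← integral_neg_eq_self]
  refine integral_congr_ae (Eventually.of_forall fun s => ?_)
  simp only [TwistedIntegral.integrand, sympCLM_apply, ContinuousLinearMap.mul_apply',
    smul_eq_mul, twistShift_apply, reflect_apply, phase_sympCLM]
  rw [← sympCLM_apply, map_neg, sympCLM_apply, symp_swap u s, neg_neg, ← sub_eq_add_neg]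
  ring

/-- Substituting `x + s` for `x` in the superposition formula makes the phases of the two sides
agree, because `s'Js = 0`. -/
theorem twistedProduct_twistShift (f g : 𝓢(PhaseSpace N, ℂ)) (s : PhaseSpace N) :
    twistedProduct f (twistShift (sympCLM N) s g) = twistShift (sympCLM N) s (twistedProduct f g) := by
  ext u
  rw [twistShift_apply, twistedProduct_eq_integral_left, twistedProduct_eq_integral_left,
    ← integral_const_mul, ← integral_add_right_eq_self (μ := phaseMeasure N) _ s]
  refine integral_congr_ae (Eventually.of_forall fun x => ?_)
  simp only [twistShift_apply, phase_sympCLM]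
  rw [add_sub_cancel_right, show u - (x + s) = u - s - x by abel]
  have e : Complex.exp (symp s (x + s) * Complex.I) * Complex.exp (symp (x + s) u * Complex.I) =
      Complex.exp (symp s u * Complex.I) * Complex.exp (symp x (u - s) * Complex.I) := by
    rw [← Complex.exp_add, ← Complex.exp_add]
    congr 1
    rw [symp_sub_right, symp_add_right, symp_add_left, symp_self, symp_swap s x]
    push_cast
    ring
  linear_combination (g x * sympFourier N f (u - s - x)) * e

/-- The twisted product is associative. -/
theorem twistedProduct_assoc (f g h : 𝓢(PhaseSpace N, ℂ)) :
    twistedProduct (twistedProduct f g) h = twistedProduct f (twistedProduct g h) := by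
  ext u
  -- The functional `k ↦ (f × k)(u)` is tempered, so it may be exchanged with the superposition that
  -- represents `g × h`; left multiplication by `f` then commutes with each translation.
  let T : 𝓢'(PhaseSpace N, ℂ) :=
    PointwiseConvergenceCLM.precomp ℂ (mulLeftCLM f) (TemperedDistribution.delta u)
  have hT (k : 𝓢(PhaseSpace N, ℂ)) : T k = twistedProduct f k u := rfl
  rw [← hT, (tempered_integral_twistShift (sympCLM N) T _ g _
    (twistedProduct_eq_integral_shift g h)).2, twistedProduct_eq_integral_shift]
  simp only [hT, twistedProduct_twistShift]

/-- Parameter and variable of the kernel `K_x φ(w)` may be interchanged at the price of reversing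
`J` and reflecting `φ`. This links the two sides of the product. -/
theorem twistShift_symm (φ : 𝓢(PhaseSpace N, ℂ)) (x w : PhaseSpace N) :
    twistShift (-sympCLM N) w (reflect N φ) x = twistShift (sympCLM N) x φ w := by
  rw [twistShift_apply, twistShift_apply, reflect_apply, phase_neg_sympCLM, phase_sympCLM, neg_sub]

end

/-! ### Left and right multiplication -/

/-- A side, left or right, of the twisted product: the product `g ↦ mul h g` is a superposition
of twisted translates of a transform of `h`. -/
structure Side (N : ℕ) where
  /-- The bilinear form of the twisted translations. -/
  form : PhaseSpace N →L[ℝ] PhaseSpace N →L[ℝ] ℝ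
  /-- The transform. -/
  trans : 𝓢(PhaseSpace N, ℂ) →L[ℂ] 𝓢(PhaseSpace N, ℂ)
  /-- The multiplication. -/
  mul : 𝓢(PhaseSpace N, ℂ) → 𝓢(PhaseSpace N, ℂ) →L[ℂ] 𝓢(PhaseSpace N, ℂ)
  trans_surjective : Function.Surjective trans
  mul_eq_integral : ∀ h g u, mul h g u = ∫ x, g x * twistShift form x (trans h) u ∂phaseMeasure N
  mul_assoc : ∀ f g h, mul (mul f g) h = mul f (mul g h)

/-- Multiplication from the left. -/
def leftSide (N : ℕ) : Side N where
  form := sympCLM N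
  trans := sympFourier N
  mul := mulLeftCLM
  trans_surjective := sympFourier_surjective N
  mul_eq_integral := twistedProduct_eq_integral_left
  mul_assoc := twistedProduct_assoc

/-- Multiplication from the right. -/
def rightSide (N : ℕ) : Side N where
  form := -sympCLM N
  trans := (reflect N).comp (sympFourier N)
  mul := mulRightCLM
  trans_surjective := (reflect_surjective N).comp (sympFourier_surjective N)
  mul_eq_integral := twistedProduct_eq_integral_right
  mul_assoc f g h := (twistedProduct_assoc h g f).symm

/-- Two sides are opposite if their multiplications are. -/
structure Side.IsOpposite {N : ℕ} (s s' : Side N) : Prop where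
  mul_swap : ∀ h g, s.mul h g = s'.mul g h
  twistShift_swap : ∀ h x w, twistShift s.form x (s.trans h) w = twistShift s'.form w (s'.trans h) x

theorem isOpposite_left_right (N : ℕ) : (leftSide N).IsOpposite (rightSide N) :=
  ⟨fun _ _ => rfl, fun h x w => (twistShift_symm (sympFourier N h) x w).symm⟩

theorem Side.IsOpposite.symm {N : ℕ} {s s' : Side N} (h : s.IsOpposite s') : s'.IsOpposite s :=
  ⟨fun f g => (h.mul_swap g f).symm, fun f x w => (h.twistShift_swap f w x).symm⟩

/-! ### Products with a Schwartz function as matrix coefficients -/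

section

variable {N : ℕ}

theorem ofSchwartz_apply (f g : 𝓢(PhaseSpace N, ℂ)) :
    ofSchwartz f g = ∫ x, g x * f x ∂phaseMeasure N :=
  SchwartzMap.toTemperedDistributionCLM_apply_apply (phaseMeasure N) f g

/-- Compactly supported smooth functions are Schwartz functions and already separate locally
integrable functions almost everywhere. -/
theorem eq_of_integral_eq {φ ψ : PhaseSpace N → ℂ} (hφ : Continuous φ) (hψ : Continuous ψ)
    (h : ∀ g : 𝓢(PhaseSpace N, ℂ),
      ∫ x, g x * φ x ∂phaseMeasure N = ∫ x, g x * ψ x ∂phaseMeasure N) : φ = ψ := by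
  refine (Continuous.ae_eq_iff_eq (phaseMeasure N) hφ hψ).1 ?_
  refine ae_eq_of_integral_contDiff_smul_eq hφ.locallyIntegrable hψ.locallyIntegrable
    fun g hg hgc => ?_
  have hg' : HasCompactSupport fun x => (g x : ℂ) :=
    hgc.comp_left (g := ((↑) : ℝ → ℂ)) Complex.ofReal_zero
  have := h (hg'.toSchwartzMap (Complex.ofRealCLM.contDiff.comp hg))
  simpa using! this

namespace Side

variable (s s' : Side N)

/-- The function which represents the product of `T` and `h`. -/
def coeff (T : 𝓢'(PhaseSpace N, ℂ)) (h : 𝓢(PhaseSpace N, ℂ)) : PhaseSpace N → ℂ :=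
  matrixCoeff s.form T (s.trans h)

theorem continuous_coeff (T : 𝓢'(PhaseSpace N, ℂ)) (h : 𝓢(PhaseSpace N, ℂ)) :
    Continuous (s.coeff T h) := continuous_matrixCoeff _ _ _

theorem integrable_coeff (T : 𝓢'(PhaseSpace N, ℂ)) (h g : 𝓢(PhaseSpace N, ℂ)) :
    Integrable (fun x => g x * s.coeff T h x) (phaseMeasure N) :=
  (tempered_integral_twistShift s.form T g (s.trans h) (s.mul h g) (s.mul_eq_integral h g)).1

theorem apply_mul (T : 𝓢'(PhaseSpace N, ℂ)) (h g : 𝓢(PhaseSpace N, ℂ)) :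
    T (s.mul h g) = ∫ x, g x * s.coeff T h x ∂phaseMeasure N :=
  (tempered_integral_twistShift s.form T g (s.trans h) (s.mul h g) (s.mul_eq_integral h g)).2

/-- The product of a tempered distribution and a Schwartz function. -/
def distProd (T : 𝓢'(PhaseSpace N, ℂ)) (h : 𝓢(PhaseSpace N, ℂ)) : 𝓢'(PhaseSpace N, ℂ) :=
  PointwiseConvergenceCLM.precomp ℂ (s.mul h) T

theorem distProd_apply (T : 𝓢'(PhaseSpace N, ℂ)) (h g : 𝓢(PhaseSpace N, ℂ)) :
    s.distProd T h g = T (s.mul h g) := rfl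

theorem isGivenBy_coeff (T : 𝓢'(PhaseSpace N, ℂ)) (h : 𝓢(PhaseSpace N, ℂ)) :
    IsGivenBy (s.distProd T h) (s.coeff T h) := fun g => by
  simp only [mul_comm (s.coeff T h _)]
  exact ⟨s.integrable_coeff T h g, s.apply_mul T h g⟩

theorem eq_coeff_of_isGivenBy {T : 𝓢'(PhaseSpace N, ℂ)} {h : 𝓢(PhaseSpace N, ℂ)}
    {φ : PhaseSpace N → ℂ} (hφ : Continuous φ) (hT : IsGivenBy (s.distProd T h) φ) :
    φ = s.coeff T h :=
  eq_of_integral_eq hφ (s.continuous_coeff T h) fun g => by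
    simp only [mul_comm (g _)]
    rw [← (hT g).2, ← (s.isGivenBy_coeff T h g).2]

theorem distProd_eq_ofSchwartz {T : 𝓢'(PhaseSpace N, ℂ)} {h a : 𝓢(PhaseSpace N, ℂ)}
    (ha : ∀ x, a x = s.coeff T h x) : s.distProd T h = ofSchwartz a := by
  ext g
  rw [distProd_apply, apply_mul, ofSchwartz_apply]
  simp only [ha]

variable {s s'}

/-- The transposed form of associativity, for the left side `(T × f) × h = T × (f × h)`. It holds
pointwise, since both functions are continuous. -/
theorem coeff_distProd (T : 𝓢'(PhaseSpace N, ℂ)) (f h : 𝓢(PhaseSpace N, ℂ)) :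
    s.coeff (s.distProd T f) h = s.coeff T (s.mul f h) :=
  eq_of_integral_eq (s.continuous_coeff _ h) (s.continuous_coeff T _) fun g => by
    rw [← apply_mul, ← apply_mul, distProd_apply, s.mul_assoc]

/-- By the symmetry of the kernel, integrating `f` against `K_x` in the variable is the
superposition formula of the opposite side. -/
theorem coeff_ofSchwartz (hs : s.IsOpposite s') (f h : 𝓢(PhaseSpace N, ℂ)) :
    s.coeff (ofSchwartz f) h = s.mul f h := by
  ext x
  rw [coeff, matrixCoeff, ofSchwartz_apply, hs.mul_swap, s'.mul_eq_integral]
  refine integral_congr_ae (Eventually.of_forall fun w => ?_)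
  simp only [hs.twistShift_swap, mul_comm]

end Side

theorem IsBoundedVk.exists_coeff {S : 𝓢'(PhaseSpace N, ℂ)} (hS : IsBoundedVk S) (s : Side N) :
    ∃ A : 𝓢(PhaseSpace N, ℂ) →L[ℂ] 𝓢(PhaseSpace N, ℂ), ∀ h x, A h x = s.coeff S h x := by
  obtain ⟨A, hA⟩ := hS.exists_schwartz s.form
  exact ⟨A.comp s.trans, fun h x => hA (s.trans h) x⟩

theorem IsBoundedVk.mem_moyalAlgebra {S : 𝓢'(PhaseSpace N, ℂ)} (hS : IsBoundedVk S) :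
    S ∈ moyalAlgebra N := by
  refine ⟨fun f => ?_, fun f => ?_⟩
  · obtain ⟨A, hA⟩ := hS.exists_coeff (leftSide N)
    exact ⟨A f, (leftSide N).distProd_eq_ofSchwartz (hA f)⟩
  · obtain ⟨A, hA⟩ := hS.exists_coeff (rightSide N)
    exact ⟨A f, (rightSide N).distProd_eq_ofSchwartz (hA f)⟩

theorem continuous_of_mem_spaceOT (φ : spaceOT N) : Continuous φ.1 := by
  obtain ⟨k, hk⟩ := mem_spaceOT.1 φ.2
  exact (hk 0).1.continuous

/-! ### Products with elements of `O_T'` -/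

/-- The tempered distribution `P` is the product of `S` and `T`, defined by transposition. -/
def Side.IsTransposedProduct (s : Side N) (S : OTDual N) (T P : 𝓢'(PhaseSpace N, ℂ)) : Prop :=
  ∀ h : 𝓢(PhaseSpace N, ℂ), ∃ φ : spaceOT N, IsGivenBy (s.distProd T h) φ ∧ P h = S.1 φ

theorem Side.IsTransposedProduct.exists_eq {s : Side N} {S : OTDual N} {T P : 𝓢'(PhaseSpace N, ℂ)}
    (hP : s.IsTransposedProduct S T P) (h : 𝓢(PhaseSpace N, ℂ)) :
    ∃ φ : spaceOT N, φ.1 = s.coeff T h ∧ P h = S.1 φ := by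
  obtain ⟨φ, h1, h2⟩ := hP h
  exact ⟨φ, s.eq_coeff_of_isGivenBy (continuous_of_mem_spaceOT φ) h1, h2⟩

/-- One `k` serves all `h`: the function representing the product of `T` and `h` depends
continuously on `h` in the norms of a single `V_k`, on which `S` is continuous. Uniqueness holds
because a continuous function is determined by its distribution. -/
theorem Side.existsUnique_isTransposedProduct (s : Side N) (S : OTDual N)
    (T : 𝓢'(PhaseSpace N, ℂ)) : ∃! P, s.IsTransposedProduct S T P := by
  refine existsUnique_of_exists_of_unique ?_ fun P Q hP hQ => ?_
  · obtain ⟨r, hr⟩ := exists_norm_matrixCoeff_le s.form T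
    obtain ⟨k, hk⟩ := exists_nat_gt r
    obtain ⟨A, hA, hAb⟩ := exists_seminorm_matrixCoeff_le s.form hr hk
    obtain ⟨m, C, hC, hS⟩ := S.exists_bound (spaceVk_le_spaceOT N k) (continuous_inclusion_OT N k)
    obtain ⟨q, hq, hqb⟩ := hAb m
    let l : 𝓢(PhaseSpace N, ℂ) →ₗ[ℂ] ℂ :=
      ((S.1.comp (Submodule.inclusion (spaceVk_le_spaceOT N k))).comp A).comp s.trans.toLinearMap
    have hl : Continuous l := by
      refine WithSeminorms.continuous_of_continuous_comp (q := fun _ : Fin 1 => normSeminorm ℂ ℂ)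
        (norm_withSeminorms ℂ ℂ) l fun _ => Seminorm.continuous_of_le
        (q := C.toNNReal • q.comp s.trans.toLinearMap)
        ((hq.comp s.trans.continuous).const_smul C.toNNReal) fun h => ?_
      rw [smul_apply, NNReal.smul_def, smul_eq_mul, Real.coe_toNNReal _ hC]
      exact (hS _).trans (mul_le_mul_of_nonneg_left (hqb _) hC)
    exact ⟨ContinuousLinearMap.toPointwiseConvergenceCLM ℂ (RingHom.id ℂ) 𝓢(PhaseSpace N, ℂ) ℂ
      ⟨l, hl⟩, fun h => ⟨Submodule.inclusion (spaceVk_le_spaceOT N k) (A (s.trans h)), by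
        rw [Submodule.coe_inclusion, hA]
        exact s.isGivenBy_coeff T h, rfl⟩⟩
  · ext h
    obtain ⟨φ, h1, h2⟩ := hP.exists_eq h
    obtain ⟨ψ, h3, h4⟩ := hQ.exists_eq h
    rw [h2, h4, Subtype.ext (h1.trans h3.symm)]

/-- The product of the Schwartz functions `h` and `g` is itself the required function in `O_T`, and
`S` takes the same value on it as its restriction `S.toTempered`. -/
theorem Side.isTransposedProduct_ofSchwartz {s s' : Side N} (hs : s.IsOpposite s') (S : OTDual N)
    {h a : 𝓢(PhaseSpace N, ℂ)} (ha : s.distProd S.toTempered h = ofSchwartz a) :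
    s.IsTransposedProduct S (ofSchwartz h) (ofSchwartz a) := fun g => by
  refine ⟨⟨s.mul h g, schwartz_mem_spaceOT _⟩, ?_, ?_⟩
  · have h1 := s.isGivenBy_coeff (ofSchwartz h) g
    rwa [coeff_ofSchwartz hs] at h1
  · rw [← ha]
    rfl

/-- Elements of `O_T'` commute with superpositions of twisted translates whose coefficients have
polynomial growth. -/
theorem OTDual.apply_integral_twistShift (S : OTDual N)
    (B : PhaseSpace N →L[ℝ] PhaseSpace N →L[ℝ] ℝ) {r C : ℝ} {ρ : PhaseSpace N → ℂ}
    (hρ : Continuous ρ) (hC : ∀ x, ‖ρ x‖ ≤ C * weight r x) (φ : 𝓢(PhaseSpace N, ℂ)) {Φ : spaceOT N}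
    (hmem : ∀ k : ℕ, r < k → Φ.1 ∈ spaceVk N k)
    (hΦ : ∀ u, Φ.1 u = ∫ x, ρ x * twistShift B x φ u ∂phaseMeasure N) :
    S.1 Φ = ∫ x, ρ x * matrixCoeff B S.toTempered φ x ∂phaseMeasure N := by
  -- In `V_k` the translates have norm `O((1 + x²)^{-k})`, so `r - k < -N` makes the superposition
  -- absolutely convergent there.
  obtain ⟨k, hk⟩ := exists_nat_gt (r + N)
  have hN : (0 : ℝ) ≤ N := by positivity
  have hΦk := hmem k (by linarith)
  obtain ⟨m, C', -, hS⟩ := S.exists_bound (spaceVk_le_spaceOT N k) (continuous_inclusion_OT N k)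
  exact (Moyal.apply_integral_twistShift B
    (Submodule.inclusion (iInf_le (fun m => spaceVkm N k m) m))
    (S.1.comp (Submodule.inclusion (spaceVk_le_spaceOT N k))) hS (schwartzVk N k) (fun φ => rfl)
    (r := -k) (b := r) (fun j _ => by linarith) (by linarith) hρ hC φ ⟨Φ.1, hΦk⟩ hΦ).2

/-- The Fubini theorem for the functionals `S` and `T`. -/
theorem Side.IsTransposedProduct.apply_eq {s s' : Side N} (hs : s.IsOpposite s') {S : OTDual N}
    {T P : 𝓢'(PhaseSpace N, ℂ)} (hP : s'.IsTransposedProduct S T P)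
    {A : 𝓢(PhaseSpace N, ℂ) →L[ℂ] 𝓢(PhaseSpace N, ℂ)} (hA : ∀ h x, A h x = s.coeff S.toTempered h x)
    (h : 𝓢(PhaseSpace N, ℂ)) : P h = T (A h) := by
  -- For the left side this is `S × (f × g) = (S × f) × g`.
  have hA_mul (f g : 𝓢(PhaseSpace N, ℂ)) : A (s.mul f g) = s.mul (A f) g := by
    have h1 : s.distProd S.toTempered f = ofSchwartz (A f) := s.distProd_eq_ofSchwartz (hA f)
    ext x
    rw [hA, ← coeff_distProd, h1, coeff_ofSchwartz hs]
  have hT_mul (f g : 𝓢(PhaseSpace N, ℂ)) : T (A (s.mul f g)) =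
      ∫ x, s'.coeff T g x * s.coeff S.toTempered f x ∂phaseMeasure N := by
    rw [hA_mul, hs.mul_swap, s'.apply_mul]
    simp only [hA, mul_comm]
  -- For the left side, `(f × g) × T = f × (g × T)` is a superposition of translates of `Ff` with
  -- coefficients `(g × T)(x)`, and `S` is applied under the integral.
  have hP_mul (f g : 𝓢(PhaseSpace N, ℂ)) : P (s.mul f g) =
      ∫ x, s'.coeff T g x * s.coeff S.toTempered f x ∂phaseMeasure N := by
    obtain ⟨φ, hφ, hPφ⟩ := hP.exists_eq (s.mul f g)
    obtain ⟨r, hr⟩ := exists_norm_matrixCoeff_le s'.form T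
    obtain ⟨q, hq, hqb⟩ := hr
    rw [hPφ]
    refine S.apply_integral_twistShift s.form (r := r) (C := q (s'.trans g))
      (s'.continuous_coeff T g) (fun x => ?_) (s.trans f) (fun k hk => ?_) fun u => ?_
    · rw [mul_comm]
      exact hqb (s'.trans g) x
    · obtain ⟨A', hA', -⟩ := exists_seminorm_matrixCoeff_le s'.form ⟨q, hq, hqb⟩ hk
      rw [hφ]
      have := (A' (s'.trans (s.mul f g))).2
      rwa [hA'] at this
    · rw [hφ, hs.mul_swap, ← coeff_distProd]
      rw [coeff, matrixCoeff, distProd_apply, s'.apply_mul]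
      simp only [hs.twistShift_swap, mul_comm]
  -- Continuity of `A` makes the difference a tempered distribution, which by now vanishes on all
  -- products.
  let D : 𝓢'(PhaseSpace N, ℂ) := P - PointwiseConvergenceCLM.precomp ℂ A T
  have hD (g : 𝓢(PhaseSpace N, ℂ)) : D g = P g - T (A g) := rfl
  have hD0 (f : 𝓢(PhaseSpace N, ℂ)) : s.coeff D f = fun _ => 0 :=
    eq_of_integral_eq (s.continuous_coeff D f) continuous_const fun g => by
      rw [← apply_mul, hD, hT_mul, hP_mul]
      simp
  obtain ⟨f, rfl⟩ := s.trans_surjective h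
  -- The translation with parameter zero is the identity, so the vanishing coefficient at `0` is the
  -- value of `D` at the transform of `f`.
  have h1 := congrFun (hD0 f) 0
  rw [coeff, matrixCoeff, twistShift_zero, hD] at h1
  exact sub_eq_zero.1 h1

end

end

end Moyal

/-! ### The theorem -/

theorem theorem4 (N : ℕ) :
    -- the spaces `E_2'`, `O_M'` and `O_T'` are contained in the Moyal algebra
    (∀ S : SmoothDual N, S.toTempered ∈ moyalAlgebra N) ∧
    (∀ S : OMDual N, S.toTempered ∈ moyalAlgebra N) ∧
    (∀ S : OTDual N, S.toTempered ∈ moyalAlgebra N) ∧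
    -- transposition defines the twisted products `S × T` and `T × S` in `S_2'`
    (∀ (S : OTDual N) (T : 𝓢'(PhaseSpace N, ℂ)),
      (∃! P : 𝓢'(PhaseSpace N, ℂ), IsProductLeft S T P) ∧
      (∃! P : 𝓢'(PhaseSpace N, ℂ), IsProductRight T S P)) ∧
    -- `S × h = a` and `h × S = b` are Schwartz functions, these products agree with the products
    -- defined by transposition, and `⟨T × S, h⟩ = ⟨T, S × h⟩`, `⟨S × T, h⟩ = ⟨T, h × S⟩`
    (∀ (S : OTDual N) (h : 𝓢(PhaseSpace N, ℂ)), ∃ a b : 𝓢(PhaseSpace N, ℂ),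
      distMul S.toTempered h = ofSchwartz a ∧ mulDist h S.toTempered = ofSchwartz b ∧
      IsProductLeft S (ofSchwartz h) (ofSchwartz a) ∧
      IsProductRight (ofSchwartz h) S (ofSchwartz b) ∧
      ∀ T P : 𝓢'(PhaseSpace N, ℂ),
        (IsProductRight T S P → P h = T a) ∧ (IsProductLeft S T P → P h = T b)) := by
  refine ⟨fun S => S.isBoundedVk.mem_moyalAlgebra, fun S => S.isBoundedVk.mem_moyalAlgebra,
    fun S => S.isBoundedVk.mem_moyalAlgebra, fun S T =>
    ⟨(leftSide N).existsUnique_isTransposedProduct S T,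
      (rightSide N).existsUnique_isTransposedProduct S T⟩, fun S h => ?_⟩
  obtain ⟨A, hA⟩ := S.isBoundedVk.exists_coeff (leftSide N)
  obtain ⟨A', hA'⟩ := S.isBoundedVk.exists_coeff (rightSide N)
  have hs := isOpposite_left_right N
  have ha := (leftSide N).distProd_eq_ofSchwartz (hA h)
  have hb := (rightSide N).distProd_eq_ofSchwartz (hA' h)
  exact ⟨A h, A' h, ha, hb, Side.isTransposedProduct_ofSchwartz hs S ha,
    Side.isTransposedProduct_ofSchwartz hs.symm S hb, fun T P =>
    ⟨fun hP => Side.IsTransposedProduct.apply_eq hs (s' := rightSide N) hP hA h,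
      fun hP => Side.IsTransposedProduct.apply_eq hs.symm (s' := leftSide N) hP hA' h⟩⟩
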